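/- Let $\mathbb K=\mathbb R$ or $\mathbb C$, $n\ge 3$, and let $\mathcal F$ be one of the following algebras of functions on $\mathbb K^n$ at $0$, with the usual partial derivatives $\partial_i=\partial/\partial x_i$: formal power series over $\mathbb K$; germs at $0$ of analytic functions (holomorphic if $\mathbb K=\mathbb C$); or, if $\mathbb K=\mathbb R$, germs at $0$ of $C^\infty$ functions. Let $\mathcal X$ and $\Omega^k$ be the corresponding spaces of vector fields and of $k$-forms, and $\omega=dx_1\wedge\dots\wedge dx_n$. Let $w_1,\dots,w_n$ be positive integers; the degree of a monomial $x^a$ is $\sum_i a_iw_i$, and a polynomial is quasihomogeneous of degree $d\in\mathbb Z$ if all its monomials have degree $d$ (so $0$ is quasihomogeneous of every degree). Let $f\in\mathbb K[x_1,\dots,x_n]$ be quasihomogeneous of degree $N$ and of finite codimension, i.e. $c=\dim_{\mathbb K}Q_f<\infty$, where $Q_f=\mathcal F/(\partial_1f,\dots,\partial_nf)$. Let $\mathcal B$ be a finite set of monomials whose classes form a basis of $Q_f$. Let $r_j$ be the number of elements of $\mathcal B$ of degree $jN-\sum_iw_i$, and $s$ the dimension of the space of quasihomogeneous polynomials of degree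 $N-\sum_iw_i$. Put $d_f\alpha=f\,d\alpha-k\,df\wedge\alpha$ for $\alpha\in\Omega^k$ and $B^n_f=d_f(\Omega^{n-1})$. Let $\Lambda=f\,\partial_1\wedge\dots\wedge\partial_n$, let $\#\alpha=i_\alpha\Lambda=\Lambda(\alpha,\bullet)\in\mathcal X$ for $\alpha\in\Omega^{n-1}$, and put $[\![\alpha,\beta]\!]=\mathcal L_{\#\alpha}\beta+(-1)^n(i_{d\alpha}\Lambda)\beta$. The Nambu-Poisson cohomology $H^\bullet_{NP}(\mathbb K^n,\Lambda)$ is the cohomology of the complex of alternating $\mathcal F$-multilinear maps $c:(\Omega^{n-1})^k\to\mathcal F$ with differential $$\partial c(\alpha_0,\dots,\alpha_k)=\sum_i(-1)^i(\#\alpha_i).c(\dots,\widehat{\alpha_i},\dots)+\sum_{i<j}(-1)^{i+j}c([\![\alpha_i,\alpha_j]\!],\dots,\widehat{\alpha_i},\dots,\widehat{\alpha_j},\dots).$$ Then for every $\alpha\in\Omega^n$ there are unique polynomials $h_1,\dots,h_n$ (possibly zero) such that - $h_1$ is quasihomogeneous of degree $N-\sum_iw_i$; - for $2\le j\le n-1$,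 $h_j$ is a linear combination of elements of $\mathcal B$ of degree $jN-\sum_iw_i$; - $h_n$ is a linear combination of elements of $\mathcal B$; - $\alpha\equiv(h_n+fh_{n-1}+\dots+f^{n-1}h_1)\,\omega\pmod{B^n_f}$. In particular, $H^n_{NP}(\mathbb K^n,\Lambda)$ is finite-dimensional, of dimension $c+r_{n-1}+\dots+r_2+s$. -/

import Mathlib

open Filter Topology
open scoped ContDiff

noncomputable section

namespace NambuPoisson

/-! ### Vector fields and differential forms over an algebra of functions

`F` is an algebra of (germs of) functions in `n` coordinates, `D i` the partial derivative
`∂/∂xᵢ` on `F`.  A vector field is the tuple of its components. A `k`-form is an alternating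
`F`-multilinear map on vector fields. -/

/-- Vector fields `∑ Xᵢ ∂/∂xᵢ`. -/
abbrev VField (F : Type) (n : ℕ) : Type := Fin n → F

/-- Differential `k`-forms in `n` coordinates. -/
abbrev DForm (F : Type) [CommRing F] (n k : ℕ) : Type := VField F n [⋀^Fin k]→ₗ[F] F

section Calculus

variable {𝕜 F : Type} [Field 𝕜] [CommRing F] [Algebra 𝕜 F] {n : ℕ}

/-- The derivation `g ↦ X.g = ∑ Xᵢ ∂g/∂xᵢ` attached to a vector field. -/
def vact (D : Fin n → Derivation 𝕜 F F) (X : VField F n) : Derivation 𝕜 F F := ∑ i, X i • D i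

theorem vact_apply (D : Fin n → Derivation 𝕜 F F) (X : VField F n) (g : F) :
    vact D X g = ∑ i, X i * D i g := by
  have h : ∀ s : Finset (Fin n), (∑ i ∈ s, X i • D i) g = ∑ i ∈ s, X i * D i g := by
    intro s
    induction s using Finset.cons_induction with
    | empty => simp
    | cons a s ha ih => rw [Finset.sum_cons, Finset.sum_cons, Derivation.add_apply, ih]; rfl
  exact h _

/-- The bracket of vector fields. -/
def vbracket (D : Fin n → Derivation 𝕜 F F) (X Y : VField F n) : VField F n :=
  fun i => vact D X (Y i) - vact D Y (X i)

theorem sum_update_update {k : ℕ} (δ : VField F n → VField F n) (α : DForm F n k)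
    (Y : Fin k → VField F n) (i : Fin k) (C : VField F n) :
    ∑ j, α (Function.update (Function.update Y i C) j (δ (Function.update Y i C j))) =
      α (Function.update Y i (δ C)) + ∑ j ∈ Finset.univ.erase i,
        α (Function.update (Function.update Y j (δ (Y j))) i C) := by
  rw [← Finset.add_sum_erase _ _ (Finset.mem_univ i)]
  congr 1
  · rw [Function.update_self, Function.update_idem]
  · refine Finset.sum_congr rfl fun j hj => ?_
    rw [Function.update_of_ne (Finset.ne_of_mem_erase hj),
      Function.update_comm (Finset.ne_of_mem_erase hj)]

/-- The Leibniz extension to forms of an operator `δ` on vector fields lying over a derivation `δ₀`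
of functions:
`(δα)(Y₁, …, Y_k) = δ₀(α(Y₁, …, Y_k)) - ∑ⱼ α(Y₁, …, δYⱼ, …, Y_k)`. -/
def leibnizExt {k : ℕ} (δ₀ : Derivation 𝕜 F F) (δ : VField F n → VField F n)
    (hadd : ∀ Y Z, δ (Y + Z) = δ Y + δ Z) (hsmul : ∀ (a : F) Y, δ (a • Y) = δ₀ a • Y + a • δ Y)
    (α : DForm F n k) : DForm F n k where
  toFun Y := δ₀ (α Y) - ∑ j, α (Function.update Y j (δ (Y j)))
  map_update_add' := by
    intro inst Y i A B
    obtain rfl : inst = instDecidableEqFin k := Subsingleton.elim _ _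
    simp only [sum_update_update, hadd, AlternatingMap.map_update_add, map_add,
      Finset.sum_add_distrib]
    ring
  map_update_smul' := by
    intro inst Y i a A
    obtain rfl : inst = instDecidableEqFin k := Subsingleton.elim _ _
    simp only [sum_update_update, hsmul, AlternatingMap.map_update_add,
      AlternatingMap.map_update_smul, smul_eq_mul, Derivation.leibniz, ← Finset.mul_sum]
    ring
  map_eq_zero_of_eq' := by
    intro Y i j hY hij
    have h0 : ∀ l ∈ Finset.univ, l ∉ ({i, j} : Finset (Fin k)) →
        α (Function.update Y l (δ (Y l))) = 0 := by
      intro l _ hl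
      simp only [Finset.mem_insert, Finset.mem_singleton, not_or] at hl
      refine α.map_eq_zero_of_eq _ ?_ hij
      rw [Function.update_of_ne (Ne.symm hl.1), Function.update_of_ne (Ne.symm hl.2), hY]
    rw [α.map_eq_zero_of_eq Y hY hij, map_zero, zero_sub, neg_eq_zero,
      ← Finset.sum_subset (Finset.subset_univ _) h0, Finset.sum_pair hij]
    have hs : Function.update Y j (δ (Y j)) =
        Function.update Y i (δ (Y i)) ∘ Equiv.swap i j := by
      funext l
      by_cases hli : l = i
      · subst hli; simp [Function.update_of_ne hij, Function.update_of_ne hij.symm, hY]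
      · by_cases hlj : l = j
        · subst hlj; simp [hY]
        · simp [Equiv.swap_apply_of_ne_of_ne hli hlj, hli, hlj]
    rw [hs, AlternatingMap.map_swap _ _ hij, add_neg_cancel]

/-- The derivative `∇_X α` of a form along `X`, coefficient by coefficient. -/
def nabla (D : Fin n → Derivation 𝕜 F F) {k : ℕ} (X : VField F n) (α : DForm F n k) :
    DForm F n k :=
  leibnizExt (vact D X) (fun Y i => vact D X (Y i)) (fun Y Z => by funext i; simp)
    (fun a Y => by funext i; simp; ring) α

/-- The Lie derivative `𝓛_X α`. -/
def lieDeriv (D : Fin n → Derivation 𝕜 F F) {k : ℕ} (X : VField F n) (α : DForm F n k) :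
    DForm F n k :=
  leibnizExt (vact D X) (vbracket D X)
    (fun Y Z => by
      funext i
      simp only [vbracket, vact_apply, Pi.add_apply, map_add, add_mul,
        Finset.sum_add_distrib]
      ring)
    (fun a Y => by
      funext i
      simp [vbracket, vact_apply, mul_assoc, ← Finset.mul_sum]
      ring) α

/-- The exterior derivative
`dα(Y₀, …, Y_k) = ∑ᵢ (-1)ⁱ (∇_{Yᵢ} α)(Y₀, …, Ŷᵢ, …, Y_k)`, i.e. `dα = ∑ᵢ dxᵢ ∧ ∂α/∂xᵢ`. -/
def extD (D : Fin n → Derivation 𝕜 F F) (k : ℕ) : DForm F n k →ₗ[𝕜] DForm F n (k + 1) where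
  toFun α := AlternatingMap.alternatizeUncurryFin
    { toFun := fun X => nabla D X α
      map_add' := fun X X' => by
        ext Y
        have h : ∀ j, (fun i => vact D (X + X') (Y j i)) =
            (fun i => vact D X (Y j i)) + fun i => vact D X' (Y j i) := by
          intro j; funext i; simp [vact_apply, add_mul, Finset.sum_add_distrib]
        simp only [nabla, leibnizExt, AlternatingMap.coe_mk, MultilinearMap.coe_mk,
          AlternatingMap.add_apply, h, AlternatingMap.map_update_add, Finset.sum_add_distrib]
        simp only [vact_apply, Pi.add_apply, add_mul, Finset.sum_add_distrib]
        ring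
      map_smul' := fun a X => by
        ext Y
        have h : ∀ j, (fun i => vact D (a • X) (Y j i)) = a • fun i => vact D X (Y j i) := by
          intro j; funext i; simp [vact_apply, mul_assoc, Finset.mul_sum]
        simp only [nabla, leibnizExt, AlternatingMap.coe_mk, MultilinearMap.coe_mk,
          AlternatingMap.smul_apply, h, AlternatingMap.map_update_smul, ← Finset.smul_sum,
          RingHom.id_apply]
        simp only [vact_apply, Pi.smul_apply, smul_eq_mul, mul_assoc, ← Finset.mul_sum]
        ring }
  map_add' α β := by
    ext Y
    simp only [AlternatingMap.alternatizeUncurryFin_apply, LinearMap.coe_mk, AddHom.coe_mk, nabla,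
      leibnizExt, AlternatingMap.coe_mk, MultilinearMap.coe_mk, AlternatingMap.add_apply, map_add,
      Finset.sum_add_distrib]
    rw [← Finset.sum_add_distrib]
    refine Finset.sum_congr rfl fun i _ => ?_
    rw [← smul_add]
    congr 1
    ring
  map_smul' c α := by
    ext Y
    simp only [AlternatingMap.alternatizeUncurryFin_apply, LinearMap.coe_mk, AddHom.coe_mk, nabla,
      leibnizExt, AlternatingMap.coe_mk, MultilinearMap.coe_mk, AlternatingMap.smul_apply,
      Derivation.map_smul, RingHom.id_apply, ← Finset.smul_sum, ← smul_sub]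
    rw [Finset.smul_sum]
    exact Finset.sum_congr rfl fun i _ => smul_comm _ _ _

/-- The 1-form `dg`, as an `F`-linear map on vector fields. -/
def dfun (D : Fin n → Derivation 𝕜 F F) (g : F) : VField F n →ₗ[F] F where
  toFun X := vact D X g
  map_add' X X' := by simp [vact_apply, add_mul, Finset.sum_add_distrib]
  map_smul' a X := by simp [vact_apply, mul_assoc, Finset.mul_sum]

/-- `θ ∧ α` for a 1-form `θ` and a `k`-form `α`. -/
def wedge₁ {k : ℕ} (θ : VField F n →ₗ[F] F) (α : DForm F n k) : DForm F n (k + 1) :=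
  AlternatingMap.alternatizeUncurryFin (θ.smulRight α)

/-- The volume form `ω = dx₁ ∧ ⋯ ∧ dxₙ`. -/
def vol (F : Type) [CommRing F] (n : ℕ) : DForm F n n := (Pi.basisFun F (Fin n)).det

/-- The operator `d_f α = f dα - k df ∧ α` on `k`-forms. -/
def dOp (D : Fin n → Derivation 𝕜 F F) (f : F) (k : ℕ) : DForm F n k →ₗ[𝕜] DForm F n (k + 1) where
  toFun α := f • extD D k α - (k : F) • wedge₁ (dfun D f) α
  map_add' α β := by
    ext Y
    simp [wedge₁, AlternatingMap.alternatizeUncurryFin_apply, mul_add, Finset.sum_add_distrib]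
    ring
  map_smul' c α := by
    ext Y
    simp only [wedge₁, map_smul, AlternatingMap.sub_apply, AlternatingMap.smul_apply,
      AlternatingMap.alternatizeUncurryFin_apply, LinearMap.smulRight_apply, RingHom.id_apply,
      smul_sub, Finset.smul_sum]
    congr 1
    · exact smul_comm _ _ _
    · refine Finset.sum_congr rfl fun i _ => ?_
      rw [smul_comm c, smul_comm c, smul_comm c]

/-- The space `B_f^{k+1}` of coboundaries of `d_f` among the `(k+1)`-forms. -/
def dOpCoboundaries (D : Fin n → Derivation 𝕜 F F) (f : F) (k : ℕ) :
    Submodule 𝕜 (DForm F n (k + 1)) :=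
  LinearMap.range (dOp D f k)

end Calculus

/-! ### Nambu-Poisson cohomology of an `n`-vector in dimension `n = m + 1` -/

/-- The vector space `Z / (Z ∩ B)`. -/
def Subquotient {𝕜 V : Type} [Field 𝕜] [AddCommGroup V] [Module 𝕜 V] (Z B : Submodule 𝕜 V) : Type :=
  Z ⧸ B.submoduleOf Z

instance {𝕜 V : Type} [Field 𝕜] [AddCommGroup V] [Module 𝕜 V] (Z B : Submodule 𝕜 V) :
    AddCommGroup (Subquotient Z B) :=
  inferInstanceAs (AddCommGroup (Z ⧸ B.submoduleOf Z))

instance {𝕜 V : Type} [Field 𝕜] [AddCommGroup V] [Module 𝕜 V] (Z B : Submodule 𝕜 V) :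
    Module 𝕜 (Subquotient Z B) :=
  inferInstanceAs (Module 𝕜 (Z ⧸ B.submoduleOf Z))

section NambuPoissonCohomology

variable {𝕜 F : Type} [Field 𝕜] [CommRing F] [Algebra 𝕜 F] {m : ℕ}

/-- The `n`-vectors in `n` coordinates: the `n`-th exterior power of the module of vector fields. -/
abbrev TopVector (F : Type) [CommRing F] (n : ℕ) : Type := ⋀[F]^n (VField F n)

/-- The `n`-vector `f ∂/∂x₁ ∧ ⋯ ∧ ∂/∂xₙ`. -/
def topVector {n : ℕ} (f : F) : TopVector F n :=
  f • exteriorPower.ιMulti F n (fun i : Fin n => (Pi.single i 1 : VField F n))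

/-- The function `i_α Λ` obtained by contracting an `n`-form with an `n`-vector. -/
def contract {n : ℕ} (α : DForm F n n) (Λ : TopVector F n) : F :=
  exteriorPower.alternatingMapLinearEquiv α Λ

/-- The anchor `#_Λ α = i_α Λ = Λ(α, •)`: the vector field whose `j`-th component is the contraction
of `Λ` with `α ∧ dxⱼ = (-1)^m dxⱼ ∧ α`, for an `m`-form `α` in dimension `n = m + 1`. -/
def anchor (Λ : TopVector F (m + 1)) (α : DForm F (m + 1) m) : VField F (m + 1) :=
  fun j => (-1) ^ m * contract (wedge₁ (LinearMap.proj j) α) Λ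

/-- The bracket `⟦α, β⟧ = 𝓛_{#α} β + (-1)^n (i_{dα} Λ) β` of `(n-1)`-forms, `n = m + 1`. -/
def npBracket (D : Fin (m + 1) → Derivation 𝕜 F F) (Λ : TopVector F (m + 1))
    (α β : DForm F (m + 1) m) : DForm F (m + 1) m :=
  lieDeriv D (anchor Λ α) β + ((-1) ^ (m + 1) * contract (extD D m α) Λ) • β

/-- The cochains `C^k(Ω^{n-1}; F)`: alternating `F`-multilinear maps on `(n-1)`-forms, `n = m + 1`. -/
abbrev NPCochain (F : Type) [CommRing F] (m k : ℕ) : Type :=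
  DForm F (m + 1) m [⋀^Fin k]→ₗ[F] F

/-- The Nambu-Poisson differential
`∂c(α₀, …, α_k) = ∑ᵢ (-1)ⁱ (#αᵢ).c(α₀, …, α̂ᵢ, …, α_k)
  + ∑_{i<j} (-1)^{i+j} c(⟦αᵢ, αⱼ⟧, α₀, …, α̂ᵢ, …, α̂ⱼ, …, α_k)`.
The value `∂c` is recorded here just as a function of `(α₀, …, α_k)`. In the double sum, the pairs
`i < j` are written as `(i.castSucc, j.succ)` with `i ≤ j`, which accounts for the minus sign. -/
def npDiff (D : Fin (m + 1) → Derivation 𝕜 F F) (Λ : TopVector F (m + 1)) : (k : ℕ) →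
    NPCochain F m k →ₗ[𝕜] ((Fin (k + 1) → DForm F (m + 1) m) → F)
  | 0 =>
    { toFun := fun c α => ∑ i : Fin _, (-1) ^ (i : ℕ) * vact D (anchor Λ (α i)) (c (i.removeNth α))
      map_add' := fun c c' => by
        funext α; simp
      map_smul' := fun a c => by
        funext α; simp }
  | k + 1 =>
    { toFun := fun c α =>
        ∑ i : Fin _, (-1) ^ (i : ℕ) * vact D (anchor Λ (α i)) (c (i.removeNth α)) -
          ∑ i : Fin (k + 1), ∑ j ≥ i, (-1) ^ (i + j : ℕ) *
            c (Matrix.vecCons (npBracket D Λ (α i.castSucc) (α j.succ))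
              (j.removeNth (i.castSucc.removeNth α)))
      map_add' := fun c c' => by
        funext α
        simp only [AlternatingMap.add_apply, map_add, mul_add, Finset.sum_add_distrib,
          Pi.add_apply]
        ring
      map_smul' := fun a c => by
        funext α
        simp only [AlternatingMap.smul_apply, Derivation.map_smul, mul_smul_comm,
          ← Finset.smul_sum, ← smul_sub, Pi.smul_apply, RingHom.id_apply] }

/-- The cocycles of degree `k`. -/
def npCocycles (D : Fin (m + 1) → Derivation 𝕜 F F) (Λ : TopVector F (m + 1)) (k : ℕ) :
    Submodule 𝕜 (NPCochain F m k) :=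
  LinearMap.ker (npDiff D Λ k)

/-- The coboundaries: the cochains of the form `∂b`. -/
def npCoboundaries (D : Fin (m + 1) → Derivation 𝕜 F F) (Λ : TopVector F (m + 1)) : (k : ℕ) →
    Submodule 𝕜 (NPCochain F m k)
  | 0 => ⊥
  | k + 1 =>
    { carrier := {c | ∃ b : NPCochain F m k, ∀ α, c α = npDiff D Λ k b α}
      add_mem' := by
        rintro c c' ⟨b, hb⟩ ⟨b', hb'⟩
        exact ⟨b + b', fun α => by simp [hb, hb']⟩
      zero_mem' := ⟨0, fun α => by simp⟩
      smul_mem' := by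
        rintro a c ⟨b, hb⟩
        exact ⟨a • b, fun α => by simp [hb]⟩ }

/-- The Nambu-Poisson cohomology `H^k_NP`: cocycles modulo coboundaries. -/
abbrev NPCohomology (D : Fin (m + 1) → Derivation 𝕜 F F) (Λ : TopVector F (m + 1)) (k : ℕ) : Type :=
  Subquotient (npCocycles D Λ k) (npCoboundaries D Λ k)

end NambuPoissonCohomology

/-! ### The algebras of germs at the origin -/

/-- An algebra of functions with its coordinates and its partial derivatives.  The ones of interest
are singled out in `FunctionAlgebra.IsLocal` below. -/
structure FunctionAlgebra (𝕜 : Type) [Field 𝕜] (n : ℕ) where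
  /-- the functions -/
  carrier : Type
  [commRing : CommRing carrier]
  [algebra : Algebra 𝕜 carrier]
  /-- the coordinate functions -/
  coord : Fin n → carrier
  /-- the partial derivatives -/
  D : Fin n → Derivation 𝕜 carrier carrier

attribute [instance] FunctionAlgebra.commRing FunctionAlgebra.algebra

/-- Formal functions: power series. -/
def formalFunctions (𝕜 : Type) [Field 𝕜] (n : ℕ) : FunctionAlgebra 𝕜 n where
  carrier := MvPowerSeries (Fin n) 𝕜
  coord := MvPowerSeries.X
  D := MvPowerSeries.pderiv 𝕜

section Germs

variable (𝕜 : Type) [RCLike 𝕜] (n : ℕ)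

instance : Algebra 𝕜 (Germ (𝓝 (0 : Fin n → 𝕜)) 𝕜) :=
  Algebra.ofModule
    (fun c φ ψ => by
      induction φ using Germ.inductionOn; induction ψ using Germ.inductionOn
      exact congrArg Germ.ofFun (smul_mul_assoc c _ _))
    (fun c φ ψ => by
      induction φ using Germ.inductionOn; induction ψ using Germ.inductionOn
      exact congrArg Germ.ofFun (mul_smul_comm c _ _))

/-- The germs at `0` of functions of class `C^r` in a neighbourhood of `0` in `𝕜ⁿ`. -/
def germAlg (r : WithTop ℕ∞) : Subalgebra 𝕜 (Germ (𝓝 (0 : Fin n → 𝕜)) 𝕜) where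
  carrier := {φ | ∃ g : (Fin n → 𝕜) → 𝕜, (∀ᶠ x in 𝓝 0, ContDiffAt 𝕜 r g x) ∧ φ = (g : Germ _ 𝕜)}
  mul_mem' := by
    rintro _ _ ⟨g, hg, rfl⟩ ⟨h, hh, rfl⟩
    exact ⟨g * h, by filter_upwards [hg, hh] with x a b using a.mul b, rfl⟩
  add_mem' := by
    rintro _ _ ⟨g, hg, rfl⟩ ⟨h, hh, rfl⟩
    exact ⟨g + h, by filter_upwards [hg, hh] with x a b using a.add b, rfl⟩
  algebraMap_mem' c := ⟨fun _ => c, Eventually.of_forall fun _ => contDiffAt_const, by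
    rw [Algebra.algebraMap_eq_smul_one]
    refine congrArg Germ.ofFun (?_ : c • (1 : (Fin n → 𝕜) → 𝕜) = fun _ => c)
    funext x; simp⟩

variable {𝕜 n}

theorem germ_differentiable {r : WithTop ℕ∞} (hr : r + 1 ≤ r) {g : (Fin n → 𝕜) → 𝕜}
    (hg : ∀ᶠ x in 𝓝 0, ContDiffAt 𝕜 r g x) : ∀ᶠ x in 𝓝 0, DifferentiableAt 𝕜 g x := by
  filter_upwards [hg] with x hx
  refine hx.differentiableAt ?_
  rintro rfl
  simp at hr

variable (𝕜 n)

/-- The partial derivative `∂/∂xᵢ` of germs. -/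
def germDeriv (i : Fin n) (φ : Germ (𝓝 (0 : Fin n → 𝕜)) 𝕜) : Germ (𝓝 (0 : Fin n → 𝕜)) 𝕜 :=
  Germ.map' (fun (g : (Fin n → 𝕜) → 𝕜) x => fderiv 𝕜 g x (Pi.single i 1))
    (fun _ _ h => by
      filter_upwards [EventuallyEq.fderiv (𝕜 := 𝕜) h] with x hx
      rw [hx]) φ

/-- The partial derivative `∂/∂xᵢ` on the germs of class `C^r` (`r = ∞` or `r = ω`). -/
def germPDeriv (r : WithTop ℕ∞) (hr : r + 1 ≤ r) (i : Fin n) :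
    Derivation 𝕜 (germAlg 𝕜 n r) (germAlg 𝕜 n r) :=
  Derivation.mk'
    { toFun := fun φ => ⟨germDeriv 𝕜 n i φ, by
        obtain ⟨_, g, hg, rfl⟩ := φ
        refine ⟨fun x => fderiv 𝕜 g x (Pi.single i 1), ?_, rfl⟩
        filter_upwards [hg] with x hx
        exact (hx.fderiv_right hr).clm_apply contDiffAt_const⟩
      map_add' := by
        rintro ⟨_, g, hg, rfl⟩ ⟨_, h, hh, rfl⟩
        refine Subtype.ext (Germ.coe_eq.2 ?_)
        filter_upwards [germ_differentiable hr hg, germ_differentiable hr hh] with x a b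
        exact congrArg (fun L => L (Pi.single i 1)) (fderiv_add a b)
      map_smul' := by
        rintro c ⟨_, g, hg, rfl⟩
        refine Subtype.ext (Germ.coe_eq.2 ?_)
        filter_upwards [germ_differentiable hr hg] with x a
        exact congrArg (fun L => L (Pi.single i 1)) (fderiv_const_smul a c) }
    (by
      rintro ⟨_, g, hg, rfl⟩ ⟨_, h, hh, rfl⟩
      refine Subtype.ext (Germ.coe_eq.2 ?_)
      filter_upwards [germ_differentiable hr hg, germ_differentiable hr hh] with x a b
      exact congrArg (fun L => L (Pi.single i 1)) (fderiv_mul a b))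

/-- The algebra of germs at `0` of `C^r` functions on `𝕜ⁿ` (`r = ∞` or `r = ω`). -/
def germFunctions (r : WithTop ℕ∞) (hr : r + 1 ≤ r) : FunctionAlgebra 𝕜 n where
  carrier := germAlg 𝕜 n r
  coord i := ⟨((fun x : Fin n → 𝕜 => x i : (Fin n → 𝕜) → 𝕜) : Germ (𝓝 (0 : Fin n → 𝕜)) 𝕜),
    fun x => x i, Eventually.of_forall fun _ => contDiffAt_apply 𝕜 𝕜 i _, rfl⟩
  D := germPDeriv 𝕜 n r hr

/-- Germs at `0` of analytic functions (real analytic over `ℝ`, holomorphic over `ℂ`). -/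
def analyticFunctions : FunctionAlgebra 𝕜 n := germFunctions 𝕜 n ω le_rfl

/-- Germs at `0` of real `C^∞` functions. -/
def smoothFunctions (n : ℕ) : FunctionAlgebra ℝ n := germFunctions ℝ n ∞ le_rfl

end Germs

/-- The algebra of functions `𝓕(𝕜ⁿ)` is one of: formal, analytic (holomorphic if `𝕜 = ℂ`), or
`C^∞` with `𝕜 = ℝ`. -/
inductive FunctionAlgebra.IsLocal {n : ℕ} :
    ∀ {𝕜 : Type} [RCLike 𝕜], FunctionAlgebra 𝕜 n → Prop
  | formal (𝕜 : Type) [RCLike 𝕜] : IsLocal (formalFunctions 𝕜 n)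
  | analytic (𝕜 : Type) [RCLike 𝕜] : IsLocal (analyticFunctions 𝕜 n)
  | smooth : IsLocal (smoothFunctions n)

/-! ### Quasihomogeneous polynomials, the algebra `Q_f` and monomial bases -/

section Quasi

variable {𝕜 : Type} [Field 𝕜] {n : ℕ}

/-- `p` is quasihomogeneous of degree `d ∈ ℤ` for the weights `w` (`p = 0` is allowed). -/
abbrev IsQuasihomogeneous (w : Fin n → ℕ) (p : MvPolynomial (Fin n) 𝕜) (d : ℤ) : Prop :=
  MvPolynomial.IsWeightedHomogeneous (fun i => (w i : ℤ)) p d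

/-- The space of quasihomogeneous polynomials of degree `d`. -/
abbrev quasihomogeneousPolys (𝕜 : Type) [Field 𝕜] (w : Fin n → ℕ) (d : ℤ) :
    Submodule 𝕜 (MvPolynomial (Fin n) 𝕜) :=
  MvPolynomial.weightedHomogeneousSubmodule 𝕜 (fun i => (w i : ℤ)) d

/-- The quasidegree of the monomial `x^a`. -/
def monomialDegree (w : Fin n → ℕ) (a : Fin n →₀ ℕ) : ℤ := ∑ i, (a i : ℤ) * w i

/-- The space of linear combinations of the monomials `x^a`, `a ∈ S`. -/
def monomialSpan (𝕜 : Type) [Field 𝕜] (S : Set (Fin n →₀ ℕ)) :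
    Submodule 𝕜 (MvPolynomial (Fin n) 𝕜) :=
  Submodule.span 𝕜 ((fun a => MvPolynomial.monomial a (1 : 𝕜)) '' S)

/-- A polynomial as an element of the algebra of functions. -/
def FunctionAlgebra.ofPoly (A : FunctionAlgebra 𝕜 n) : MvPolynomial (Fin n) 𝕜 →ₐ[𝕜] A.carrier :=
  MvPolynomial.aeval A.coord

/-- The ideal `I_f` generated by the partial derivatives of `f`. -/
def FunctionAlgebra.gradIdeal (A : FunctionAlgebra 𝕜 n) (f : A.carrier) : Ideal A.carrier :=
  Ideal.span (Set.range fun i => A.D i f)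

/-- `Q_f = 𝓕 / I_f`. -/
abbrev FunctionAlgebra.Q (A : FunctionAlgebra 𝕜 n) (f : A.carrier) : Type :=
  A.carrier ⧸ A.gradIdeal f

/-- The monomials with exponents in `B` form a basis of the vector space `Q_f`. -/
def FunctionAlgebra.IsMonomialBasis (A : FunctionAlgebra 𝕜 n) (f : A.carrier)
    (B : Finset (Fin n →₀ ℕ)) : Prop :=
  let v : B → A.Q f :=
    fun a => Ideal.Quotient.mk (A.gradIdeal f) (A.ofPoly (MvPolynomial.monomial a.1 1))
  LinearIndependent 𝕜 v ∧ Submodule.span 𝕜 (Set.range v) = ⊤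

end Quasi

end NambuPoisson

end

/-!
Contraction with the volume form `ω` identifies vector fields with `(n-1)`-forms, and under this
identification everything becomes a statement about the operator `T X = f div X - (n-1) X.f` on
vector fields: `d_f (i_X ω) = (T X) ω` (`dOp_interiorVol`), and the Nambu-Poisson differential is
`± d_f` (`npDiff_interiorVol`), so that the cohomology in degree `n` is the space of `n`-forms
modulo `d_f`-coboundaries (`npCohomologyEquiv`). It remains to find a normal form of a function
modulo the image of `T`.

The tool is the Euler field `W = ∑ wᵢ xᵢ ∂/∂xᵢ`, which acts on quasihomogeneous polynomials of
degree `d` as multiplication by `d` and has divergence `∑ wᵢ`. In each of the three algebras the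
equation `W h + μ h = g` has a solution for `μ ≥ 1`: termwise for power series, and `h(x) = ∫₀¹
t^{μ-1} g(t^{w₁} x₁, …, t^{wₙ} xₙ) dt` for germs (`euler_dilationMean`), where smoothness follows
by differentiation under the integral and analyticity by integrating the power series. The same
means give Hadamard's lemma. These properties are collected in `FunctionAlgebra.EulerSolvable`;
everything else is algebra, valid over any field of characteristic zero.

*Existence.* Modulo the gradient ideal, `g = b + Y.f` with `b` a combination of basis monomials,
and `Y.f` is equivalent to `f div Y / (n-1)`. Since `T (u W) = f (W u - d u)` with `d = (n-1) N -
∑ wᵢ`, the factor `div Y / (n-1)` may be replaced by a quasihomogeneous polynomial of degree `d`.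
The argument is now repeated: if `q` has degree `kN - ∑ wᵢ` and `q = b + Y.f`, then `f^{n-k} Y.f`
is equivalent to a multiple of `f^{n-k+1} div Y`, as `T (f^{n-k} Y)` shows, and `div Y` has degree
`(k-1)N - ∑ wᵢ`. It stops at `k = 1`, when the coefficient `k - 1` in `T (f^{n-k} Y)` is zero
(`exists_normalForm`).

*Uniqueness.* Let `h_n + f G` be in the image of `T`, with `G = h_{n-1} + … + f^{n-2} h_1`. As `f`
is in the gradient ideal, so is `h_n`, whence `h_n = 0`. The term `f G` is quasihomogeneous, so it
is `T x` with `x` polynomial; subtracting from `x` a multiple of `W` yields a field that kills `f`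
and has divergence `G`. As the derivatives of `f` generate an ideal containing a power of each
variable, the Koszul complex is exact in degree one (`exists_antisymm_of_regular`), and a field
killing `f` has a divergence of the form `Z.f` with `div Z = 0` (`exists_divergence_eq_vact`).
Hence `h_{n-1}` is in the gradient ideal and vanishes, and then `Z` minus a multiple of `W` kills
`f` and has for divergence a multiple of the next partial sum, so the argument repeats
(`eq_zero_of_sum_eq_vact`). At the end `h_1 = Z.f` with `Z` of negative degree `-∑ wᵢ`, which
forces `h_1 = 0`.
-/

noncomputable section

namespace NambuPoisson

/-! ### Forms, vector fields and the top cohomology -/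

section Forms

variable {𝕜 F : Type} [Field 𝕜] [CommRing F] [Algebra 𝕜 F]

theorem extD_apply {n k : ℕ} (D : Fin n → Derivation 𝕜 F F) (α : DForm F n k)
    (Y : Fin (k + 1) → VField F n) :
    extD D k α Y = ∑ i : Fin (k + 1), (-1) ^ (i : ℕ) * (vact D (Y i) (α (i.removeNth Y)) -
      ∑ j, α (Function.update (i.removeNth Y) j
        (fun l => vact D (Y i) (i.removeNth Y j l)))) := by
  simp only [extD, LinearMap.coe_mk, AddHom.coe_mk, AlternatingMap.alternatizeUncurryFin_apply,
    zsmul_eq_mul, Int.cast_pow, Int.cast_neg, Int.cast_one, nabla, leibnizExt,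
    AlternatingMap.coe_mk, MultilinearMap.coe_mk]

theorem wedge₁_apply {n k : ℕ} (θ : VField F n →ₗ[F] F) (α : DForm F n k)
    (Y : Fin (k + 1) → VField F n) :
    wedge₁ θ α Y = ∑ i : Fin (k + 1), (-1) ^ (i : ℕ) * (θ (Y i) * α (i.removeNth Y)) := by
  simp [wedge₁, AlternatingMap.alternatizeUncurryFin_apply]

theorem dOp_apply {n k : ℕ} (D : Fin n → Derivation 𝕜 F F) (f : F) (α : DForm F n k)
    (Y : Fin (k + 1) → VField F n) :
    dOp D f k α Y = f * extD D k α Y - k * wedge₁ (dfun D f) α Y := rfl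

/-- Moving the replaced argument to the front turns the sum over an argument `i` and a position
among the remaining ones into a sum over pairs of arguments. -/
theorem sum_pairs_antisymmetrization {V : Type} [AddCommGroup V] [Module F V] {k : ℕ}
    (c : V [⋀^Fin (k + 1)]→ₗ[F] F) (X : Fin (k + 2) → V) (δ : V → V → V) :
    ∑ i : Fin (k + 1), ∑ j ≥ i, (-1) ^ (i + j : ℕ) *
        c (Matrix.vecCons (δ (X i.castSucc) (X j.succ) - δ (X j.succ) (X i.castSucc))
          (j.removeNth (i.castSucc.removeNth X))) =
      ∑ i : Fin (k + 2), (-1) ^ (i : ℕ) *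
        ∑ l, c (Function.update (i.removeNth X) l (δ (X i) (i.removeNth X l))) := by
  symm
  simp only [Finset.mul_sum]
  rw [Fin.sum_sum_eq_sum_triangle_add]
  refine Fintype.sum_congr _ _ fun i ↦ Finset.sum_congr rfl fun j hj ↦ ?_
  rw [Finset.mem_Ici] at hj
  simp only [← Fin.insertNth_removeNth, AlternatingMap.map_insertNth]
  rw [Fin.removeNth_removeNth_eq_swap]
  have H₁ : i.castSucc.succAbove j = j.succ := by simp [Fin.succAbove_of_le_castSucc, hj]
  have H₂ : j.predAbove i.castSucc = i := by simp [Fin.predAbove_of_le_castSucc, hj]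
  have H₃ : j.succ.succAbove i = i.castSucc := by simp [Fin.succAbove_of_castSucc_lt, hj]
  have H₄ : ∀ (x y : V) (z : Fin k → V),
      c (Matrix.vecCons (x - y) z) = c (Matrix.vecCons x z) - c (Matrix.vecCons y z) :=
    fun x y z => by
      rw [sub_eq_add_neg, AlternatingMap.map_vecCons_add, ← neg_one_smul F y,
        AlternatingMap.map_vecCons_smul]
      simp [sub_eq_add_neg]
  simp only [H₄, H₁, H₂, H₃, Fin.removeNth, pow_add, Fin.val_castSucc, Fin.val_succ, pow_one,
    zsmul_eq_mul, Int.cast_pow, Int.cast_neg, Int.cast_one]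
  ring

/-- The coordinate frame `∂/∂x₁, …, ∂/∂xₙ`. -/
def frame (F : Type) [CommRing F] (n : ℕ) : Fin n → VField F n := fun j => Pi.single j 1

theorem frame_eq_basisFun (n : ℕ) : frame F n = Pi.basisFun F (Fin n) := by
  funext l; simp [frame]

theorem vfield_eq_sum_frame {n : ℕ} (X : VField F n) : X = ∑ l, X l • frame F n l := by
  funext a
  simp [Finset.sum_apply, Pi.single_apply, frame]

theorem vol_frame (n : ℕ) : vol F n (frame F n) = 1 := by
  rw [frame_eq_basisFun, vol, Module.Basis.det_self]

theorem dform_top_ext {n : ℕ} {α β : DForm F n n} (h : α (frame F n) = β (frame F n)) :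
    α = β := by
  rw [frame_eq_basisFun] at h
  rw [α.eq_smul_basis_det (Pi.basisFun F (Fin n)), β.eq_smul_basis_det (Pi.basisFun F (Fin n)), h]

theorem vol_update_frame {n : ℕ} (X : VField F n) (i : Fin n) :
    vol F n (Function.update (frame F n) i X) = X i := by
  conv_lhs => rw [vfield_eq_sum_frame X]
  rw [AlternatingMap.map_update_sum]
  simp only [AlternatingMap.map_update_smul]
  rw [Finset.sum_eq_single i]
  · rw [Function.update_eq_self, vol_frame, smul_eq_mul, mul_one]
  · intro l _ hl
    rw [AlternatingMap.map_eq_zero_of_eq _ _ (i := i) (j := l)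
      (by simp [Function.update_of_ne hl]) hl.symm, smul_zero]
  · simp

variable {m : ℕ}

/-- An `m`-form in dimension `m + 1` is determined by its values on the coordinate frame with one
vector left out. -/
theorem dform_codim_one_ext {α β : DForm F (m + 1) m}
    (h : ∀ i : Fin (m + 1), α (i.removeNth (frame F (m + 1))) =
      β (i.removeNth (frame F (m + 1)))) : α = β := by
  refine Module.Basis.ext_alternating (Pi.basisFun F (Fin (m + 1))) fun v hv => ?_
  obtain ⟨i, hi⟩ : ∃ i, i ∉ Set.range v := by
    by_contra! hc
    have := Fintype.card_le_of_surjective v hc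
    simp at this
  have hex : ∀ l, ∃ l', i.succAbove l' = v l := fun l =>
    Fin.exists_succAbove_eq (fun h => hi ⟨l, h⟩)
  choose σ hσ using hex
  have hinj : Function.Injective σ := fun a b hab => hv (by rw [← hσ, ← hσ, hab])
  let e : Equiv.Perm (Fin m) := Equiv.ofBijective σ (Finite.injective_iff_bijective.1 hinj)
  have hve : (fun l => Pi.basisFun F (Fin (m + 1)) (v l)) =
      (i.removeNth (frame F (m + 1))) ∘ e := by
    funext l
    simp only [Function.comp, Fin.removeNth, e, Equiv.ofBijective_apply, hσ, frame_eq_basisFun]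
  rw [hve, AlternatingMap.map_perm, AlternatingMap.map_perm, h]

theorem vol_vecCons_removeNth_frame (X : VField F (m + 1)) (i : Fin (m + 1)) :
    vol F (m + 1) (Matrix.vecCons X (i.removeNth (frame F (m + 1)))) = (-1) ^ (i : ℕ) * X i := by
  rw [← AlternatingMap.neg_one_pow_smul_map_insertNth, Fin.insertNth_removeNth, vol_update_frame]
  simp

/-- The isomorphism `X ↦ i_X ω` between vector fields and `(n-1)`-forms, `n = m + 1`. -/
def interiorVol (F : Type) [CommRing F] (m : ℕ) : VField F (m + 1) ≃ₗ[F] DForm F (m + 1) m where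
  toLinearMap := (vol F (m + 1)).curryLeft
  invFun β := fun i => (-1) ^ (i : ℕ) * β (i.removeNth (frame F (m + 1)))
  left_inv X := by
    funext i
    change (-1) ^ (i : ℕ) * vol F (m + 1) (Matrix.vecCons X (i.removeNth (frame F (m + 1)))) = _
    rw [vol_vecCons_removeNth_frame, ← mul_assoc, ← mul_pow]
    simp
  right_inv β := dform_codim_one_ext fun i => by
    change vol F (m + 1) (Matrix.vecCons _ (i.removeNth (frame F (m + 1)))) = _
    rw [vol_vecCons_removeNth_frame, ← mul_assoc, ← mul_pow]
    simp

theorem interiorVol_apply (X : VField F (m + 1)) (Y : Fin m → VField F (m + 1)) :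
    interiorVol F m X Y = vol F (m + 1) (Matrix.vecCons X Y) := rfl

theorem interiorVol_frame (X : VField F (m + 1)) (i : Fin (m + 1)) :
    interiorVol F m X (i.removeNth (frame F (m + 1))) = (-1) ^ (i : ℕ) * X i :=
  vol_vecCons_removeNth_frame X i

/-- The divergence `∑ ∂Xᵢ/∂xᵢ`. -/
def divergence {n : ℕ} (D : Fin n → Derivation 𝕜 F F) (X : VField F n) : F := ∑ i, D i (X i)

theorem vact_smul_left {n : ℕ} (D : Fin n → Derivation 𝕜 F F) (a g : F) (X : VField F n) :
    vact D (a • X) g = a * vact D X g := by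
  simp [vact_apply, mul_assoc, Finset.mul_sum]

theorem divergence_smul {n : ℕ} (D : Fin n → Derivation 𝕜 F F) (a : F) (X : VField F n) :
    divergence D (a • X) = a * divergence D X + vact D X a := by
  simp [divergence, vact_apply, Finset.sum_add_distrib, Finset.mul_sum]

theorem map_neg_one_pow_mul (δ : Derivation 𝕜 F F) (k : ℕ) (g : F) :
    δ ((-1) ^ k * g) = (-1) ^ k * δ g := by
  rcases neg_one_pow_eq_or F k with h | h <;> simp [h]

theorem vact_frame {n : ℕ} (D : Fin n → Derivation 𝕜 F F) (i : Fin n) (g : F) :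
    vact D (frame F n i) g = D i g := by
  simp [vact_apply, Pi.single_apply, frame]

theorem vact_comp_frame {n : ℕ} (D : Fin n → Derivation 𝕜 F F) (X : VField F n) (i l : Fin n) :
    vact D X (frame F n i l) = 0 := by
  by_cases h : l = i
  · subst h; simp [frame]
  · simp [frame, Pi.single_eq_of_ne h]

/-- `d i_X ω = (div X) ω`. -/
theorem extD_interiorVol (D : Fin (m + 1) → Derivation 𝕜 F F) (X : VField F (m + 1)) :
    extD D m (interiorVol F m X) = divergence D X • vol F (m + 1) := by
  refine dform_top_ext ?_
  rw [extD_apply, AlternatingMap.smul_apply, vol_frame, smul_eq_mul, mul_one, divergence]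
  refine Finset.sum_congr rfl fun i _ => ?_
  have h0 : ∀ j, interiorVol F m X (Function.update (i.removeNth (frame F (m + 1))) j
      (fun l => vact D (frame F (m + 1) i) (i.removeNth (frame F (m + 1)) j l))) = 0 := fun j =>
    AlternatingMap.map_coord_zero _ j (by
      rw [Function.update_self]
      funext l
      exact vact_comp_frame D _ _ l)
  rw [Finset.sum_congr rfl fun j _ => h0 j, Finset.sum_const_zero, sub_zero, vact_frame,
    interiorVol_frame]
  rw [map_neg_one_pow_mul, ← mul_assoc, ← mul_pow]
  simp

/-- `θ ∧ i_X ω = θ(X) ω`. -/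
theorem wedge₁_interiorVol (θ : VField F (m + 1) →ₗ[F] F) (X : VField F (m + 1)) :
    wedge₁ θ (interiorVol F m X) = θ X • vol F (m + 1) := by
  refine dform_top_ext ?_
  rw [wedge₁_apply, AlternatingMap.smul_apply, vol_frame, smul_eq_mul, mul_one]
  conv_rhs => rw [vfield_eq_sum_frame X, map_sum]
  refine Finset.sum_congr rfl fun i _ => ?_
  rw [interiorVol_frame, map_smul, smul_eq_mul, mul_left_comm, ← mul_assoc ((-1) ^ (i : ℕ)),
    ← mul_pow]
  simp [mul_comm]

/-- Under `X ↦ i_X ω`, the operator `d_f` becomes `X ↦ f div X - (n-1) X.f`. -/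
theorem dOp_interiorVol (D : Fin (m + 1) → Derivation 𝕜 F F) (f : F) (X : VField F (m + 1)) :
    dOp D f m (interiorVol F m X) =
      (f * divergence D X - m * vact D X f) • vol F (m + 1) := by
  change f • extD D m _ - (m : F) • wedge₁ _ _ = _
  rw [extD_interiorVol, wedge₁_interiorVol, smul_smul, smul_smul, ← sub_smul]
  rfl

theorem contract_topVector {n : ℕ} (α : DForm F n n) (f : F) :
    contract α (topVector f) = f * α (frame F n) := by
  simp [contract, topVector]
  rfl

theorem anchor_interiorVol (f : F) (X : VField F (m + 1)) :
    anchor (topVector f) (interiorVol F m X) = ((-1) ^ m * f) • X := by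
  funext j
  rw [anchor, wedge₁_interiorVol, contract_topVector, AlternatingMap.smul_apply, vol_frame]
  simp [mul_assoc]

theorem lieDeriv_apply {n k : ℕ} (D : Fin n → Derivation 𝕜 F F) (X : VField F n)
    (α : DForm F n k) (Y : Fin k → VField F n) :
    lieDeriv D X α Y = vact D X (α Y) - ∑ j, α (Function.update Y j (vbracket D X (Y j))) := rfl

theorem lieDeriv_vol {n : ℕ} (D : Fin n → Derivation 𝕜 F F) (Z : VField F n) :
    lieDeriv D Z (vol F n) = divergence D Z • vol F n := by
  refine dform_top_ext ?_
  rw [lieDeriv_apply, AlternatingMap.smul_apply, vol_frame, Derivation.map_one_eq_zero,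
    zero_sub, smul_eq_mul, mul_one, divergence, ← Finset.sum_neg_distrib]
  refine Finset.sum_congr rfl fun j _ => ?_
  rw [vol_update_frame, vbracket, vact_comp_frame, vact_frame, zero_sub, neg_neg]

/-- `𝓛_Z i_Y ω = i_{[Z, Y]} ω + div Z · i_Y ω`. -/
theorem lieDeriv_interiorVol (D : Fin (m + 1) → Derivation 𝕜 F F) (Z Y : VField F (m + 1)) :
    lieDeriv D Z (interiorVol F m Y) =
      interiorVol F m (vbracket D Z Y) + divergence D Z • interiorVol F m Y := by
  ext U
  have h := congrArg (fun α => α (Matrix.vecCons Y U)) (lieDeriv_vol D Z)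
  simp only [lieDeriv_apply, AlternatingMap.smul_apply, Fin.sum_univ_succ] at h
  have h1 : ∀ j : Fin m, Function.update (Matrix.vecCons Y U) j.succ
      (vbracket D Z ((Matrix.vecCons Y U : Fin (m + 1) → VField F (m + 1)) j.succ)) =
      Matrix.vecCons Y (Function.update U j (vbracket D Z (U j))) := fun j => by
    rw [Matrix.cons_val_succ]
    exact (Fin.cons_update (α := fun _ => VField F (m + 1)) Y U j _).symm
  have h2 : Function.update (Matrix.vecCons Y U) 0
      (vbracket D Z ((Matrix.vecCons Y U : Fin (m + 1) → VField F (m + 1)) 0)) =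
      Matrix.vecCons (vbracket D Z Y) U :=
    Fin.update_cons_zero (α := fun _ => VField F (m + 1)) Y U _
  rw [h2, Finset.sum_congr rfl fun j _ => by rw [h1 j]] at h
  rw [lieDeriv_apply, AlternatingMap.add_apply, AlternatingMap.smul_apply]
  simp only [interiorVol_apply]
  rw [← h]
  ring

/-- The operator `δ_X Y = f ∇_X Y + (X.f) Y`, whose antisymmetrization is, up to sign, the bracket
of `(n-1)`-forms. -/
def twistedNabla {n : ℕ} (D : Fin n → Derivation 𝕜 F F) (f : F) (X Y : VField F n) : VField F n :=
  (f • fun i => vact D X (Y i)) + vact D X f • Y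

/-- Under `X ↦ i_X ω`, the bracket is an antisymmetrization of `δ_X Y`, so that the double sum in
the Nambu-Poisson differential becomes a single one by `sum_pairs_antisymmetrization`. -/
theorem npBracket_interiorVol (D : Fin (m + 1) → Derivation 𝕜 F F) (f : F)
    (X Y : VField F (m + 1)) :
    npBracket D (topVector f) (interiorVol F m X) (interiorVol F m Y) =
      (-1 : F) ^ m • (interiorVol F m (twistedNabla D f X Y) -
        interiorVol F m (twistedNabla D f Y X)) := by
  rw [npBracket, anchor_interiorVol, lieDeriv_interiorVol, extD_interiorVol, contract_topVector,
    AlternatingMap.smul_apply, vol_frame, add_assoc, ← add_smul, ← map_smul, ← map_add,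
    ← map_sub, ← map_smul]
  congr 1
  funext i
  simp only [vbracket, divergence_smul, twistedNabla, Pi.add_apply, Pi.smul_apply, smul_eq_mul,
    Pi.sub_apply, vact_smul_left, mul_assoc, map_neg_one_pow_mul]
  simp only [Derivation.leibniz, smul_eq_mul]
  ring

/-- Under `X ↦ i_X ω`, the Nambu-Poisson differential becomes `± d_f`. -/
theorem npDiff_interiorVol (D : Fin (m + 1) → Derivation 𝕜 F F) (f : F) {k : ℕ}
    (c : NPCochain F m (k + 1)) (X : Fin (k + 2) → VField F (m + 1)) :
    npDiff D (topVector f) (k + 1) c (fun i => interiorVol F m (X i)) =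
      (-1) ^ m * dOp D f (k + 1) (c.compLinearMap (interiorVol F m).toLinearMap) X := by
  set c' : DForm F (m + 1) (k + 1) := c.compLinearMap (interiorVol F m).toLinearMap with hc'
  have hc : ∀ Y : Fin (k + 1) → VField F (m + 1), c (fun i => interiorVol F m (Y i)) = c' Y :=
    fun Y => rfl
  have hpairs : ∀ (i j : Fin (k + 1)),
      c (Matrix.vecCons (npBracket D (topVector f) (interiorVol F m (X i.castSucc))
        (interiorVol F m (X j.succ)))
          (j.removeNth (i.castSucc.removeNth fun i => interiorVol F m (X i)))) =
      (-1) ^ m * c' (Matrix.vecCons (twistedNabla D f (X i.castSucc) (X j.succ) -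
        twistedNabla D f (X j.succ) (X i.castSucc)) (j.removeNth (i.castSucc.removeNth X))) := by
    intro i j
    rw [npBracket_interiorVol, AlternatingMap.map_vecCons_smul, smul_eq_mul, ← map_sub, ← hc]
    congr 2
    funext l
    refine Fin.cases rfl (fun l => rfl) l
  have hsum : ∀ i : Fin (k + 2), ∑ l, c' (Function.update (i.removeNth X) l
      (twistedNabla D f (X i) (i.removeNth X l))) =
      f * ∑ l, c' (Function.update (i.removeNth X) l
        (fun a => vact D (X i) (i.removeNth X l a))) +
      (k + 1) * (vact D (X i) f * c' (i.removeNth X)) := fun i => by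
    simp only [twistedNabla, AlternatingMap.map_update_add, AlternatingMap.map_update_smul,
      Finset.sum_add_distrib, Function.update_eq_self, smul_eq_mul, ← Finset.mul_sum]
    simp [mul_left_comm]
  have hanchor : ∀ i : Fin (k + 2), vact D (anchor (topVector f) (interiorVol F m (X i)))
      (c (i.removeNth fun i => interiorVol F m (X i))) =
      (-1) ^ m * (f * vact D (X i) (c' (i.removeNth X))) := fun i => by
    rw [anchor_interiorVol, vact_smul_left, mul_assoc]
    rfl
  simp only [npDiff, LinearMap.coe_mk, AddHom.coe_mk, hpairs, hanchor]
  have := sum_pairs_antisymmetrization c' X (twistedNabla D f)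
  simp only [mul_left_comm _ ((-1 : F) ^ m), ← Finset.mul_sum]
  rw [this, dOp_apply, extD_apply, wedge₁_apply, ← mul_sub]
  simp only [hsum, Finset.mul_sum, ← Finset.sum_sub_distrib]
  refine Finset.sum_congr rfl fun i _ => ?_
  simp only [mul_sub, ← Finset.mul_sum, dfun, LinearMap.coe_mk, AddHom.coe_mk]
  push_cast
  ring

/-- Every `n`-cochain is a cocycle: its differential corresponds to an `(n+1)`-form. -/
theorem npCocycles_top (D : Fin (m + 1) → Derivation 𝕜 F F) (f : F) :
    npCocycles D (topVector f) (m + 1) = ⊤ := by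
  refine eq_top_iff.2 fun c _ => LinearMap.mem_ker.2 ?_
  funext α
  obtain ⟨X, rfl⟩ : ∃ X : Fin (m + 2) → VField F (m + 1), α = fun i => interiorVol F m (X i) :=
    ⟨fun i => (interiorVol F m).symm (α i), by simp⟩
  rw [npDiff_interiorVol]
  have h0 : dOp D f (m + 1) (c.compLinearMap (interiorVol F m).toLinearMap) = 0 := by
    refine Module.Basis.ext_alternating (Pi.basisFun F (Fin (m + 1))) fun v hv => ?_
    have := Fintype.card_le_of_injective v hv
    simp at this
  rw [h0]
  simp

/-- The pullback of cochains to forms along `X ↦ i_X ω`. -/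
def cochainToForm (𝕜 F : Type) [Field 𝕜] [CommRing F] [Algebra 𝕜 F] (m k : ℕ) :
    NPCochain F m k ≃ₗ[𝕜] DForm F (m + 1) k where
  toFun c := c.compLinearMap (interiorVol F m).toLinearMap
  invFun β := β.compLinearMap (interiorVol F m).symm.toLinearMap
  map_add' _ _ := rfl
  map_smul' _ _ := rfl
  left_inv c := by ext; simp
  right_inv β := by ext; simp

theorem map_npCoboundaries (hm : 1 ≤ m) (D : Fin (m + 1) → Derivation 𝕜 F F) (f : F) :
    (npCoboundaries D (topVector f) (m + 1)).map (cochainToForm 𝕜 F m (m + 1)).toLinearMap =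
      dOpCoboundaries D f m := by
  obtain ⟨k, rfl⟩ : ∃ k, m = k + 1 := ⟨m - 1, by omega⟩
  have hsq : ((-1 : 𝕜) ^ (k + 1)) * ((-1 : 𝕜) ^ (k + 1)) = 1 := by rw [← mul_pow]; simp
  have hkey : ∀ (c : NPCochain F (k + 1) (k + 2)) (b : NPCochain F (k + 1) (k + 1)),
      (∀ α, c α = npDiff D (topVector f) (k + 1) b α) ↔
        cochainToForm 𝕜 F (k + 1) (k + 2) c =
          (-1 : 𝕜) ^ (k + 1) • dOp D f (k + 1) (cochainToForm 𝕜 F (k + 1) (k + 1) b) := by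
    intro c b
    have hs : ∀ x : F, (-1 : 𝕜) ^ (k + 1) • x = (-1) ^ (k + 1) * x := fun x => by
      rw [Algebra.smul_def]; simp
    constructor
    · intro h
      ext X
      rw [AlternatingMap.smul_apply, hs]
      exact (h _).trans (npDiff_interiorVol D f b X)
    · intro h α
      obtain ⟨X, rfl⟩ : ∃ X : Fin (k + 2) → VField F (k + 1 + 1),
          α = fun i => interiorVol F (k + 1) (X i) :=
        ⟨fun i => (interiorVol F (k + 1)).symm (α i), by simp⟩
      rw [npDiff_interiorVol, ← hs]
      exact congrArg (fun β => β X) h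
  ext β
  simp only [Submodule.mem_map, dOpCoboundaries, LinearMap.mem_range]
  constructor
  · rintro ⟨c, ⟨b, hb⟩, rfl⟩
    refine ⟨(-1 : 𝕜) ^ (k + 1) • cochainToForm 𝕜 F (k + 1) (k + 1) b, ?_⟩
    rw [map_smul]
    exact ((hkey c b).1 hb).symm
  · rintro ⟨γ, rfl⟩
    refine ⟨(cochainToForm 𝕜 F (k + 1) (k + 2)).symm (dOp D f (k + 1) γ),
      ⟨(-1 : 𝕜) ^ (k + 1) • (cochainToForm 𝕜 F (k + 1) (k + 1)).symm γ, ?_⟩, by simp⟩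
    rw [hkey]
    simp [smul_smul, hsq]

/-- `H^n_NP` is the space of `n`-forms modulo the coboundaries of `d_f`. -/
def npCohomologyEquiv (hm : 1 ≤ m) (D : Fin (m + 1) → Derivation 𝕜 F F) (f : F) :
    NPCohomology D (topVector f) (m + 1) ≃ₗ[𝕜]
      (DForm F (m + 1) (m + 1) ⧸ dOpCoboundaries D f m) :=
  Submodule.Quotient.equiv _ _
    ((LinearEquiv.ofTop _ (npCocycles_top D f)).trans (cochainToForm 𝕜 F m (m + 1))) (by
      rw [← map_npCoboundaries hm]
      ext β
      simp only [Submodule.mem_map, Submodule.submoduleOf, Submodule.mem_comap]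
      constructor
      · rintro ⟨c, hc, rfl⟩
        exact ⟨c.1, hc, rfl⟩
      · rintro ⟨c, hc, rfl⟩
        exact ⟨⟨c, by rw [npCocycles_top]; trivial⟩, hc, rfl⟩)

end Forms

/-! ### Exactness of the Koszul complex in degree one -/

section Koszul

theorem mem_ideal_smul_top_iff_repr {R M ι : Type*} [CommRing R] [AddCommGroup M] [Module R M]
    (b : Module.Basis ι R M) (J : Ideal R) (v : M) :
    v ∈ J • (⊤ : Submodule R M) ↔ ∀ i, b.repr v i ∈ J := by
  constructor
  · intro h i
    have h2 : b.coord i v ∈ (J • (⊤ : Submodule R M)).map (b.coord i) :=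
      Submodule.mem_map_of_mem h
    rw [Submodule.map_smul''] at h2
    have h3 := Submodule.smul_mono (le_refl J)
      (le_top (a := (⊤ : Submodule R M).map (b.coord i))) h2
    rwa [smul_eq_mul, Ideal.mul_top] at h3
  · intro h
    rw [← b.linearCombination_repr v, Finsupp.linearCombination_apply, Finsupp.sum]
    exact Submodule.sum_mem _ fun i _ => Submodule.smul_mem_smul (h i) trivial

/-- An element that is regular modulo `J` acts regularly on a free module modulo `J`. -/
theorem mem_ideal_smul_top_of_smul_mem {R M : Type*} [CommRing R] [AddCommGroup M] [Module R M]
    [Module.Free R M] {J : Ideal R} {a : R} (ha : ∀ b, a * b ∈ J → b ∈ J) {v : M}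
    (hv : a • v ∈ J • (⊤ : Submodule R M)) : v ∈ J • (⊤ : Submodule R M) := by
  rw [mem_ideal_smul_top_iff_repr (Module.Free.chooseBasis R M)] at hv ⊢
  intro i
  exact ha _ (by simpa using hv i)

/-- A complex of free modules on which each member of a regular sequence `y₀, …, y_{n-1}` is
homotopic to zero is exact in degree `1` if it vanishes in degree `n + 1`.  By descending induction
on `r`, the complex modulo `(y₀, …, y_{r-1})` is exact in degree `r + 1`: for a cycle `z`, the
homotopy `s z` is a cycle modulo `y_r`, so `s z = d u + y_r v`, whence `y_r z = y_r d v`. -/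
theorem exact_of_regular_homotopies {R : Type*} [CommRing R] {L : ℕ → Type*}
    [∀ k, AddCommGroup (L k)] [∀ k, Module R (L k)] [∀ k, Module.Free R (L k)]
    (d : ∀ k, L (k + 1) →ₗ[R] L k) (hd : ∀ k z, d k (d (k + 1) z) = 0) {n : ℕ} (y : ℕ → R)
    (hreg : ∀ r < n, ∀ a, y r * a ∈ Ideal.span (y '' Set.Iio r) →
      a ∈ Ideal.span (y '' Set.Iio r))
    (s : ℕ → ∀ k, L k →ₗ[R] L (k + 1))
    (hs : ∀ r < n, ∀ k (z : L (k + 1)), d (k + 1) (s r (k + 1) z) + s r k (d k z) = y r • z)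
    [Subsingleton (L (n + 1))] {z : L 1} (hz : d 0 z = 0) : ∃ u, d 1 u = z := by
  set J : ℕ → Ideal R := fun r => Ideal.span (y '' Set.Iio r) with hJ
  have hJs : ∀ r, J (r + 1) = Ideal.span {y r} ⊔ J r := fun r => by
    have : Set.Iio (r + 1) = insert r (Set.Iio r) := by ext; simp
    simp only [hJ]
    rw [this, Set.image_insert_eq, Ideal.span_insert]
  have hmap : ∀ {A C : Type _} [AddCommGroup A] [AddCommGroup C] [Module R A] [Module R C]
      (g : A →ₗ[R] C) (r : ℕ) (v : A), v ∈ J r • (⊤ : Submodule R A) →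
      g v ∈ J r • (⊤ : Submodule R C) := by
    intro A C _ _ _ _ g r v hv
    have h2 := Submodule.mem_map_of_mem (f := g) hv
    rw [Submodule.map_smul''] at h2
    exact Submodule.smul_mono le_rfl le_top h2
  have claim : ∀ t r, r + t = n → ∀ z : L (r + 1), d r z ∈ J r • (⊤ : Submodule R (L r)) →
      ∃ u, z - d (r + 1) u ∈ J r • (⊤ : Submodule R (L (r + 1))) := by
    intro t
    induction t with
    | zero =>
      rintro r rfl z -
      exact ⟨0, by rw [Subsingleton.elim (z - _) 0]; exact zero_mem _⟩
    | succ t ih =>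
      intro r hr z hz
      have hrn : r < n := by omega
      have hle : J r ≤ J (r + 1) := (hJs r).ge.trans' le_sup_right
      have hyz : y r ∈ J (r + 1) := by
        rw [hJs]; exact Submodule.mem_sup_left (Ideal.mem_span_singleton_self _)
      have hsz := hs r hrn r z
      have hsdz := hmap (s r r) r _ hz
      obtain ⟨u, hu⟩ := ih (r + 1) (by omega) (s r (r + 1) z) (by
        rw [eq_sub_of_add_eq hsz]
        exact sub_mem (Submodule.smul_mem_smul hyz trivial)
          (Submodule.smul_mono_left hle hsdz))
      rw [hJs, Submodule.sup_smul, Submodule.mem_sup] at hu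
      obtain ⟨p, hp, q, hq, hpq⟩ := hu
      rw [Submodule.ideal_span_singleton_smul] at hp
      obtain ⟨v, -, rfl⟩ := hp
      change y r • v + q = _ at hpq
      refine ⟨v, mem_ideal_smul_top_of_smul_mem (hreg r hrn) ?_⟩
      have hdq := hmap (d (r + 1)) r _ hq
      have e := congrArg (d (r + 1)) hpq
      rw [map_sub, hd, sub_zero, map_add, map_smul] at e
      rw [smul_sub, ← hsz, ← e]
      convert add_mem hdq hsdz using 1
      abel
  obtain ⟨u, hu⟩ := claim n 0 (by omega) z (by rw [hz]; exact zero_mem _)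
  refine ⟨u, ?_⟩
  simp only [hJ] at hu
  rw [show Set.Iio 0 = (∅ : Set ℕ) by ext; simp, Set.image_empty, Ideal.span_empty,
    Submodule.bot_smul, Submodule.mem_bot, sub_eq_zero] at hu
  exact hu.symm

variable {R : Type*} [CommRing R] {V : Type*} [AddCommGroup V] [Module R V]

open CliffordAlgebra in
theorem contractLeft_mem_exteriorPower (g : Module.Dual R V) (k : ℕ) {z : ExteriorAlgebra R V}
    (hz : z ∈ ⋀[R]^(k + 1) V) :
    contractLeft (Q := (0 : QuadraticForm R V)) g z ∈ ⋀[R]^k V := by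
  induction k generalizing z with
  | zero =>
    rw [ExteriorAlgebra.exteriorPower, zero_add, pow_one] at hz
    obtain ⟨v, rfl⟩ := hz
    rw [ExteriorAlgebra.exteriorPower, pow_zero, Submodule.mem_one]
    exact ⟨g v, (contractLeft_ι _ g v).symm⟩
  | succ k ih =>
    rw [ExteriorAlgebra.exteriorPower, pow_succ'] at hz
    refine Submodule.mul_induction_on hz ?_ fun a b ha hb => ?_
    · rintro _ ⟨v, rfl⟩ b hb
      have : contractLeft (Q := (0 : QuadraticForm R V)) g (ExteriorAlgebra.ι R v * b) =
          g v • b - ExteriorAlgebra.ι R v * contractLeft (Q := (0 : QuadraticForm R V)) g b :=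
        contractLeft_ι_mul g v b
      rw [this]
      refine sub_mem (Submodule.smul_mem _ _ hb) ?_
      rw [ExteriorAlgebra.exteriorPower, pow_succ']
      exact Submodule.mul_mem_mul ⟨v, rfl⟩ (ih hb)
    · rw [map_add]
      exact add_mem ha hb

/-- The Koszul differential on exterior powers: contraction with a linear functional. -/
def koszulDiff (g : Module.Dual R V) (k : ℕ) : ⋀[R]^(k + 1) V →ₗ[R] ⋀[R]^k V :=
  ((CliffordAlgebra.contractLeft (Q := (0 : QuadraticForm R V)) g).comp
    (⋀[R]^(k + 1) V).subtype).codRestrict _ fun z => contractLeft_mem_exteriorPower g k z.2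

/-- Exterior multiplication by a vector. -/
def exteriorMul (c : V) (k : ℕ) : ⋀[R]^k V →ₗ[R] ⋀[R]^(k + 1) V :=
  ((LinearMap.mulLeft R (ExteriorAlgebra.ι R c)).comp (⋀[R]^k V).subtype).codRestrict _ fun z => by
    rw [ExteriorAlgebra.exteriorPower, pow_succ']
    exact Submodule.mul_mem_mul (LinearMap.mem_range_self _ c) z.2

theorem koszulDiff_koszulDiff (g : Module.Dual R V) (k : ℕ) (z : ⋀[R]^(k + 2) V) :
    koszulDiff g k (koszulDiff g (k + 1) z) = 0 :=
  Subtype.ext (CliffordAlgebra.contractLeft_contractLeft (Q := (0 : QuadraticForm R V)) (d := g) _)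

theorem koszulDiff_exteriorMul (g : Module.Dual R V) (c : V) (k : ℕ) (z : ⋀[R]^(k + 1) V) :
    koszulDiff g (k + 1) (exteriorMul c (k + 1) z) + exteriorMul c k (koszulDiff g k z) =
      g c • z := by
  refine Subtype.ext ?_
  have := CliffordAlgebra.contractLeft_ι_mul (Q := (0 : QuadraticForm R V)) (d := g) c z.1
  change CliffordAlgebra.contractLeft (Q := (0 : QuadraticForm R V)) g
    (ExteriorAlgebra.ι R c * z.1) + ExteriorAlgebra.ι R c *
      CliffordAlgebra.contractLeft (Q := (0 : QuadraticForm R V)) g z.1 = g c • z.1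
  exact (congrArg (· + _) this).trans (sub_add_cancel _ _)

/-- If the ideal `(g₀, …, g_{n-1})` contains a regular sequence of length `n`, then the relations
between the `gᵢ` are generated by the trivial ones. -/
theorem exists_antisymm_of_regular [IsDomain R] {n : ℕ} (g : Fin n → R) (y : ℕ → R)
    (hreg : ∀ r < n, ∀ a, y r * a ∈ Ideal.span (y '' Set.Iio r) →
      a ∈ Ideal.span (y '' Set.Iio r))
    (hy : ∀ r < n, y r ∈ Ideal.span (Set.range g)) {Y : Fin n → R} (hY : ∑ i, Y i * g i = 0) :
    ∃ A : Fin n → Fin n → R, (∀ i j, A i j = -A j i) ∧ ∀ j, Y j = ∑ i, A i j * g i := by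
  let γ : Module.Dual R (Fin n → R) := Fintype.linearCombination R g
  have hγ : ∀ v, γ v = ∑ i, v i * g i := fun v => by
    simp [γ, Fintype.linearCombination_apply]
  have hc : ∀ r, ∃ c : Fin n → R, r < n → γ c = y r := fun r => by
    by_cases h : r < n
    · obtain ⟨c, hc⟩ := Ideal.mem_span_range_iff_exists_fun.1 (hy r h)
      exact ⟨c, fun _ => (hγ c).trans hc⟩
    · exact ⟨0, fun h' => absurd h' h⟩
  choose c hc using hc
  have hsub : Subsingleton (⋀[R]^(n + 1) (Fin n → R)) := by
    rw [← Module.finrank_eq_zero_iff_of_free (R := R), exteriorPower.finrank_eq]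
    simp
  have hιY : ExteriorAlgebra.ι R Y ∈ ⋀[R]^1 (Fin n → R) := by
    rw [ExteriorAlgebra.exteriorPower, pow_one]; exact ⟨Y, rfl⟩
  obtain ⟨u, hu⟩ := exact_of_regular_homotopies (L := fun k => ⋀[R]^k (Fin n → R))
    (koszulDiff γ) (koszulDiff_koszulDiff γ) y hreg (fun r k => exteriorMul (c r) k)
    (fun r hr k z => by rw [koszulDiff_exteriorMul, hc r hr]) (z := ⟨_, hιY⟩)
    (Subtype.ext (by
      change CliffordAlgebra.contractLeft (Q := (0 : QuadraticForm R _)) γ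
        (CliffordAlgebra.ι _ Y) = 0
      rw [CliffordAlgebra.contractLeft_ι, hγ, hY, map_zero]))
  have key : ∀ z ∈ ⋀[R]^2 (Fin n → R), ∃ A : Fin n → Fin n → R, (∀ i j, A i j = -A j i) ∧
      CliffordAlgebra.contractLeft (Q := (0 : QuadraticForm R _)) γ z =
        ExteriorAlgebra.ι R (fun j => ∑ i, A i j * g i) := by
    intro z hz
    rw [ExteriorAlgebra.exteriorPower, pow_two] at hz
    refine Submodule.mul_induction_on hz ?_ ?_
    · rintro _ ⟨a, rfl⟩ _ ⟨b, rfl⟩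
      refine ⟨fun i j => a i * b j - b i * a j, fun i j => by ring, ?_⟩
      have e : (fun j => ∑ i, (a i * b j - b i * a j) * g i) = γ a • b - γ b • a := by
        funext j
        simp only [hγ, Pi.sub_apply, Pi.smul_apply, smul_eq_mul, Finset.sum_mul,
          ← Finset.sum_sub_distrib]
        exact Finset.sum_congr rfl fun i _ => by ring
      rw [e, map_sub, map_smul, map_smul]
      refine (CliffordAlgebra.contractLeft_ι_mul (Q := (0 : QuadraticForm R _)) γ a _).trans ?_
      congr 1
      refine (congrArg _ (CliffordAlgebra.contractLeft_ι (Q := (0 : QuadraticForm R _)) γ b)).trans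
        ?_
      rw [← Algebra.commutes, ← Algebra.smul_def]
    · rintro p q ⟨A, hA, hp⟩ ⟨A', hA', hq⟩
      refine ⟨A + A', fun i j => by simp only [Pi.add_apply, hA i j, hA' i j]; ring, ?_⟩
      rw [map_add, hp, hq, ← map_add]
      congr 1
      funext j
      simp [add_mul, Finset.sum_add_distrib]
  obtain ⟨A, hA, hAu⟩ := key u.1 u.2
  refine ⟨A, hA, fun j => ?_⟩
  have h1 := congrArg Subtype.val hu
  exact congrFun ((ExteriorAlgebra.ι_leftInverse (R := R) (M := Fin n → R)).injective
    (h1.symm.trans hAu)) j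

end Koszul

/-! ### Quasihomogeneous polynomials and vector fields -/

section Polynomials

variable {𝕜 : Type} [Field 𝕜] {n : ℕ}

/-- The partial derivatives of polynomials. -/
abbrev polyD (𝕜 : Type) [Field 𝕜] (n : ℕ) :
    Fin n → Derivation 𝕜 (MvPolynomial (Fin n) 𝕜) (MvPolynomial (Fin n) 𝕜) :=
  fun i => MvPolynomial.pderiv i

/-- The quasihomogeneous component of degree `d` of a polynomial. -/
abbrev quasiComp (w : Fin n → ℕ) (d : ℤ) :
    MvPolynomial (Fin n) 𝕜 →ₗ[𝕜] MvPolynomial (Fin n) 𝕜 :=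
  MvPolynomial.weightedHomogeneousComponent (fun i => (w i : ℤ)) d

/-- The Euler vector field `∑ wᵢ xᵢ ∂/∂xᵢ` in the coordinates `xᵢ`. -/
def eulerField {F : Type} [CommRing F] (w : Fin n → ℕ) (x : Fin n → F) : VField F n :=
  fun i => (w i : F) * x i

/-- The Euler vector field on polynomials. -/
abbrev polyEuler (𝕜 : Type) [Field 𝕜] (w : Fin n → ℕ) : VField (MvPolynomial (Fin n) 𝕜) n :=
  eulerField w MvPolynomial.X

theorem weight_eq_monomialDegree (w : Fin n → ℕ) (a : Fin n →₀ ℕ) :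
    Finsupp.weight (fun i => (w i : ℤ)) a = monomialDegree w a := by
  rw [Finsupp.weight_apply, Finsupp.sum_fintype _ _ (by simp), monomialDegree]
  simp

theorem monomialDegree_add_single (w : Fin n → ℕ) (a : Fin n →₀ ℕ) (i : Fin n) :
    monomialDegree w (a + Finsupp.single i 1) = monomialDegree w a + w i := by
  rw [← weight_eq_monomialDegree, ← weight_eq_monomialDegree, map_add]
  simp [Finsupp.weight_single]

theorem monomialDegree_zero (w : Fin n → ℕ) : monomialDegree w 0 = 0 := by
  simp [monomialDegree]

theorem monomialDegree_nonneg (w : Fin n → ℕ) (a : Fin n →₀ ℕ) : 0 ≤ monomialDegree w a :=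
  Finset.sum_nonneg fun i _ => by positivity

theorem isQuasihomogeneous_monomial (w : Fin n → ℕ) (a : Fin n →₀ ℕ) (c : 𝕜) :
    IsQuasihomogeneous w (MvPolynomial.monomial a c) (monomialDegree w a) :=
  MvPolynomial.isWeightedHomogeneous_monomial _ _ _ (weight_eq_monomialDegree w a)

theorem isQuasihomogeneous_quasiComp (w : Fin n → ℕ) (d : ℤ) (p : MvPolynomial (Fin n) 𝕜) :
    IsQuasihomogeneous w (quasiComp w d p) d :=
  MvPolynomial.weightedHomogeneousComponent_isWeightedHomogeneous _ _

theorem quasiComp_of_isQuasihomogeneous (w : Fin n → ℕ) {d e : ℤ} {p : MvPolynomial (Fin n) 𝕜}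
    (hp : IsQuasihomogeneous w p e) : quasiComp w d p = if d = e then p else 0 :=
  MvPolynomial.weightedHomogeneousComponent_of_mem hp

theorem eq_zero_of_isQuasihomogeneous_neg {w : Fin n → ℕ} {d : ℤ} (hd : d < 0)
    {p : MvPolynomial (Fin n) 𝕜} (hp : IsQuasihomogeneous w p d) : p = 0 := by
  ext a
  by_contra h
  have := hp h
  rw [weight_eq_monomialDegree] at this
  have := monomialDegree_nonneg w a
  omega

theorem quasiComp_mul {w : Fin n → ℕ} {N : ℤ} {f : MvPolynomial (Fin n) 𝕜}
    (hf : IsQuasihomogeneous w f N) (d : ℤ) (p : MvPolynomial (Fin n) 𝕜) :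
    quasiComp w d (p * f) = quasiComp w (d - N) p * f := by
  induction p using MvPolynomial.induction_on' with
  | add p q hp hq => rw [add_mul, map_add, map_add, hp, hq, add_mul]
  | monomial a c =>
    have h := isQuasihomogeneous_monomial (𝕜 := 𝕜) w a c
    rw [quasiComp_of_isQuasihomogeneous w (h.mul hf), quasiComp_of_isQuasihomogeneous w h]
    by_cases hd : d = monomialDegree w a + N
    · rw [if_pos hd, if_pos (by omega)]
    · rw [if_neg hd, if_neg (by omega), zero_mul]

theorem isQuasihomogeneous_pderiv {w : Fin n → ℕ} {d : ℤ} {p : MvPolynomial (Fin n) 𝕜}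
    (hp : IsQuasihomogeneous w p d) (i : Fin n) :
    IsQuasihomogeneous w (MvPolynomial.pderiv i p) (d - w i) :=
  MvPolynomial.IsWeightedHomogeneous.pderiv hp (by ring)

theorem quasiComp_pderiv (w : Fin n → ℕ) (d : ℤ) (i : Fin n) (p : MvPolynomial (Fin n) 𝕜) :
    quasiComp w d (MvPolynomial.pderiv i p) =
      MvPolynomial.pderiv i (quasiComp w (d + w i) p) := by
  induction p using MvPolynomial.induction_on' with
  | add p q hp hq => simp only [map_add, hp, hq]
  | monomial a c =>
    have h := isQuasihomogeneous_monomial (𝕜 := 𝕜) w a c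
    rw [quasiComp_of_isQuasihomogeneous w (isQuasihomogeneous_pderiv h i),
      quasiComp_of_isQuasihomogeneous w h]
    by_cases hd : d + w i = monomialDegree w a
    · rw [if_pos hd, if_pos (by omega)]
    · rw [if_neg hd, if_neg (by omega), map_zero]

theorem euler_monomial (w : Fin n → ℕ) (a : Fin n →₀ ℕ) (c : 𝕜) :
    vact (polyD 𝕜 n) (polyEuler 𝕜 w) (MvPolynomial.monomial a c) =
      (monomialDegree w a : 𝕜) • MvPolynomial.monomial a c := by
  have h : ∀ i, polyEuler 𝕜 w i * MvPolynomial.pderiv i (MvPolynomial.monomial a c) =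
      ((a i : 𝕜) * (w i : 𝕜)) • MvPolynomial.monomial a c := fun i => by
    change (w i : MvPolynomial (Fin n) 𝕜) * MvPolynomial.X i * _ = _
    rw [mul_assoc, MvPolynomial.X_mul_pderiv_monomial, mul_comm, mul_smul,
      nsmul_eq_mul, mul_assoc]
    simp [MvPolynomial.smul_eq_C_mul, mul_comm]
  rw [vact_apply, Finset.sum_congr rfl fun i _ => h i, ← Finset.sum_smul, monomialDegree]
  push_cast
  rfl

theorem euler_apply {w : Fin n → ℕ} {d : ℤ} {p : MvPolynomial (Fin n) 𝕜}
    (hp : IsQuasihomogeneous w p d) :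
    vact (polyD 𝕜 n) (polyEuler 𝕜 w) p = (d : 𝕜) • p := by
  refine MvPolynomial.IsWeightedHomogeneous.induction_on
    (motive := fun p _ => vact (polyD 𝕜 n) (polyEuler 𝕜 w) p = (d : 𝕜) • p) ?_ ?_ ?_ hp
  · simp
  · intro p q _ _ h1 h2
    rw [map_add, h1, h2, smul_add]
  · intro a c ha
    rw [euler_monomial, ← weight_eq_monomialDegree, ha]

theorem divergence_polyEuler (w : Fin n → ℕ) :
    divergence (polyD 𝕜 n) (polyEuler 𝕜 w) = MvPolynomial.C ((∑ i, (w i : ℤ) : ℤ) : 𝕜) := by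
  simp only [divergence, eulerField, Derivation.leibniz, MvPolynomial.pderiv_X_self,
    Derivation.map_natCast]
  simp

theorem divergence_add {F : Type} [CommRing F] [Algebra 𝕜 F] (D : Fin n → Derivation 𝕜 F F)
    (X Y : VField F n) : divergence D (X + Y) = divergence D X + divergence D Y := by
  simp [divergence, Finset.sum_add_distrib]

theorem vact_add_left {F : Type} [CommRing F] [Algebra 𝕜 F] (D : Fin n → Derivation 𝕜 F F)
    (X Y : VField F n) (g : F) : vact D (X + Y) g = vact D X g + vact D Y g := by
  simp [vact_apply, Finset.sum_add_distrib, add_mul]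

/-- Quasihomogeneous vector fields of degree `d`: the coefficient of `∂/∂xᵢ` has degree
`d + wᵢ`. -/
def IsQuasihomogeneousField (w : Fin n → ℕ) (X : VField (MvPolynomial (Fin n) 𝕜) n) (d : ℤ) :
    Prop := ∀ i, IsQuasihomogeneous w (X i) (d + w i)

/-- The quasihomogeneous component of degree `d` of a vector field. -/
def quasiCompField (w : Fin n → ℕ) (d : ℤ) (X : VField (MvPolynomial (Fin n) 𝕜) n) :
    VField (MvPolynomial (Fin n) 𝕜) n := fun i => quasiComp w (d + w i) (X i)

theorem isQuasihomogeneousField_quasiCompField (w : Fin n → ℕ) (d : ℤ)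
    (X : VField (MvPolynomial (Fin n) 𝕜) n) :
    IsQuasihomogeneousField w (quasiCompField w d X) d :=
  fun i => isQuasihomogeneous_quasiComp w _ (X i)

theorem quasiComp_divergence (w : Fin n → ℕ) (d : ℤ) (X : VField (MvPolynomial (Fin n) 𝕜) n) :
    quasiComp w d (divergence (polyD 𝕜 n) X) =
      divergence (polyD 𝕜 n) (quasiCompField w d X) := by
  rw [divergence, map_sum]
  exact Finset.sum_congr rfl fun i _ => quasiComp_pderiv w d i (X i)

theorem quasiComp_vact {w : Fin n → ℕ} {N : ℤ} {f : MvPolynomial (Fin n) 𝕜}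
    (hf : IsQuasihomogeneous w f N) (d : ℤ) (X : VField (MvPolynomial (Fin n) 𝕜) n) :
    quasiComp w d (vact (polyD 𝕜 n) X f) = vact (polyD 𝕜 n) (quasiCompField w (d - N) X) f := by
  rw [vact_apply, vact_apply, map_sum]
  refine Finset.sum_congr rfl fun i _ => ?_
  rw [quasiComp_mul (isQuasihomogeneous_pderiv hf i), quasiCompField]
  congr 3
  ring

theorem IsQuasihomogeneousField.divergence {w : Fin n → ℕ} {d : ℤ}
    {X : VField (MvPolynomial (Fin n) 𝕜) n} (hX : IsQuasihomogeneousField w X d) :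
    IsQuasihomogeneous w (divergence (polyD 𝕜 n) X) d :=
  MvPolynomial.IsWeightedHomogeneous.sum _ _ _ fun i _ => by
    have := isQuasihomogeneous_pderiv (hX i) i
    rwa [add_sub_cancel_right] at this

/-! ### Polynomial vector fields killing `f` -/

/-- Powers of distinct variables form a regular sequence. -/
theorem regular_variable_powers (k : Fin n → ℕ) {r : ℕ} (hr : r < n)
    (a : MvPolynomial (Fin n) 𝕜) :
    let y : ℕ → MvPolynomial (Fin n) 𝕜 := fun r =>
      if h : r < n then MvPolynomial.X ⟨r, h⟩ ^ k ⟨r, h⟩ else 0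
    y r * a ∈ Ideal.span (y '' Set.Iio r) → a ∈ Ideal.span (y '' Set.Iio r) := by
  intro y
  have hy : y '' Set.Iio r = (fun s => MvPolynomial.monomial s (1 : 𝕜)) ''
      {s | ∃ i : Fin n, (i : ℕ) < r ∧ s = Finsupp.single i (k i)} := by
    ext p
    constructor
    · rintro ⟨i, hi, rfl⟩
      have hin : i < n := lt_trans hi hr
      exact ⟨_, ⟨⟨i, hin⟩, hi, rfl⟩, by simp [y, hin, MvPolynomial.X_pow_eq_monomial]⟩
    · rintro ⟨_, ⟨i, hi, rfl⟩, rfl⟩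
      exact ⟨i, hi, by simp [y, MvPolynomial.X_pow_eq_monomial]⟩
  rw [hy, MvPolynomial.mem_ideal_span_monomial_image, MvPolynomial.mem_ideal_span_monomial_image]
  intro h s hs
  obtain ⟨_, ⟨i, hi, rfl⟩, hle⟩ := h (Finsupp.single ⟨r, hr⟩ (k ⟨r, hr⟩) + s) (by
    rw [MvPolynomial.mem_support_iff] at hs ⊢
    simpa [y, hr, MvPolynomial.X_pow_eq_monomial] using hs)
  refine ⟨_, ⟨i, hi, rfl⟩, ?_⟩
  have hne : (⟨r, hr⟩ : Fin n) ≠ i := fun h => by simp [← h] at hi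
  rw [Finsupp.single_le_iff] at hle ⊢
  simpa [Finsupp.single_eq_of_ne hne.symm] using hle

/-- If `∂₁f, …, ∂ₙf` generate an ideal of finite colength, a polynomial vector field killing `f` is
`∑ Aᵢⱼ ∂ᵢf ∂/∂xⱼ` with `A` antisymmetric.  Its divergence is `Z.f` with `Zᵢ = ∑ ∂ⱼAᵢⱼ`, and
`div Z = ∑ ∂ᵢ∂ⱼAᵢⱼ = 0`. -/
theorem exists_divergence_eq_vact [CharZero 𝕜] {f : MvPolynomial (Fin n) 𝕜}
    (hfin : ∀ i, ∃ k : ℕ, (MvPolynomial.X i : MvPolynomial (Fin n) 𝕜) ^ k ∈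
      Ideal.span (Set.range fun i => MvPolynomial.pderiv i f))
    {Y : VField (MvPolynomial (Fin n) 𝕜) n} (hY : vact (polyD 𝕜 n) Y f = 0) :
    ∃ Z, divergence (polyD 𝕜 n) Y = vact (polyD 𝕜 n) Z f ∧ divergence (polyD 𝕜 n) Z = 0 := by
  choose k hk using hfin
  rw [vact_apply] at hY
  obtain ⟨A, hA, hYA⟩ := exists_antisymm_of_regular (fun i => MvPolynomial.pderiv i f) _
    (fun r hr a => regular_variable_powers k hr a)
    (fun r hr => by simpa [hr] using hk ⟨r, hr⟩) hY
  have hcomm : ∀ (i j : Fin n) (p : MvPolynomial (Fin n) 𝕜), MvPolynomial.pderiv i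
      (MvPolynomial.pderiv j p) = MvPolynomial.pderiv j (MvPolynomial.pderiv i p) := by
    intro i j p
    ext a
    simp only [MvPolynomial.coeff_pderiv, add_right_comm a (Finsupp.single i 1)]
    by_cases h : i = j
    · subst h; rfl
    · simp [Finsupp.single_eq_of_ne h, Finsupp.single_eq_of_ne (Ne.symm h)]
      ring
  have hanti : ∀ T : Fin n → Fin n → MvPolynomial (Fin n) 𝕜, (∀ i j, T i j = -T j i) →
      ∑ i, ∑ j, T i j = 0 := by
    intro T hT
    have h1 : ∑ i, ∑ j, T i j = -∑ i, ∑ j, T i j := by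
      conv_lhs => rw [Finset.sum_comm]
      simp only [← Finset.sum_neg_distrib]
      exact Finset.sum_congr rfl fun i _ => Finset.sum_congr rfl fun j _ => hT j i
    exact self_eq_neg.1 h1
  refine ⟨fun i => ∑ j, MvPolynomial.pderiv j (A i j), ?_, ?_⟩
  · have h0 := hanti (fun j i => A i j * MvPolynomial.pderiv j (MvPolynomial.pderiv i f))
      (fun j i => by rw [hA i j, hcomm]; ring)
    simp only [divergence, vact_apply, hYA, map_sum, Derivation.leibniz, smul_eq_mul,
      Finset.sum_add_distrib]
    rw [h0, zero_add, Finset.sum_comm]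
    refine Finset.sum_congr rfl fun i _ => ?_
    rw [Finset.sum_mul]
    exact Finset.sum_congr rfl fun j _ => mul_comm _ _
  · simp only [divergence, map_sum]
    exact hanti _ fun i j => by rw [hcomm, hA i j, map_neg, map_neg]

/-! ### Vanishing of polynomial relations -/

/-- The polynomial case of uniqueness.  If `G = ∑ f^{κ-j} hⱼ` equals `Z.f` with `div Z = 0`, the
last term `h_κ` lies in the gradient ideal, so it vanishes. Then `f G' = Z.f` for the sum `G'` with
one term less, so `Z - (G'/N) W` kills `f`, where `W` is the Euler field, and the divergence of this
field, a nonzero multiple of `G'`, is again `Z'.f` with `div Z' = 0`. -/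
theorem eq_zero_of_sum_eq_vact [CharZero 𝕜] {w : Fin n → ℕ} (hw : ∀ i, (w i : ℤ) < ∑ i, (w i : ℤ))
    {N : ℤ} (hN : N ≠ 0) {f : MvPolynomial (Fin n) 𝕜} (hf : IsQuasihomogeneous w f N)
    (hfin : ∀ i, ∃ k : ℕ, (MvPolynomial.X i : MvPolynomial (Fin n) 𝕜) ^ k ∈
      Ideal.span (Set.range fun i => MvPolynomial.pderiv i f))
    (h : ℕ → MvPolynomial (Fin n) 𝕜) (κ : ℕ)
    (hh : ∀ j ≤ κ, IsQuasihomogeneous w (h j) ((j + 1) * N - ∑ i, (w i : ℤ)))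
    (hgrad : ∀ j, 1 ≤ j → j ≤ κ →
      h j ∈ Ideal.span (Set.range fun i => MvPolynomial.pderiv i f) → h j = 0)
    {Z : VField (MvPolynomial (Fin n) 𝕜) n}
    (hZ : ∑ j ∈ Finset.range (κ + 1), f ^ (κ - j) * h j = vact (polyD 𝕜 n) Z f)
    (hZ0 : divergence (polyD 𝕜 n) Z = 0) : ∀ j ≤ κ, h j = 0 := by
  have hN' : (N : 𝕜) ≠ 0 := by exact_mod_cast hN
  have hvact : ∀ X : VField (MvPolynomial (Fin n) 𝕜) n, vact (polyD 𝕜 n) X f ∈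
      Ideal.span (Set.range fun i => MvPolynomial.pderiv i f) := fun X => by
    rw [vact_apply]
    exact Ideal.mem_span_range_iff_exists_fun.2 ⟨X, rfl⟩
  have hfgrad : f ∈ Ideal.span (Set.range fun i => MvPolynomial.pderiv i f) := by
    have h1 := hvact ((N : 𝕜)⁻¹ • polyEuler 𝕜 w)
    have h2 : vact (polyD 𝕜 n) ((N : 𝕜)⁻¹ • polyEuler 𝕜 w) f = f := by
      have : (N : 𝕜)⁻¹ • polyEuler 𝕜 w =
        (MvPolynomial.C (N : 𝕜)⁻¹ : MvPolynomial (Fin n) 𝕜) • polyEuler 𝕜 w := by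
        funext i; simp [MvPolynomial.smul_eq_C_mul]
      rw [this, vact_smul_left, euler_apply hf, MvPolynomial.smul_eq_C_mul, ← mul_assoc,
        ← map_mul, inv_mul_cancel₀ hN', map_one, one_mul]
    rwa [h2] at h1
  induction κ generalizing Z with
  | zero =>
    intro j hj
    obtain rfl : j = 0 := by omega
    have h0 : h 0 = vact (polyD 𝕜 n) Z f := by simpa using hZ
    have h00 := hh 0 le_rfl
    -- `h₀` has degree `N - ∑ wᵢ`, so `Z` may be replaced by its component of degree `-∑ wᵢ`. The
    -- coefficients of the latter have negative degree.
    have h1 := quasiComp_vact hf (((0 : ℕ) + 1) * N - ∑ i, (w i : ℤ)) Z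
    rw [← h0, quasiComp_of_isQuasihomogeneous w h00, if_pos rfl, vact_apply] at h1
    rw [h1]
    refine Finset.sum_eq_zero fun i _ => ?_
    rw [eq_zero_of_isQuasihomogeneous_neg _ (isQuasihomogeneousField_quasiCompField w _ Z i),
      zero_mul]
    have := hw i
    push_cast
    linarith
  | succ κ ih =>
    set G := ∑ j ∈ Finset.range (κ + 1), f ^ (κ - j) * h j with hG
    have hsum : ∑ j ∈ Finset.range (κ + 1 + 1), f ^ (κ + 1 - j) * h j = f * G + h (κ + 1) := by
      rw [Finset.sum_range_succ, hG, Finset.mul_sum, Nat.sub_self, pow_zero, one_mul]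
      congr 1
      refine Finset.sum_congr rfl fun j hj => ?_
      rw [Finset.mem_range] at hj
      rw [show κ + 1 - j = (κ - j) + 1 by omega, pow_succ']
      ring
    rw [hsum] at hZ
    have hlast : h (κ + 1) = 0 := by
      refine hgrad _ (by omega) le_rfl ?_
      rw [eq_sub_of_add_eq' hZ]
      exact sub_mem (hvact Z) (Ideal.mul_mem_right _ _ hfgrad)
    rw [hlast, add_zero] at hZ
    have hGhom : IsQuasihomogeneous w G ((κ + 1) * N - ∑ i, (w i : ℤ)) := by
      refine MvPolynomial.IsWeightedHomogeneous.sum _ _ _ fun j hj => ?_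
      rw [Finset.mem_range] at hj
      have := (hf.pow (κ - j)).mul (hh j (by omega))
      convert this using 1
      rw [nsmul_eq_mul, Nat.cast_sub (by omega)]
      ring
    -- The field `Z - (G/N) W`, which kills `f`.
    set Y : VField (MvPolynomial (Fin n) 𝕜) n :=
      Z + (MvPolynomial.C (-(N : 𝕜)⁻¹) * G) • polyEuler 𝕜 w with hY
    have hYf : vact (polyD 𝕜 n) Y f = 0 := by
      rw [hY, vact_add_left, vact_smul_left, euler_apply hf, ← hZ, MvPolynomial.smul_eq_C_mul]
      have : MvPolynomial.C (-(N : 𝕜)⁻¹) * MvPolynomial.C (N : 𝕜) =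
          (-1 : MvPolynomial (Fin n) 𝕜) := by
        rw [← map_mul, neg_mul, inv_mul_cancel₀ hN', map_neg, map_one]
      linear_combination f * G * this
    have hYdiv : divergence (polyD 𝕜 n) Y = MvPolynomial.C (-(κ + 1 : 𝕜)) * G := by
      rw [hY, divergence_add, hZ0, divergence_smul, divergence_polyEuler, Derivation.leibniz,
        euler_apply hGhom, ← MvPolynomial.algebraMap_eq, Derivation.map_algebraMap,
        MvPolynomial.algebraMap_eq, MvPolynomial.smul_eq_C_mul]
      have : (-(κ + 1 : 𝕜)) = (-(N : 𝕜)⁻¹) * (((∑ i, (w i : ℤ) : ℤ) : 𝕜) +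
          (((κ + 1) * N - ∑ i, (w i : ℤ) : ℤ) : 𝕜)) := by
        push_cast
        field_simp
        ring
      rw [this, map_mul, map_add]
      simp only [smul_eq_mul]
      ring
    obtain ⟨Z', hZ', hZ'0⟩ := exists_divergence_eq_vact hfin hYf
    have hκ : (κ + 1 : 𝕜) ≠ 0 := by exact_mod_cast Nat.succ_ne_zero κ
    have hC : ∀ c : 𝕜, vact (polyD 𝕜 n) Z' (MvPolynomial.C c) = 0 := fun c => by
      rw [← MvPolynomial.algebraMap_eq, Derivation.map_algebraMap]
    have key := ih (fun j hj => hh j (by omega)) (fun j h1 h2 => hgrad j h1 (by omega))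
      (Z := (MvPolynomial.C (-(κ + 1 : 𝕜)⁻¹)) • Z') (by
        rw [vact_smul_left, ← hZ', hYdiv, ← mul_assoc, ← map_mul]
        rw [neg_mul_neg, inv_mul_cancel₀ hκ, map_one, one_mul])
      (by rw [divergence_smul, hZ'0, hC, mul_zero, add_zero])
    intro j hj
    rcases Nat.lt_or_ge κ j with hlt | hle
    · rw [show j = κ + 1 by omega]; exact hlast
    · exact key j hle

end Polynomials

/-! ### Local algebras of functions and their polynomials -/

section LocalAlgebra

variable {𝕜 : Type} [Field 𝕜] {n : ℕ}

/-- The properties of an algebra of functions on which the argument rests: the coordinates generate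
the maximal ideal of the functions vanishing at `0` (Hadamard), and the equation
`W h + μ h = g` is solvable for `μ ≥ 1`, with `W` the Euler field `∑ wᵢ xᵢ ∂/∂xᵢ`. -/
structure FunctionAlgebra.EulerSolvable (A : FunctionAlgebra 𝕜 n) (w : Fin n → ℕ) : Prop where
  span_coord_ne_top : Ideal.span (Set.range A.coord) ≠ ⊤
  D_coord : ∀ i j, A.D i (A.coord j) = if i = j then 1 else 0
  exists_sub_mem_span : ∀ g : A.carrier, ∃ c : 𝕜,
    g - algebraMap 𝕜 A.carrier c ∈ Ideal.span (Set.range A.coord)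
  exists_euler_add : ∀ μ : ℕ, 0 < μ → ∀ g : A.carrier, ∃ h,
    vact A.D (eulerField w A.coord) h + μ * h = g

variable {A : FunctionAlgebra 𝕜 n} {w : Fin n → ℕ}

/-- The ideal generated by the monomials of degree at least `K`. -/
def FunctionAlgebra.degIdeal (A : FunctionAlgebra 𝕜 n) (w : Fin n → ℕ) (K : ℤ) :
    Ideal A.carrier :=
  Ideal.span ((fun a => A.ofPoly (MvPolynomial.monomial a 1)) '' {a | K ≤ monomialDegree w a})

theorem FunctionAlgebra.ofPoly_X (A : FunctionAlgebra 𝕜 n) (i : Fin n) :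
    A.ofPoly (MvPolynomial.X i) = A.coord i := MvPolynomial.aeval_X _ _

theorem FunctionAlgebra.ofPoly_C (A : FunctionAlgebra 𝕜 n) (c : 𝕜) :
    A.ofPoly (MvPolynomial.C c) = algebraMap 𝕜 A.carrier c := MvPolynomial.aeval_C _ _

theorem FunctionAlgebra.ofPoly_monomial_add_single (A : FunctionAlgebra 𝕜 n) (a : Fin n →₀ ℕ)
    (i : Fin n) : A.ofPoly (MvPolynomial.monomial (a + Finsupp.single i 1) 1) =
      A.ofPoly (MvPolynomial.monomial a 1) * A.coord i := by
  rw [← A.ofPoly_X, ← map_mul, MvPolynomial.X, MvPolynomial.monomial_mul, mul_one]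

theorem FunctionAlgebra.degIdeal_anti (A : FunctionAlgebra 𝕜 n) (w : Fin n → ℕ) {K K' : ℤ}
    (h : K ≤ K') : A.degIdeal w K' ≤ A.degIdeal w K :=
  Ideal.span_mono (Set.image_mono fun _ ha => h.trans ha)

/-- Transport of a polynomial vector field to an algebra of functions. -/
def FunctionAlgebra.ofPolyField (A : FunctionAlgebra 𝕜 n)
    (X : VField (MvPolynomial (Fin n) 𝕜) n) : VField A.carrier n := fun i => A.ofPoly (X i)

theorem FunctionAlgebra.ofPolyField_polyEuler :
    A.ofPolyField (polyEuler 𝕜 w) = eulerField w A.coord := by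
  funext i
  simp [ofPolyField, eulerField, A.ofPoly_X]

theorem FunctionAlgebra.degIdeal_le_span_coord (A : FunctionAlgebra 𝕜 n) {w : Fin n → ℕ}
    {K : ℤ} (hK : 0 < K) :
    A.degIdeal w K ≤ Ideal.span (Set.range A.coord) := by
  refine Ideal.span_le.2 ?_
  rintro _ ⟨a, ha, rfl⟩
  obtain ⟨i, hi⟩ : ∃ i, a i ≠ 0 := by
    by_contra! h
    have ha : K ≤ monomialDegree w a := ha
    rw [show a = 0 from Finsupp.ext h, monomialDegree_zero] at ha
    omega
  have h1 : Finsupp.single i 1 ≤ a := by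
    rw [Finsupp.single_le_iff]; omega
  change A.ofPoly _ ∈ _
  rw [← tsub_add_cancel_of_le h1, A.ofPoly_monomial_add_single]
  exact Ideal.mul_mem_left _ _ (Ideal.subset_span ⟨i, rfl⟩)

theorem FunctionAlgebra.vact_mem_gradIdeal (A : FunctionAlgebra 𝕜 n) (f : A.carrier)
    (Y : VField A.carrier n) : vact A.D Y f ∈ A.gradIdeal f := by
  rw [vact_apply]
  exact Ideal.mem_span_range_iff_exists_fun.2 ⟨Y, rfl⟩

theorem FunctionAlgebra.mem_gradIdeal_iff (A : FunctionAlgebra 𝕜 n) (f g : A.carrier) :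
    g ∈ A.gradIdeal f ↔ ∃ Y, g = vact A.D Y f := by
  constructor
  · intro h
    obtain ⟨Y, hY⟩ := Ideal.mem_span_range_iff_exists_fun.1 h
    exact ⟨Y, by rw [vact_apply, ← hY]⟩
  · rintro ⟨Y, rfl⟩
    exact A.vact_mem_gradIdeal f Y

namespace FunctionAlgebra.EulerSolvable

theorem D_ofPoly (hA : A.EulerSolvable w) (i : Fin n) (p : MvPolynomial (Fin n) 𝕜) :
    A.D i (A.ofPoly p) = A.ofPoly (MvPolynomial.pderiv i p) := by
  induction p using MvPolynomial.induction_on with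
  | C c => rw [A.ofPoly_C, Derivation.map_algebraMap, MvPolynomial.pderiv_C, map_zero]
  | add p q hp hq => simp only [map_add, hp, hq]
  | mul_X p j hp =>
    rw [map_mul, Derivation.leibniz, Derivation.leibniz, hp, A.ofPoly_X, hA.D_coord,
      MvPolynomial.pderiv_X]
    by_cases h : i = j
    · subst h; simp [A.ofPoly_X]
    · simp [h, A.ofPoly_X]

theorem vact_ofPoly (hA : A.EulerSolvable w) (X : VField (MvPolynomial (Fin n) 𝕜) n)
    (p : MvPolynomial (Fin n) 𝕜) :
    vact A.D (A.ofPolyField X) (A.ofPoly p) = A.ofPoly (vact (polyD 𝕜 n) X p) := by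
  simp only [vact_apply, map_sum, map_mul, hA.D_ofPoly, ofPolyField]

theorem divergence_ofPoly (hA : A.EulerSolvable w) (X : VField (MvPolynomial (Fin n) 𝕜) n) :
    divergence A.D (A.ofPolyField X) = A.ofPoly (divergence (polyD 𝕜 n) X) := by
  simp only [divergence, map_sum, hA.D_ofPoly, ofPolyField]

/-- A subspace that contains all monomials, and all multiples of the monomials of sufficiently high
degree, is everything. -/
theorem submodule_eq_top (hA : A.EulerSolvable w) (hw : ∀ i, 0 < w i)
    (S : Submodule 𝕜 A.carrier) (K : ℤ)
    (hmon : ∀ a, A.ofPoly (MvPolynomial.monomial a 1) ∈ S)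
    (hhigh : ∀ a, K ≤ monomialDegree w a → ∀ g, A.ofPoly (MvPolynomial.monomial a 1) * g ∈ S) :
    S = ⊤ := by
  have claim : ∀ (t : ℕ) a, K ≤ monomialDegree w a + t →
      ∀ g, A.ofPoly (MvPolynomial.monomial a 1) * g ∈ S := by
    intro t
    induction t with
    | zero => intro a ha; exact hhigh a (by simpa using ha)
    | succ t ih =>
      intro a ha g
      obtain ⟨c, hc⟩ := hA.exists_sub_mem_span g
      obtain ⟨u, hu⟩ := Ideal.mem_span_range_iff_exists_fun.1 hc
      rw [← sub_add_cancel g (algebraMap 𝕜 A.carrier c), ← hu, mul_add, Finset.mul_sum]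
      refine add_mem (sum_mem fun i _ => ?_) ?_
      · have := ih (a + Finsupp.single i 1) (by
          rw [monomialDegree_add_single]
          have := hw i
          push_cast at ha
          omega) (u i)
        rwa [A.ofPoly_monomial_add_single, mul_assoc, mul_comm (A.coord i)] at this
      · rw [mul_comm, ← Algebra.smul_def]
        exact S.smul_mem _ (hmon a)
  refine eq_top_iff.2 fun g _ => ?_
  have := claim K.toNat 0 (by rw [monomialDegree_zero]; omega) g
  simpa using this

/-- Every function is a polynomial up to terms of high degree (Taylor expansion). -/
theorem exists_ofPoly_sub_mem (hA : A.EulerSolvable w) (hw : ∀ i, 0 < w i) (K : ℤ) (g : A.carrier) :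
    ∃ p, g - A.ofPoly p ∈ A.degIdeal w K := by
  have h : LinearMap.range A.ofPoly.toLinearMap ⊔ (A.degIdeal w K).restrictScalars 𝕜 = ⊤ := by
    refine hA.submodule_eq_top hw _ K (fun a => Submodule.mem_sup_left ⟨_, rfl⟩) fun a ha g => ?_
    exact Submodule.mem_sup_right (Ideal.mul_mem_right _ _ (Ideal.subset_span ⟨a, ha, rfl⟩))
  have hg : g ∈ LinearMap.range A.ofPoly.toLinearMap ⊔ (A.degIdeal w K).restrictScalars 𝕜 :=
    h ▸ trivial
  obtain ⟨_, ⟨p, rfl⟩, q, hq, rfl⟩ := Submodule.mem_sup.1 hg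
  exact ⟨p, by simpa using hq⟩

theorem vact_euler_monomial_mul (hA : A.EulerSolvable w) (a : Fin n →₀ ℕ) (g : A.carrier) :
    vact A.D (eulerField w A.coord) (A.ofPoly (MvPolynomial.monomial a 1) * g) =
      A.ofPoly (MvPolynomial.monomial a 1) *
        (vact A.D (eulerField w A.coord) g + (monomialDegree w a : 𝕜) • g) := by
  rw [Derivation.leibniz, ← ofPolyField_polyEuler, hA.vact_ofPoly, euler_monomial, map_smul]
  simp only [smul_eq_mul, Algebra.smul_def]
  ring

/-- Every function is, up to the image of `W - d`, a quasihomogeneous polynomial of degree `d`,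
where `W` is the Euler field. -/
theorem exists_euler_sub (hA : A.EulerSolvable w) [CharZero 𝕜] (hw : ∀ i, 0 < w i) (d : ℤ)
    (g : A.carrier) :
    ∃ q, IsQuasihomogeneous w q d ∧ ∃ u,
      g = A.ofPoly q + (vact A.D (eulerField w A.coord) u - (d : 𝕜) • u) := by
  let T : A.carrier →ₗ[𝕜] A.carrier :=
    (vact A.D (eulerField w A.coord)).toLinearMap - (d : 𝕜) • LinearMap.id
  have h : (quasihomogeneousPolys 𝕜 w d).map A.ofPoly.toLinearMap ⊔ LinearMap.range T = ⊤ := by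
    refine hA.submodule_eq_top hw _ (d + 1) (fun a => ?_) fun a ha g => ?_
    · by_cases hd : monomialDegree w a = d
      · exact Submodule.mem_sup_left ⟨_, hd ▸ isQuasihomogeneous_monomial w a 1, rfl⟩
      · refine Submodule.mem_sup_right ⟨((monomialDegree w a - d : ℤ) : 𝕜)⁻¹ •
          A.ofPoly (MvPolynomial.monomial a 1), ?_⟩
        have h1 := hA.vact_euler_monomial_mul a 1
        rw [Derivation.map_one_eq_zero, zero_add, mul_one, mul_smul_comm, mul_one] at h1
        have h2 : ((monomialDegree w a - d : ℤ) : 𝕜) ≠ 0 := by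
          exact_mod_cast sub_ne_zero.2 hd
        change vact A.D _ _ - (d : 𝕜) • ((_ : 𝕜) • _) = _
        rw [Derivation.map_smul, h1, smul_smul, smul_smul, ← sub_smul, mul_comm, ← sub_mul,
          ← Int.cast_sub, mul_inv_cancel₀ h2, one_smul]
    · obtain ⟨v, hv⟩ := hA.exists_euler_add (monomialDegree w a - d).toNat (by omega) g
      refine Submodule.mem_sup_right ⟨A.ofPoly (MvPolynomial.monomial a 1) * v, ?_⟩
      change vact A.D _ _ - (d : 𝕜) • (_ * _) = _
      have h2 : (((monomialDegree w a - d).toNat : ℕ) : A.carrier) * v =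
          (monomialDegree w a : 𝕜) • v - (d : 𝕜) • v := by
        rw [← sub_smul, ← Int.cast_sub, Algebra.smul_def, map_intCast, ← Int.cast_natCast,
          Int.toNat_of_nonneg (by omega)]
      rw [hA.vact_euler_monomial_mul, ← hv, h2, ← mul_smul_comm, ← mul_sub]
      congr 1
      abel
  have hg : g ∈ (quasihomogeneousPolys 𝕜 w d).map A.ofPoly.toLinearMap ⊔ LinearMap.range T :=
    h ▸ trivial
  obtain ⟨_, ⟨q, hq, rfl⟩, _, ⟨u, rfl⟩, rfl⟩ := Submodule.mem_sup.1 hg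
  exact ⟨q, hq, u, rfl⟩

theorem D_mem_degIdeal (hA : A.EulerSolvable w) (i : Fin n) {K : ℤ} {g : A.carrier}
    (hg : g ∈ A.degIdeal w K) :
    A.D i g ∈ A.degIdeal w (K - w i) := by
  refine Submodule.span_induction ?_ ?_ ?_ ?_ hg
  · rintro _ ⟨a, ha, rfl⟩
    simp only [hA.D_ofPoly, MvPolynomial.pderiv_monomial, one_mul]
    by_cases h : a i = 0
    · simp [h]
    · have h1 : Finsupp.single i 1 ≤ a := by
        rw [Finsupp.single_le_iff]; omega
      have h2 := monomialDegree_add_single w (a - Finsupp.single i 1) i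
      rw [tsub_add_cancel_of_le h1] at h2
      rw [← mul_one ((a i : ℕ) : 𝕜), ← MvPolynomial.C_mul_monomial, map_mul]
      refine Ideal.mul_mem_left _ _ (Ideal.subset_span ⟨_, ?_, rfl⟩)
      have ha : K ≤ monomialDegree w a := ha
      simp only [Set.mem_ofPred_eq]
      omega
  · rw [map_zero]; exact zero_mem _
  · intro x y _ _ hx hy
    rw [map_add]; exact add_mem hx hy
  · intro x y hy h
    rw [smul_eq_mul, Derivation.leibniz, smul_eq_mul, smul_eq_mul]
    exact add_mem (Ideal.mul_mem_left _ _ h)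
      (Ideal.mul_mem_right _ _ (A.degIdeal_anti w (by omega) hy))

/-- Low-degree coefficients of a polynomial can be read off modulo functions of high degree. The
proof is by induction on `|a|`: differentiation along `xᵢ` lowers `a` to `a - eᵢ` and maps the ideal
of degree `K` to that of degree `K - wᵢ`. -/
theorem coeff_eq_zero_of_mem_degIdeal (hA : A.EulerSolvable w) [CharZero 𝕜] (t : ℕ) :
    ∀ (a : Fin n →₀ ℕ), ∑ i, a i = t → ∀ (K : ℤ) (p : MvPolynomial (Fin n) 𝕜),
      A.ofPoly p ∈ A.degIdeal w K → monomialDegree w a < K → MvPolynomial.coeff a p = 0 := by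
  induction t with
  | zero =>
    intro a ha K p hp hK
    obtain rfl : a = 0 := by
      ext i
      exact Finset.sum_eq_zero_iff.1 ha i (Finset.mem_univ i)
    rw [monomialDegree_zero] at hK
    by_contra hc
    refine hA.span_coord_ne_top (Ideal.eq_top_of_isUnit_mem _ (x := algebraMap 𝕜 A.carrier
      (MvPolynomial.coeff 0 p)) ?_ ((IsUnit.mk0 _ hc).map _))
    have h1 : p - MvPolynomial.C (MvPolynomial.coeff 0 p) ∈
        Ideal.span (MvPolynomial.X '' Set.univ : Set (MvPolynomial (Fin n) 𝕜)) := by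
      rw [MvPolynomial.mem_ideal_span_X_image]
      intro m hm
      by_contra! h
      rw [show m = 0 from Finsupp.ext fun i => h i trivial] at hm
      simp at hm
    have h2 := Ideal.mem_map_of_mem A.ofPoly h1
    rw [Ideal.map_span, ← Set.image_comp, map_sub, A.ofPoly_C, Set.image_univ] at h2
    have h3 : A.ofPoly ∘ MvPolynomial.X = A.coord := funext A.ofPoly_X
    rw [h3] at h2
    have h4 := A.degIdeal_le_span_coord hK hp
    have := sub_mem h4 h2
    rwa [sub_sub_cancel] at this
  | succ t ih =>
    intro a ha K p hp hK
    obtain ⟨i, -, hi⟩ : ∃ i ∈ Finset.univ, a i ≠ 0 := by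
      by_contra! h
      rw [Finset.sum_eq_zero h] at ha
      omega
    have h1 : Finsupp.single i 1 ≤ a := by
      rw [Finsupp.single_le_iff]; omega
    obtain ⟨b, rfl⟩ : ∃ b, a = b + Finsupp.single i 1 := ⟨_, (tsub_add_cancel_of_le h1).symm⟩
    rw [monomialDegree_add_single] at hK
    have h2 := ih b (by
      simp only [Finsupp.add_apply, Finset.sum_add_distrib] at ha
      have : ∑ x, (Finsupp.single i 1 : Fin n →₀ ℕ) x = 1 := by
        simp [Finsupp.single_apply]
      omega) (K - w i) (MvPolynomial.pderiv i p) (by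
        rw [← hA.D_ofPoly]; exact hA.D_mem_degIdeal i hp) (by omega)
    rw [MvPolynomial.coeff_pderiv] at h2
    exact (mul_eq_zero.1 h2).resolve_right (Nat.cast_add_one_ne_zero (b i))

/-- Quasihomogeneous components of an identity `p = α f div Y + β Y.f` whose unknown field `Y` is
not polynomial.  The field is approximated by a polynomial one up to terms of high degree. -/
theorem exists_quasiComp_eq (hA : A.EulerSolvable w) [CharZero 𝕜] (hw : ∀ i, 0 < w i) {N : ℤ}
    {f : MvPolynomial (Fin n) 𝕜} (hf : IsQuasihomogeneous w f N) (α β : 𝕜)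
    {p : MvPolynomial (Fin n) 𝕜} {Y : VField A.carrier n}
    (hp : A.ofPoly p = α • (A.ofPoly f * divergence A.D Y) + β • vact A.D Y (A.ofPoly f)) (d : ℤ) :
    ∃ y, IsQuasihomogeneousField w y (d - N) ∧
      quasiComp w d p = α • (f * divergence (polyD 𝕜 n) y) + β • vact (polyD 𝕜 n) y f := by
  set K : ℤ := d + 1 + ∑ i, (w i : ℤ) with hK
  choose z hz using fun i => hA.exists_ofPoly_sub_mem hw K (Y i)
  have hwi : ∀ i, (w i : ℤ) ≤ ∑ i, (w i : ℤ) := fun i =>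
    Finset.single_le_sum (f := fun i => (w i : ℤ)) (fun i _ => by positivity) (Finset.mem_univ i)
  set P := p - (α • (f * divergence (polyD 𝕜 n) z) + β • vact (polyD 𝕜 n) z f) with hP
  have hmem : A.ofPoly P ∈ A.degIdeal w (d + 1) := by
    have h1 : A.ofPoly P = algebraMap 𝕜 _ α * (A.ofPoly f * ∑ i, A.D i (Y i - A.ofPoly (z i))) +
        algebraMap 𝕜 _ β * ∑ i, (Y i - A.ofPoly (z i)) * A.D i (A.ofPoly f) := by
      rw [hP, map_sub, hp, map_add, map_smul, map_smul, map_mul, ← hA.divergence_ofPoly,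
        ← hA.vact_ofPoly, divergence, divergence, vact_apply, vact_apply]
      simp only [map_sub, sub_mul, Finset.sum_sub_distrib, Algebra.smul_def, ofPolyField]
      ring
    rw [h1]
    refine add_mem (Ideal.mul_mem_left _ _ (Ideal.mul_mem_left _ _ (sum_mem fun i _ => ?_)))
      (Ideal.mul_mem_left _ _ (sum_mem fun i _ => Ideal.mul_mem_right _ _ ?_))
    · exact A.degIdeal_anti w (by have := hwi i; omega) (hA.D_mem_degIdeal i (hz i))
    · exact A.degIdeal_anti w (by have := hwi i; omega) (hz i)
  have hcomp : quasiComp w d P = 0 := by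
    refine MvPolynomial.weightedHomogeneousComponent_eq_zero' _ _ fun a ha h => ?_
    rw [weight_eq_monomialDegree] at h
    exact MvPolynomial.mem_support_iff.1 ha
      (hA.coeff_eq_zero_of_mem_degIdeal _ a rfl _ P hmem (by omega))
  refine ⟨quasiCompField w (d - N) z, isQuasihomogeneousField_quasiCompField w _ z, ?_⟩
  rw [hP, map_sub, sub_eq_zero] at hcomp
  rw [hcomp, map_add, map_smul, map_smul, quasiComp_vact hf, mul_comm f, quasiComp_mul hf,
    quasiComp_divergence, mul_comm f]

theorem exists_quasiComp_eq_vact (hA : A.EulerSolvable w) [CharZero 𝕜] (hw : ∀ i, 0 < w i) {N : ℤ}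
    {f : MvPolynomial (Fin n) 𝕜} (hf : IsQuasihomogeneous w f N)
    {p : MvPolynomial (Fin n) 𝕜} (hp : A.ofPoly p ∈ A.gradIdeal (A.ofPoly f)) (d : ℤ) :
    ∃ y, IsQuasihomogeneousField w y (d - N) ∧ quasiComp w d p = vact (polyD 𝕜 n) y f := by
  obtain ⟨Y, hY⟩ := (A.mem_gradIdeal_iff _ _).1 hp
  obtain ⟨y, hy, h⟩ := hA.exists_quasiComp_eq hw hf 0 1 (p := p) (Y := Y)
    (by rw [hY, zero_smul, zero_add, one_smul]) d
  exact ⟨y, hy, by rw [h, zero_smul, zero_add, one_smul]⟩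

/-- If `Q_f` is finite-dimensional, the polynomial gradient ideal contains a power of each
variable: the leading term of a polynomial in `xᵢ` that vanishes in `Q_f`. -/
theorem exists_X_pow_mem (hA : A.EulerSolvable w) [CharZero 𝕜] (hw : ∀ i, 0 < w i) {N : ℤ}
    {f : MvPolynomial (Fin n) 𝕜} (hf : IsQuasihomogeneous w f N)
    [Module.Finite 𝕜 (A.Q (A.ofPoly f))] (i : Fin n) :
    ∃ k : ℕ, (MvPolynomial.X i : MvPolynomial (Fin n) 𝕜) ^ k ∈
      Ideal.span (Set.range fun i => MvPolynomial.pderiv i f) := by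
  obtain ⟨q, hq, hq0⟩ := Algebra.IsIntegral.isIntegral (R := 𝕜)
    (Ideal.Quotient.mk (A.gradIdeal (A.ofPoly f)) (A.coord i))
  have h1 : A.ofPoly (Polynomial.aeval (MvPolynomial.X i) q) ∈ A.gradIdeal (A.ofPoly f) := by
    rw [← Ideal.Quotient.eq_zero_iff_mem, ← Polynomial.aeval_algHom_apply, A.ofPoly_X]
    have := Polynomial.aeval_algHom_apply (Ideal.Quotient.mkₐ 𝕜 (A.gradIdeal (A.ofPoly f)))
      (A.coord i) q
    exact this.symm.trans hq0
  obtain ⟨y, -, hy⟩ := hA.exists_quasiComp_eq_vact hw hf h1 (w i * q.natDegree)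
  have h2 : quasiComp w (w i * q.natDegree)
      (Polynomial.aeval (MvPolynomial.X i : MvPolynomial (Fin n) 𝕜) q) =
      MvPolynomial.X i ^ q.natDegree := by
    have hj : ∀ j : ℕ, IsQuasihomogeneous w
        (q.coeff j • (MvPolynomial.X i : MvPolynomial (Fin n) 𝕜) ^ j) (w i * j) := fun j => by
      rw [MvPolynomial.smul_eq_C_mul, MvPolynomial.X_pow_eq_monomial, MvPolynomial.C_mul_monomial]
      convert isQuasihomogeneous_monomial w (Finsupp.single i j) (q.coeff j * 1) using 1
      rw [← weight_eq_monomialDegree]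
      simp [Finsupp.weight_single, mul_comm]
    rw [Polynomial.aeval_eq_sum_range, map_sum, Finset.sum_eq_single q.natDegree]
    · rw [quasiComp_of_isQuasihomogeneous w (hj _), if_pos rfl, hq.coeff_natDegree, one_smul]
    · intro j _ hne
      rw [quasiComp_of_isQuasihomogeneous w (hj _), if_neg]
      have := (hw i).ne'
      intro h
      have := mul_left_cancel₀ (by exact_mod_cast this) h
      exact hne (by exact_mod_cast this.symm)
    · simp
  refine ⟨q.natDegree, ?_⟩
  rw [← h2, hy, vact_apply]
  exact Ideal.mem_span_range_iff_exists_fun.2 ⟨y, rfl⟩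

/-- For `N = 0` the derivatives of `f` would have negative degree, so they would vanish. -/
theorem degree_ne_zero (hA : A.EulerSolvable w) [CharZero 𝕜] (hw : ∀ i, 0 < w i) {N : ℤ} [NeZero n]
    {f : MvPolynomial (Fin n) 𝕜} (hf : IsQuasihomogeneous w f N)
    [Module.Finite 𝕜 (A.Q (A.ofPoly f))] : N ≠ 0 := by
  rintro rfl
  obtain ⟨k, hk⟩ := hA.exists_X_pow_mem hw hf 0
  have h0 : ∀ i, MvPolynomial.pderiv i f = 0 := fun i =>
    eq_zero_of_isQuasihomogeneous_neg (by have := hw i; omega) (isQuasihomogeneous_pderiv hf i)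
  simp only [h0] at hk
  have : Ideal.span (Set.range fun _ : Fin n => (0 : MvPolynomial (Fin n) 𝕜)) = ⊥ := by
    simp
  rw [this, Ideal.mem_bot] at hk
  exact MvPolynomial.X_ne_zero _ (eq_zero_of_pow_eq_zero hk)

end FunctionAlgebra.EulerSolvable

end LocalAlgebra

/-! ### Monomial bases and normal forms -/

section NormalForm

variable {𝕜 : Type} [Field 𝕜] {n : ℕ}

theorem mem_monomialSpan_iff {S : Set (Fin n →₀ ℕ)} {p : MvPolynomial (Fin n) 𝕜} :
    p ∈ monomialSpan 𝕜 S ↔ ∀ a ∈ p.support, a ∈ S := by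
  constructor
  · intro h
    refine Submodule.span_induction ?_ (by simp) ?_ ?_ h
    · rintro _ ⟨a, ha, rfl⟩ b hb
      classical
      rw [MvPolynomial.mem_support_iff, MvPolynomial.coeff_monomial] at hb
      by_cases hab : a = b
      · rwa [← hab]
      · rw [if_neg hab] at hb; exact absurd rfl hb
    · intro x y _ _ hx hy a ha
      classical
      rcases Finset.mem_union.1 (MvPolynomial.support_add ha) with h | h
      exacts [hx a h, hy a h]
    · intro c x _ hx a ha
      exact hx a (MvPolynomial.support_smul ha)
  · intro h
    rw [p.as_sum]
    refine sum_mem fun a ha => ?_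
    rw [← mul_one (MvPolynomial.coeff a p), ← MvPolynomial.C_mul_monomial,
      ← MvPolynomial.smul_eq_C_mul]
    exact Submodule.smul_mem _ _ (Submodule.subset_span ⟨a, h a ha, rfl⟩)

theorem isQuasihomogeneous_of_mem_monomialSpan {w : Fin n → ℕ} {S : Set (Fin n →₀ ℕ)} {d : ℤ}
    (hS : ∀ a ∈ S, monomialDegree w a = d) {p : MvPolynomial (Fin n) 𝕜}
    (hp : p ∈ monomialSpan 𝕜 S) : IsQuasihomogeneous w p d := fun a ha => by
  rw [weight_eq_monomialDegree]
  exact hS a (mem_monomialSpan_iff.1 hp a (MvPolynomial.mem_support_iff.2 ha))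

theorem quasiComp_mem_monomialSpan {w : Fin n → ℕ} {B : Finset (Fin n →₀ ℕ)} (d : ℤ)
    {p : MvPolynomial (Fin n) 𝕜} (hp : p ∈ monomialSpan 𝕜 {a | a ∈ B}) :
    quasiComp w d p ∈ monomialSpan 𝕜 {a | a ∈ B ∧ monomialDegree w a = d} := by
  rw [mem_monomialSpan_iff] at hp ⊢
  intro a ha
  rw [MvPolynomial.support_weightedHomogeneousComponent, Finset.mem_filter,
    weight_eq_monomialDegree] at ha
  exact ⟨hp a ha.1, ha.2⟩

theorem exists_eq_sum_of_mem_monomialSpan {B : Finset (Fin n →₀ ℕ)}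
    {p : MvPolynomial (Fin n) 𝕜} (hp : p ∈ monomialSpan 𝕜 {a | a ∈ B}) :
    p = ∑ a : B, MvPolynomial.coeff a.1 p • MvPolynomial.monomial a.1 (1 : 𝕜) := by
  rw [mem_monomialSpan_iff] at hp
  conv_lhs => rw [p.as_sum]
  rw [Finset.sum_coe_sort B
    (fun a => MvPolynomial.coeff a p • MvPolynomial.monomial a (1 : 𝕜))]
  refine (Finset.sum_subset (fun a ha => hp a ha) fun a _ ha => ?_).trans ?_
  · rw [MvPolynomial.notMem_support_iff.1 ha, MvPolynomial.monomial_zero]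
  · refine Finset.sum_congr rfl fun a _ => ?_
    rw [MvPolynomial.smul_eq_C_mul, MvPolynomial.C_mul_monomial, mul_one]

theorem finrank_monomialSpan (S : Finset (Fin n →₀ ℕ)) :
    Module.finrank 𝕜 (monomialSpan 𝕜 (S : Set (Fin n →₀ ℕ))) = S.card := by
  classical
  have hli : LinearIndependent 𝕜 fun a : Fin n →₀ ℕ => MvPolynomial.monomial a (1 : 𝕜) := by
    have := (MvPolynomial.basisMonomials (Fin n) 𝕜).linearIndependent
    rwa [MvPolynomial.coe_basisMonomials] at this
  rw [monomialSpan, ← Finset.coe_image, finrank_span_finset_eq_card]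
  · exact Finset.card_image_of_injective _ hli.injective
  · rw [Finset.coe_image]
    exact (hli.linearIndepOn S).id_image

instance finite_monomialSpan (S : Finset (Fin n →₀ ℕ)) :
    Module.Finite 𝕜 (monomialSpan 𝕜 (S : Set (Fin n →₀ ℕ))) :=
  Module.Finite.span_of_finite 𝕜 (S.finite_toSet.image _)

theorem finite_quasihomogeneousPolys {w : Fin n → ℕ} (hw : ∀ i, 0 < w i) (d : ℤ) :
    Module.Finite 𝕜 (quasihomogeneousPolys 𝕜 w d) := by
  have hfin : {a : Fin n →₀ ℕ | monomialDegree w a = d}.Finite := by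
    refine Set.Finite.subset (Set.finite_Iic
      (Finsupp.equivFunOnFinite.symm fun _ => d.toNat : Fin n →₀ ℕ)) fun a ha i => ?_
    have h1 : (a i : ℤ) * w i ≤ monomialDegree w a :=
      Finset.single_le_sum (f := fun i => (a i : ℤ) * w i) (fun i _ => by positivity)
        (Finset.mem_univ i)
    have ha : monomialDegree w a = d := ha
    have h2 : (a i : ℤ) * 1 ≤ (a i : ℤ) * w i :=
      mul_le_mul_of_nonneg_left (by have := hw i; omega) (by positivity)
    simp only [Finsupp.equivFunOnFinite_symm_apply_apply]
    omega
  have hle : quasihomogeneousPolys 𝕜 w d ≤ monomialSpan 𝕜 (hfin.toFinset : Set (Fin n →₀ ℕ)) := by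
    intro p hp
    rw [mem_monomialSpan_iff]
    intro a ha
    have := hp (MvPolynomial.mem_support_iff.1 ha)
    rw [weight_eq_monomialDegree] at this
    simpa using this
  exact Submodule.finiteDimensional_of_le hle

variable {A : FunctionAlgebra 𝕜 n} {w : Fin n → ℕ} {f : MvPolynomial (Fin n) 𝕜}
  {B : Finset (Fin n →₀ ℕ)}

theorem FunctionAlgebra.IsMonomialBasis.eq_zero (hB : A.IsMonomialBasis (A.ofPoly f) B)
    {p : MvPolynomial (Fin n) 𝕜} (hp : p ∈ monomialSpan 𝕜 {a | a ∈ B})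
    (hpf : A.ofPoly p ∈ A.gradIdeal (A.ofPoly f)) : p = 0 := by
  have hsum := exists_eq_sum_of_mem_monomialSpan hp
  have h0 := Fintype.linearIndependent_iff.1 hB.1 (fun a => MvPolynomial.coeff a.1 p) (by
    rw [hsum, map_sum, ← Ideal.Quotient.eq_zero_iff_mem, map_sum] at hpf
    rw [← hpf]
    refine Finset.sum_congr rfl fun a _ => ?_
    rw [map_smul]
    rfl)
  rw [hsum]
  exact Finset.sum_eq_zero fun a _ => by rw [h0 a, zero_smul]

theorem FunctionAlgebra.IsMonomialBasis.exists_sub_mem (hB : A.IsMonomialBasis (A.ofPoly f) B)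
    (g : A.carrier) : ∃ b ∈ monomialSpan 𝕜 {a | a ∈ B},
      g - A.ofPoly b ∈ A.gradIdeal (A.ofPoly f) := by
  have hg : Ideal.Quotient.mk (A.gradIdeal (A.ofPoly f)) g ∈ Submodule.span 𝕜 (Set.range
      fun a : B => Ideal.Quotient.mk (A.gradIdeal (A.ofPoly f))
        (A.ofPoly (MvPolynomial.monomial a.1 1))) := hB.2 ▸ trivial
  obtain ⟨c, hc⟩ := Submodule.mem_span_range_iff_exists_fun 𝕜 |>.1 hg
  refine ⟨∑ a : B, c a • MvPolynomial.monomial a.1 1, sum_mem fun a _ =>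
    Submodule.smul_mem _ _ (Submodule.subset_span ⟨a.1, a.2, rfl⟩), ?_⟩
  rw [← Ideal.Quotient.eq_zero_iff_mem, map_sub, ← hc, map_sum, map_sum, sub_eq_zero]
  refine Finset.sum_congr rfl fun a _ => ?_
  rw [map_smul]
  rfl

theorem finrank_Q_eq_card (hB : A.IsMonomialBasis (A.ofPoly f) B) :
    Module.finrank 𝕜 (A.Q (A.ofPoly f)) = B.card := by
  rw [Module.finrank_eq_card_basis (Module.Basis.mk hB.1 hB.2.ge)]
  simp

namespace FunctionAlgebra.EulerSolvable

/-- A quasihomogeneous polynomial is a combination of basis monomials of its degree, up to the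
derivative of `f` along a quasihomogeneous polynomial vector field. -/
theorem exists_monomialSpan_add_vact [CharZero 𝕜] (hA : A.EulerSolvable w) (hw : ∀ i, 0 < w i)
    {N : ℤ} (hf : IsQuasihomogeneous w f N) (hB : A.IsMonomialBasis (A.ofPoly f) B) {d : ℤ}
    {q : MvPolynomial (Fin n) 𝕜} (hq : IsQuasihomogeneous w q d) :
    ∃ b ∈ monomialSpan 𝕜 {a | a ∈ B ∧ monomialDegree w a = d}, ∃ y,
      IsQuasihomogeneousField w y (d - N) ∧ q = b + vact (polyD 𝕜 n) y f := by
  obtain ⟨b, hb, hqb⟩ := hB.exists_sub_mem (A.ofPoly q)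
  rw [← map_sub] at hqb
  obtain ⟨y, hy, h⟩ := hA.exists_quasiComp_eq_vact hw hf hqb d
  refine ⟨_, quasiComp_mem_monomialSpan d hb, y, hy, ?_⟩
  rw [map_sub, quasiComp_of_isQuasihomogeneous w hq, if_pos rfl] at h
  rw [← h, add_sub_cancel]

end FunctionAlgebra.EulerSolvable

/-- The operator `X ↦ f div X - c X.f` to which `d_f` reduces on `(n-1)`-forms. -/
def fieldOp {F : Type} [CommRing F] [Algebra 𝕜 F] (D : Fin n → Derivation 𝕜 F F) (f : F) (c : 𝕜)
    (X : VField F n) : F := f * divergence D X - c • vact D X f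

section fieldOp

variable {F : Type} [CommRing F] [Algebra 𝕜 F] (D : Fin n → Derivation 𝕜 F F) (f : F) (c : 𝕜)

theorem fieldOp_add (X Y : VField F n) :
    fieldOp D f c (X + Y) = fieldOp D f c X + fieldOp D f c Y := by
  simp only [fieldOp, divergence_add, vact_add_left]
  rw [mul_add, smul_add]
  ring

theorem fieldOp_smul (a : F) (X : VField F n) :
    fieldOp D f c (a • X) = a * fieldOp D f c X + f * vact D X a := by
  rw [fieldOp, fieldOp, divergence_smul, vact_smul_left, Algebra.smul_def, Algebra.smul_def]
  ring

theorem fieldOp_algebraMap_smul (a : 𝕜) (X : VField F n) :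
    fieldOp D f c (algebraMap 𝕜 F a • X) = a • fieldOp D f c X := by
  rw [fieldOp_smul, Derivation.map_algebraMap, mul_zero, add_zero, Algebra.smul_def]

end fieldOp

/-- Multiplication by a power of `f` shifts the coefficient of the operator. -/
theorem fieldOp_pow_smul {F : Type} [CommRing F] [Algebra 𝕜 F] (D : Fin n → Derivation 𝕜 F F)
    (f : F) (c : 𝕜) (p : ℕ) (X : VField F n) :
    fieldOp D f c (f ^ p • X) = f ^ p * fieldOp D f (c - p) X := by
  rw [fieldOp_smul, Derivation.leibniz_pow]
  rcases p with _ | p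
  · simp [fieldOp]
  · rw [fieldOp, fieldOp, nsmul_eq_mul, smul_eq_mul, Algebra.smul_def, Algebra.smul_def, map_sub,
      map_natCast, Nat.add_sub_cancel]
    ring

namespace FunctionAlgebra.EulerSolvable

/-- Reduction of `f^p q` for a quasihomogeneous polynomial `q` of degree `(κ+1)N - ∑ wᵢ`. Writing
`q = b + Y.f`, the term `f^p Y.f` is equivalent to a multiple of `f^{p+1} div Y`, and `div Y` has
degree `κN - ∑ wᵢ`. -/
theorem exists_polynomial_normalForm [CharZero 𝕜] (hA : A.EulerSolvable w) (hw : ∀ i, 0 < w i)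
    {N : ℤ} (hf : IsQuasihomogeneous w f N) (hB : A.IsMonomialBasis (A.ofPoly f) B) {m κ : ℕ}
    (hκ : κ < m) {q : MvPolynomial (Fin n) 𝕜}
    (hq : IsQuasihomogeneous w q ((κ + 1) * N - ∑ i, (w i : ℤ))) :
    ∃ h : ℕ → MvPolynomial (Fin n) 𝕜,
      IsQuasihomogeneous w (h 0) (N - ∑ i, (w i : ℤ)) ∧
      (∀ j : ℕ, 1 ≤ j → j ≤ κ → h j ∈ monomialSpan 𝕜
        {a | a ∈ B ∧ monomialDegree w a = ((j : ℤ) + 1) * N - ∑ i, (w i : ℤ)}) ∧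
      ∃ X, f ^ (m - κ) * q = ∑ j ∈ Finset.range (κ + 1), f ^ (m - j) * h j +
        fieldOp (polyD 𝕜 n) f (m : 𝕜) X := by
  induction κ generalizing q with
  | zero =>
    refine ⟨fun _ => q, by simpa using hq, fun j h1 h2 => by omega, 0, ?_⟩
    simp [fieldOp, divergence, vact_apply]
  | succ κ ih =>
    obtain ⟨b, hb, Y, hY, rfl⟩ := hA.exists_monomialSpan_add_vact hw hf hB hq
    have hκ0 : (κ + 1 : 𝕜) ≠ 0 := Nat.cast_add_one_ne_zero κ
    obtain ⟨h, h0, hj, X, hX⟩ := ih (by omega) (q := (κ + 1 : 𝕜)⁻¹ • divergence (polyD 𝕜 n) Y)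
      (Submodule.smul_mem (quasihomogeneousPolys 𝕜 w _) _ (by
        have := hY.divergence
        rwa [show ((κ + 1 : ℕ) + 1 : ℤ) * N - ∑ i, (w i : ℤ) - N =
          ((κ : ℤ) + 1) * N - ∑ i, (w i : ℤ) by push_cast; ring] at this))
    refine ⟨Function.update h (κ + 1) b, ?_, fun j h1 h2 => ?_,
      X + (MvPolynomial.C (-(κ + 1 : 𝕜)⁻¹) : MvPolynomial (Fin n) 𝕜) • (f ^ (m - (κ + 1)) • Y), ?_⟩
    · rwa [Function.update_of_ne (by omega)]
    · rcases Nat.lt_or_ge κ j with hlt | hle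
      · obtain rfl : j = κ + 1 := by omega
        rwa [Function.update_self]
      · rw [Function.update_of_ne (by omega)]
        exact hj j h1 hle
    · have hs : ∑ j ∈ Finset.range (κ + 1), f ^ (m - j) * Function.update h (κ + 1) b j =
          ∑ j ∈ Finset.range (κ + 1), f ^ (m - j) * h j :=
        Finset.sum_congr rfl fun j hj => by
          rw [Function.update_of_ne (Finset.mem_range.1 hj).ne]
      rw [Finset.sum_range_succ, hs, Function.update_self, fieldOp_add,
        ← MvPolynomial.algebraMap_eq, fieldOp_algebraMap_smul, fieldOp_pow_smul]
      have hm : ((m : 𝕜) - (m - (κ + 1) : ℕ)) = κ + 1 := by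
        rw [Nat.cast_sub (by omega)]
        push_cast
        ring
      have hpow : f ^ (m - κ) = f ^ (m - (κ + 1)) * f := by
        rw [← pow_succ]
        congr 1
        omega
      have e : (MvPolynomial.C (κ + 1 : 𝕜)⁻¹ : MvPolynomial (Fin n) 𝕜) *
          MvPolynomial.C (κ + 1 : 𝕜) = 1 := by
        rw [← map_mul, inv_mul_cancel₀ hκ0, map_one]
      have hYop : fieldOp (polyD 𝕜 n) f (κ + 1 : 𝕜) Y = f * divergence (polyD 𝕜 n) Y -
          MvPolynomial.C (κ + 1 : 𝕜) * vact (polyD 𝕜 n) Y f := by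
        rw [fieldOp, MvPolynomial.smul_eq_C_mul]
      rw [hm, hYop]
      rw [hpow] at hX
      simp only [MvPolynomial.smul_eq_C_mul, map_neg] at hX ⊢
      linear_combination hX - f ^ (m - (κ + 1)) * vact (polyD 𝕜 n) Y f * e

end FunctionAlgebra.EulerSolvable

variable {m : ℕ} {A : FunctionAlgebra 𝕜 (m + 1)} {w : Fin (m + 1) → ℕ}
  {f : MvPolynomial (Fin (m + 1)) 𝕜} {B : Finset (Fin (m + 1) →₀ ℕ)}

/-- The spaces in which the coefficients `h₁, …, hₙ` of a normal form lie. The index `j` stands for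
`h_{j+1}`. -/
def normalFormSpace (w : Fin (m + 1) → ℕ) (N : ℤ) (B : Finset (Fin (m + 1) →₀ ℕ))
    (j : Fin (m + 1)) : Submodule 𝕜 (MvPolynomial (Fin (m + 1)) 𝕜) :=
  if j = Fin.last m then monomialSpan 𝕜 {a | a ∈ B}
  else if j = 0 then quasihomogeneousPolys 𝕜 w (N - ∑ i, (w i : ℤ))
  else monomialSpan 𝕜 {a | a ∈ B ∧ monomialDegree w a = ((j : ℤ) + 1) * N - ∑ i, (w i : ℤ)}

namespace FunctionAlgebra.EulerSolvable

theorem fieldOp_ofPoly (hA : A.EulerSolvable w) (c : 𝕜)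
    (X : VField (MvPolynomial (Fin (m + 1)) 𝕜) (m + 1)) :
    fieldOp A.D (A.ofPoly f) c (A.ofPolyField X) =
      A.ofPoly (fieldOp (polyD 𝕜 (m + 1)) f c X) := by
  rw [fieldOp, fieldOp, hA.divergence_ofPoly, hA.vact_ofPoly, map_sub, map_mul, map_smul]

/-- Existence of the normal form. Reduction modulo the gradient ideal gives `g = b + Y.f`, and `Y.f`
is equivalent to `f div Y / m`. The Euler field replaces `div Y / m` by a quasihomogeneous
polynomial `q` of degree `mN - ∑ wᵢ`, and `f q` is treated by `exists_polynomial_normalForm`. -/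
theorem exists_normalForm [CharZero 𝕜] (hm : 1 ≤ m) (hA : A.EulerSolvable w) (hw : ∀ i, 0 < w i)
    {N : ℤ} (hf : IsQuasihomogeneous w f N) (hB : A.IsMonomialBasis (A.ofPoly f) B)
    (g : A.carrier) :
    ∃ h : Fin (m + 1) → MvPolynomial (Fin (m + 1)) 𝕜, (∀ j, h j ∈ normalFormSpace w N B j) ∧
      ∃ X, g - A.ofPoly (∑ j : Fin (m + 1), f ^ (m - (j : ℕ)) * h j) =
        fieldOp A.D (A.ofPoly f) (m : 𝕜) X := by
  have hm0 : (m : 𝕜) ≠ 0 := by exact_mod_cast (by omega : m ≠ 0)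
  obtain ⟨b, hb, hgb⟩ := hB.exists_sub_mem g
  obtain ⟨Y, hY⟩ := (A.mem_gradIdeal_iff _ _).1 hgb
  -- `g = b + Y.f` is equivalent to `b + f div Y / m`.
  set d : ℤ := m * N - ∑ i, (w i : ℤ) with hd
  obtain ⟨q, hq, u, hu⟩ := hA.exists_euler_sub hw d ((m : 𝕜)⁻¹ • divergence A.D Y)
  obtain ⟨h, h0, hj, X, hX⟩ := hA.exists_polynomial_normalForm hw hf hB (m := m) (κ := m - 1)
    (by omega) (q := q) (by
      convert hq using 1
      rw [hd, Nat.cast_sub hm]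
      push_cast
      ring)
  -- `f (W u - d u)` is the image of the field `u W`.
  have huW : fieldOp A.D (A.ofPoly f) (m : 𝕜) (u • eulerField w A.coord) =
      A.ofPoly f * (vact A.D (eulerField w A.coord) u - (d : 𝕜) • u) := by
    rw [fieldOp_smul, ← ofPolyField_polyEuler, hA.fieldOp_ofPoly, fieldOp, divergence_polyEuler,
      euler_apply hf, hd, map_sub, map_mul, A.ofPoly_C, smul_smul, map_smul]
    simp only [Algebra.smul_def]
    push_cast
    simp only [map_intCast]
    ring
  refine ⟨fun j => if j = Fin.last m then b else h j, fun j => ?_,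
    A.ofPolyField X + u • eulerField w A.coord + algebraMap 𝕜 A.carrier (-(m : 𝕜)⁻¹) • Y, ?_⟩
  · rw [normalFormSpace]
    by_cases hl : j = Fin.last m
    · simp only [if_pos hl]; exact hb
    · simp only [if_neg hl]
      have hjm := Fin.val_lt_last hl
      by_cases hj0 : j = 0
      · subst hj0; rw [if_pos rfl]; exact h0
      · rw [if_neg hj0]
        have : (j : ℕ) ≠ 0 := fun h => hj0 (Fin.ext h)
        exact hj j (by omega) (by omega)
  · have hs : ∑ j : Fin (m + 1), f ^ (m - (j : ℕ)) * (if j = Fin.last m then b else h j) =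
        ∑ j ∈ Finset.range m, f ^ (m - j) * h j + b := by
      rw [Fin.sum_univ_castSucc, if_pos rfl, Fin.val_last, Nat.sub_self, pow_zero, one_mul]
      congr 1
      rw [← Fin.sum_univ_eq_sum_range (fun j => f ^ (m - j) * h j) m]
      exact Finset.sum_congr rfl fun j _ => by
        rw [if_neg (Fin.castSucc_lt_last j).ne, Fin.val_castSucc]
    rw [Nat.sub_add_cancel hm, Nat.sub_sub_self hm, pow_one] at hX
    rw [hs, fieldOp_add, fieldOp_add, hA.fieldOp_ofPoly, huW, fieldOp_algebraMap_smul]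
    have hYop : fieldOp A.D (A.ofPoly f) (m : 𝕜) Y = A.ofPoly f * divergence A.D Y -
        algebraMap 𝕜 A.carrier m * vact A.D Y (A.ofPoly f) := by
      rw [fieldOp, Algebra.smul_def]
    have hX' := congrArg A.ofPoly hX
    rw [map_mul, map_add] at hX'
    have e : algebraMap 𝕜 A.carrier (m : 𝕜)⁻¹ * algebraMap 𝕜 A.carrier (m : 𝕜) = 1 := by
      rw [← map_mul, inv_mul_cancel₀ hm0, map_one]
    rw [map_add, hYop]
    simp only [Algebra.smul_def, map_neg] at hu ⊢
    linear_combination hY + hX' + A.ofPoly f * hu - vact A.D Y (A.ofPoly f) * e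

/-- Uniqueness of the normal form. The last term vanishes because it lies in the gradient ideal. The
rest is `f G` with `G` quasihomogeneous, so that the field `X` can be taken to be polynomial; `G` is
then the divergence of a field killing `f`, and `eq_zero_of_sum_eq_vact` applies. -/
theorem normalForm_eq_zero [CharZero 𝕜] (hm : 1 ≤ m) (hA : A.EulerSolvable w)
    (hw : ∀ i, 0 < w i) {N : ℤ} (hf : IsQuasihomogeneous w f N)
    [Module.Finite 𝕜 (A.Q (A.ofPoly f))] (hB : A.IsMonomialBasis (A.ofPoly f) B)
    {h : Fin (m + 1) → MvPolynomial (Fin (m + 1)) 𝕜} (hh : ∀ j, h j ∈ normalFormSpace w N B j)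
    {X : VField A.carrier (m + 1)}
    (hX : A.ofPoly (∑ j : Fin (m + 1), f ^ (m - (j : ℕ)) * h j) =
      fieldOp A.D (A.ofPoly f) (m : 𝕜) X) : h = 0 := by
  have hm0 : (m : 𝕜) ≠ 0 := by exact_mod_cast (by omega : m ≠ 0)
  have hN : N ≠ 0 := hA.degree_ne_zero hw hf
  have hN' : (N : 𝕜) ≠ 0 := by exact_mod_cast hN
  have hfin := hA.exists_X_pow_mem hw hf
  have hfgrad : A.ofPoly f ∈ A.gradIdeal (A.ofPoly f) := by
    have h1 := A.vact_mem_gradIdeal (A.ofPoly f) (A.ofPolyField (polyEuler 𝕜 w))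
    rw [hA.vact_ofPoly, euler_apply hf, map_smul, Algebra.smul_def] at h1
    have h2 := Ideal.mul_mem_left _ (algebraMap 𝕜 A.carrier (N : 𝕜)⁻¹) h1
    rwa [← mul_assoc, ← map_mul, inv_mul_cancel₀ hN', map_one, one_mul] at h2
  -- `H j = h j` for `j < m`, and `G` is the sum of the `f^{m-1-j} H j`.
  set H : ℕ → MvPolynomial (Fin (m + 1)) 𝕜 := fun j =>
    if hj : j < m + 1 then h ⟨j, hj⟩ else 0 with hH
  set G := ∑ j ∈ Finset.range (m - 1 + 1), f ^ (m - 1 - j) * H j with hG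
  have hsum : ∑ j : Fin (m + 1), f ^ (m - (j : ℕ)) * h j = f * G + h (Fin.last m) := by
    rw [Fin.sum_univ_castSucc, Fin.val_last, Nat.sub_self, pow_zero, one_mul, hG,
      Nat.sub_add_cancel hm, Finset.mul_sum]
    congr 1
    rw [← Fin.sum_univ_eq_sum_range (fun j => f * (f ^ (m - 1 - j) * H j)) m]
    refine Finset.sum_congr rfl fun j _ => ?_
    have hj := j.2
    rw [Fin.val_castSucc, show m - (j : ℕ) = (m - 1 - j) + 1 by omega, pow_succ', hH]
    simp only [show (j : ℕ) < m + 1 by omega, dite_true]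
    rw [mul_assoc]
    rfl
  have hlast : h (Fin.last m) = 0 := by
    refine hB.eq_zero (by simpa [normalFormSpace] using hh (Fin.last m)) ?_
    rw [hsum, map_add, map_mul] at hX
    rw [eq_sub_of_add_eq' hX, fieldOp, Algebra.smul_def]
    exact sub_mem (sub_mem (Ideal.mul_mem_right _ _ hfgrad)
      (Ideal.mul_mem_left _ _ (A.vact_mem_gradIdeal _ _))) (Ideal.mul_mem_right _ _ hfgrad)
  have hHhom : ∀ j ≤ m - 1, IsQuasihomogeneous w (H j) ((j + 1) * N - ∑ i, (w i : ℤ)) := by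
    intro j hj
    have hjm : j < m + 1 := by omega
    have h1 := hh ⟨j, hjm⟩
    have hne : (⟨j, hjm⟩ : Fin (m + 1)) ≠ Fin.last m := fun h => by
      have := congrArg Fin.val h
      simp only [Fin.val_last] at this
      omega
    rw [normalFormSpace, if_neg hne] at h1
    simp only [hH, hjm, dite_true]
    rcases Nat.eq_zero_or_pos j with rfl | hpos
    · rw [if_pos (by rfl)] at h1
      simpa using h1
    · rw [if_neg (fun h => by have := congrArg Fin.val h; simp at this; omega)] at h1
      exact isQuasihomogeneous_of_mem_monomialSpan (fun a ha => ha.2) h1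
  have hHgrad : ∀ j, 1 ≤ j → j ≤ m - 1 →
      H j ∈ Ideal.span (Set.range fun i => MvPolynomial.pderiv i f) → H j = 0 := by
    intro j h1 hj hgrad
    have hjm : j < m + 1 := by omega
    have h2 := hh ⟨j, hjm⟩
    have hne : (⟨j, hjm⟩ : Fin (m + 1)) ≠ Fin.last m := fun h => by
      have := congrArg Fin.val h
      simp only [Fin.val_last] at this
      omega
    rw [normalFormSpace, if_neg hne,
      if_neg (fun h => by have := congrArg Fin.val h; simp at this; omega)] at h2
    refine hB.eq_zero (p := H j) ?_ ?_
    · simp only [hH, hjm, dite_true]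
      rw [mem_monomialSpan_iff] at h2 ⊢
      exact fun a ha => (h2 a ha).1
    · obtain ⟨y, hy⟩ := Ideal.mem_span_range_iff_exists_fun.1 hgrad
      rw [← hy, ← vact_apply (polyD 𝕜 (m + 1)) y, ← hA.vact_ofPoly]
      exact A.vact_mem_gradIdeal _ _
  have hGhom : IsQuasihomogeneous w G (m * N - ∑ i, (w i : ℤ)) := by
    refine MvPolynomial.IsWeightedHomogeneous.sum _ _ _ fun j hj => ?_
    rw [Finset.mem_range] at hj
    have := (hf.pow (m - 1 - j)).mul (hHhom j (by omega))
    convert this using 1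
    rw [nsmul_eq_mul, Nat.cast_sub (by omega), Nat.cast_sub hm]
    push_cast
    ring
  -- The homogeneous component of the relation that contains `f G`.
  obtain ⟨x, hx, hfG⟩ := hA.exists_quasiComp_eq hw hf 1 (-(m : 𝕜)) (p := f * G) (Y := X) (by
    rw [hsum, hlast, add_zero] at hX
    rw [hX, fieldOp, one_smul, neg_smul, sub_eq_add_neg]) (N + (m * N - ∑ i, (w i : ℤ)))
  rw [quasiComp_of_isQuasihomogeneous w (hf.mul hGhom), if_pos rfl, one_smul] at hfG
  rw [add_sub_cancel_left] at hx
  set v := (m : 𝕜)⁻¹ • (divergence (polyD 𝕜 (m + 1)) x - G) with hv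
  have hvhom : IsQuasihomogeneous w v (m * N - ∑ i, (w i : ℤ)) :=
    Submodule.smul_mem (quasihomogeneousPolys 𝕜 w _) _ (hx.divergence.sub hGhom)
  have em : (MvPolynomial.C (m : 𝕜)⁻¹ : MvPolynomial (Fin (m + 1)) 𝕜) *
      MvPolynomial.C (m : 𝕜) = 1 := by
    rw [← map_mul, inv_mul_cancel₀ hm0, map_one]
  have eN : (MvPolynomial.C (N : 𝕜)⁻¹ : MvPolynomial (Fin (m + 1)) 𝕜) *
      MvPolynomial.C (N : 𝕜) = 1 := by
    rw [← map_mul, inv_mul_cancel₀ hN', map_one]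
  have hxf : vact (polyD 𝕜 (m + 1)) x f = f * v := by
    rw [hv]
    simp only [MvPolynomial.smul_eq_C_mul, map_neg] at hfG ⊢
    linear_combination (-vact (polyD 𝕜 (m + 1)) x f) * em + MvPolynomial.C (m : 𝕜)⁻¹ * hfG
  -- The field `x - (v/N) W` kills `f` and has divergence `G`.
  set Y : VField (MvPolynomial (Fin (m + 1)) 𝕜) (m + 1) :=
    x + (MvPolynomial.C (-(N : 𝕜)⁻¹) * v) • polyEuler 𝕜 w with hY
  have hYf : vact (polyD 𝕜 (m + 1)) Y f = 0 := by
    rw [hY, vact_add_left, vact_smul_left, euler_apply hf, hxf, MvPolynomial.smul_eq_C_mul, map_neg]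
    linear_combination (-f * v) * eN
  have hYdiv : divergence (polyD 𝕜 (m + 1)) Y = G := by
    rw [hY, divergence_add, divergence_smul, divergence_polyEuler, Derivation.leibniz,
      euler_apply hvhom, ← MvPolynomial.algebraMap_eq, Derivation.map_algebraMap,
      MvPolynomial.algebraMap_eq, MvPolynomial.smul_eq_C_mul]
    have e1 : (MvPolynomial.C (m : 𝕜) : MvPolynomial (Fin (m + 1)) 𝕜) * v =
        divergence (polyD 𝕜 (m + 1)) x - G := by
      rw [hv, MvPolynomial.smul_eq_C_mul, ← mul_assoc, mul_comm (MvPolynomial.C (m : 𝕜)), em,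
        one_mul]
    push_cast
    simp only [map_sub, map_mul, map_neg, smul_eq_mul, mul_zero, add_zero]
    linear_combination (-MvPolynomial.C (m : 𝕜) * v) * eN - e1
  obtain ⟨Z, hZ, hZ0⟩ := exists_divergence_eq_vact hfin hYf
  have hwlt : ∀ i, (w i : ℤ) < ∑ i, (w i : ℤ) := fun i => by
    obtain ⟨j, hj⟩ : ∃ j : Fin (m + 1), j ≠ i := by
      have : Nontrivial (Fin (m + 1)) := Fin.nontrivial_iff_two_le.2 (by omega)
      exact exists_ne i
    refine Finset.single_lt_sum (f := fun i => (w i : ℤ)) hj (Finset.mem_univ i)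
      (Finset.mem_univ j) ?_ fun k _ _ => ?_
    · exact_mod_cast hw j
    · positivity
  have key := eq_zero_of_sum_eq_vact hwlt hN hf hfin H (m - 1) hHhom hHgrad
    (hYdiv.symm.trans hZ) hZ0
  funext j
  by_cases hl : j = Fin.last m
  · rw [hl, hlast]; rfl
  · have hjm := Fin.val_lt_last hl
    have := key j (by omega)
    simpa [hH, hjm.le] using this

end FunctionAlgebra.EulerSolvable

end NormalForm

/-! ### Formal power series -/

section Formal

variable {𝕜 : Type} [Field 𝕜] {n : ℕ}

theorem coeff_mul_X_mvPowerSeries (u : MvPowerSeries (Fin n) 𝕜) (i : Fin n) (a : Fin n →₀ ℕ) :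
    MvPowerSeries.coeff a (u * MvPowerSeries.X i) =
      if a i = 0 then 0 else MvPowerSeries.coeff (a - Finsupp.single i 1) u := by
  rw [MvPowerSeries.X, MvPowerSeries.coeff_mul_monomial, mul_one]
  by_cases h : a i = 0
  · rw [if_pos h, if_neg (by rw [Finsupp.single_le_iff]; omega)]
  · rw [if_neg h, if_pos (by rw [Finsupp.single_le_iff]; omega)]

theorem exists_sum_mul_X_mvPowerSeries (g : MvPowerSeries (Fin n) 𝕜) :
    ∃ u : Fin n → MvPowerSeries (Fin n) 𝕜, ∑ i, u i * MvPowerSeries.X i =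
      g - MvPowerSeries.C (MvPowerSeries.constantCoeff g) := by
  classical
  have hi : ∀ a : Fin n →₀ ℕ, ∃ i : Option (Fin n), (a ≠ 0 → ∃ j, i = some j ∧ a j ≠ 0) ∧
      (a = 0 → i = none) := by
    intro a
    by_cases ha : a = 0
    · exact ⟨none, fun h => absurd ha h, fun _ => rfl⟩
    · obtain ⟨j, hj⟩ := Finsupp.ne_iff.1 ha
      exact ⟨some j, fun _ => ⟨j, rfl, hj⟩, fun h => absurd h ha⟩
  choose ι hι hι0 using hi
  -- The monomial `x^a` is assigned to the variable `ι a`, which divides it.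
  let u : Fin n → MvPowerSeries (Fin n) 𝕜 := fun i b =>
    if ι (b + Finsupp.single i 1) = some i then
      MvPowerSeries.coeff (b + Finsupp.single i 1) g else 0
  refine ⟨u, ?_⟩
  ext a
  rw [map_sum, map_sub, MvPowerSeries.coeff_C]
  simp only [coeff_mul_X_mvPowerSeries]
  have hterm : ∀ i, (if a i = 0 then 0 else
      MvPowerSeries.coeff (a - Finsupp.single i 1) (u i)) =
      if a i ≠ 0 ∧ ι a = some i then MvPowerSeries.coeff a g else 0 := by
    intro i
    by_cases h : a i = 0
    · simp [h]
    · have h1 : a - Finsupp.single i 1 + Finsupp.single i 1 = a :=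
        tsub_add_cancel_of_le (by rw [Finsupp.single_le_iff]; omega)
      rw [if_neg h]
      change (if ι (a - Finsupp.single i 1 + Finsupp.single i 1) = some i then
        MvPowerSeries.coeff (a - Finsupp.single i 1 + Finsupp.single i 1) g else 0) = _
      rw [h1]
      simp [h]
  simp only [hterm]
  by_cases ha : a = 0
  · subst ha; simp
  · obtain ⟨j, hj, hj0⟩ := hι a ha
    rw [if_neg ha, sub_zero, Finset.sum_eq_single j]
    · rw [if_pos ⟨hj0, hj⟩]
    · intro i _ hij
      rw [if_neg]
      rintro ⟨-, h⟩
      exact hij (Option.some_injective _ (h.symm.trans hj))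
    · simp

/-- The Euler operator acts on `x^a` as multiplication by the degree of `x^a`. -/
theorem exists_euler_add_mvPowerSeries [CharZero 𝕜] (w : Fin n → ℕ) {μ : ℕ} (hμ : 0 < μ)
    (g : MvPowerSeries (Fin n) 𝕜) :
    ∃ h : MvPowerSeries (Fin n) 𝕜, ∑ i, ((w i : ℕ) : MvPowerSeries (Fin n) 𝕜) *
      MvPowerSeries.X i * MvPowerSeries.pderiv 𝕜 i h + (μ : MvPowerSeries (Fin n) 𝕜) * h = g := by
  let h : MvPowerSeries (Fin n) 𝕜 := fun a =>
    MvPowerSeries.coeff a g / ((∑ i, a i * w i : ℕ) + (μ : 𝕜))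
  refine ⟨h, ?_⟩
  ext a
  have hc : ∀ (k : ℕ) (v : MvPowerSeries (Fin n) 𝕜),
      MvPowerSeries.coeff a ((k : MvPowerSeries (Fin n) 𝕜) * v) =
        k * MvPowerSeries.coeff a v := by
    intro k v
    rw [← nsmul_eq_mul, map_nsmul, nsmul_eq_mul]
  have hX : ∀ i, MvPowerSeries.coeff a (((w i : ℕ) : MvPowerSeries (Fin n) 𝕜) *
      MvPowerSeries.X i * MvPowerSeries.pderiv 𝕜 i h) =
      (a i * w i : ℕ) * MvPowerSeries.coeff a h := by
    intro i
    rw [mul_assoc, hc, mul_comm (MvPowerSeries.X i), coeff_mul_X_mvPowerSeries]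
    by_cases hai : a i = 0
    · simp [hai]
    · have h1 : a - Finsupp.single i 1 + Finsupp.single i 1 = a :=
        tsub_add_cancel_of_le (by rw [Finsupp.single_le_iff]; omega)
      rw [if_neg hai, MvPowerSeries.coeff_pderiv, h1]
      have h2 : (((a - Finsupp.single i 1 : Fin n →₀ ℕ) i : ℕ) : 𝕜) + 1 = (a i : 𝕜) := by
        rw [Finsupp.tsub_apply, Finsupp.single_eq_same, ← Nat.cast_add_one]
        congr 1
        omega
      rw [h2]
      push_cast
      ring
  rw [map_add, map_sum, hc]
  simp only [hX]
  rw [← Finset.sum_mul, ← add_mul, ← Nat.cast_sum]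
  change _ * (MvPowerSeries.coeff a g / _) = _
  refine mul_div_cancel₀ _ ?_
  have : (((∑ i, a i * w i) + μ : ℕ) : 𝕜) ≠ 0 := by
    rw [Nat.cast_ne_zero]; omega
  simpa using this

theorem span_X_ne_top_mvPowerSeries :
    Ideal.span (Set.range (MvPowerSeries.X : Fin n → MvPowerSeries (Fin n) 𝕜)) ≠ ⊤ := by
  intro h
  have h1 : Ideal.span (Set.range (MvPowerSeries.X : Fin n → MvPowerSeries (Fin n) 𝕜)) ≤
      RingHom.ker (MvPowerSeries.constantCoeff (σ := Fin n) (R := 𝕜)) := by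
    refine Ideal.span_le.2 ?_
    rintro _ ⟨i, rfl⟩
    exact MvPowerSeries.constantCoeff_X i
  rw [h, top_le_iff] at h1
  have h2 : (1 : MvPowerSeries (Fin n) 𝕜) ∈
      RingHom.ker (MvPowerSeries.constantCoeff (σ := Fin n) (R := 𝕜)) := h1 ▸ trivial
  simp [RingHom.mem_ker] at h2

theorem eulerSolvable_formalFunctions [CharZero 𝕜] (w : Fin n → ℕ) :
    (formalFunctions 𝕜 n).EulerSolvable w where
  span_coord_ne_top := span_X_ne_top_mvPowerSeries
  D_coord i j := by
    change MvPowerSeries.pderiv 𝕜 i (MvPowerSeries.X j) = _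
    split_ifs with h
    · subst h; exact MvPowerSeries.pderiv_X_self
    · exact MvPowerSeries.pderiv_X_of_ne (Ne.symm h)
  exists_sub_mem_span g :=
    ⟨MvPowerSeries.constantCoeff (σ := Fin n) (R := 𝕜) g,
      Ideal.mem_span_range_iff_exists_fun.2 (exists_sum_mul_X_mvPowerSeries g)⟩
  exists_euler_add μ hμ g := by
    obtain ⟨h, hh⟩ := exists_euler_add_mvPowerSeries w hμ g
    exact ⟨h, (congrArg₂ (· + ·) (vact_apply _ _ _) rfl).trans hh⟩

end Formal

/-! ### Means over dilations -/

section Dilations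

variable {𝕜 : Type} [RCLike 𝕜] {n : ℕ}

/-- The dilation `x ↦ (t^{v₁} x₁, …, t^{vₙ} xₙ)`. -/
def dilation (𝕜 : Type) [RCLike 𝕜] {n : ℕ} (v : Fin n → ℕ) (t : ℝ) :
    (Fin n → 𝕜) →L[𝕜] (Fin n → 𝕜) :=
  ∑ i, (t : 𝕜) ^ v i • (ContinuousLinearMap.single 𝕜 (fun _ => 𝕜) i).comp
    (ContinuousLinearMap.proj i)

theorem dilation_apply (v : Fin n → ℕ) (t : ℝ) (x : Fin n → 𝕜) (i : Fin n) :
    dilation 𝕜 v t x i = (t : 𝕜) ^ v i * x i := by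
  simp [dilation, Pi.single_apply]

theorem continuous_dilation (v : Fin n → ℕ) : Continuous (dilation 𝕜 v) := by
  unfold dilation
  have := RCLike.continuous_ofReal (K := 𝕜)
  fun_prop

theorem norm_dilation_apply_le (v : Fin n → ℕ) {t : ℝ} (h0 : 0 ≤ t) (h1 : t ≤ 1)
    (x : Fin n → 𝕜) : ‖dilation 𝕜 v t x‖ ≤ ‖x‖ := by
  refine (pi_norm_le_iff_of_nonneg (norm_nonneg x)).2 fun i => ?_
  rw [dilation_apply, norm_mul, norm_pow, RCLike.norm_ofReal, abs_of_nonneg h0]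
  exact (mul_le_of_le_one_left (norm_nonneg _) (pow_le_one₀ h0 h1)).trans (norm_le_pi_norm x i)

theorem norm_dilation_le (v : Fin n → ℕ) {t : ℝ} (h0 : 0 ≤ t) (h1 : t ≤ 1) :
    ‖dilation 𝕜 v t‖ ≤ 1 :=
  ContinuousLinearMap.opNorm_le_bound _ zero_le_one fun x => by
    rw [one_mul]; exact norm_dilation_apply_le v h0 h1 x

theorem dilation_mem_ball (v : Fin n → ℕ) {t : ℝ} (h0 : 0 ≤ t) (h1 : t ≤ 1) {x : Fin n → 𝕜} {ρ : ℝ}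
    (hx : x ∈ Metric.ball 0 ρ) : dilation 𝕜 v t x ∈ Metric.ball 0 ρ := by
  rw [mem_ball_zero_iff] at hx ⊢
  exact (norm_dilation_apply_le v h0 h1 x).trans_lt hx

theorem dilation_single (v : Fin n → ℕ) (t : ℝ) (i : Fin n) :
    dilation 𝕜 v t (Pi.single i 1) = (t : 𝕜) ^ v i • Pi.single i 1 := by
  funext j
  rw [dilation_apply, Pi.smul_apply, smul_eq_mul]
  by_cases h : j = i
  · subst h; rfl
  · simp [h]

theorem continuousOn_comp_dilation {G : Type*} [TopologicalSpace G] {φ : (Fin n → 𝕜) → G} {ρ : ℝ}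
    (hφ : ContinuousOn φ (Metric.ball 0 ρ)) (v : Fin n → ℕ) {x : Fin n → 𝕜}
    (hx : x ∈ Metric.ball 0 ρ) :
    ContinuousOn (fun t => φ (dilation 𝕜 v t x)) (Set.Icc 0 1) :=
  hφ.comp (((continuous_dilation v).clm_apply continuous_const).continuousOn)
    fun _ ht => dilation_mem_ball v ht.1 ht.2 hx

/-- The weighted mean `∫₀¹ t^k g(t^{v₁} x₁, …, t^{vₙ} xₙ) dt` of a function over the dilations. -/
def dilationMean (v : Fin n → ℕ) (k : ℕ) (g : (Fin n → 𝕜) → 𝕜) (x : Fin n → 𝕜) : 𝕜 :=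
  ∫ t in (0 : ℝ)..1, (t : 𝕜) ^ k * g (dilation 𝕜 v t x)

variable {g : (Fin n → 𝕜) → 𝕜} {ρ : ℝ} {x : Fin n → 𝕜}

theorem continuousOn_fderiv_comp_dilation (hg : ContDiffOn 𝕜 1 g (Metric.ball 0 ρ))
    (v : Fin n → ℕ) (k : ℕ) (hx : x ∈ Metric.ball 0 ρ) :
    ContinuousOn (fun t : ℝ => (t : 𝕜) ^ k • (fderiv 𝕜 g (dilation 𝕜 v t x)).comp
      (dilation 𝕜 v t)) (Set.Icc 0 1) := by
  have h1 := hg.continuousOn_fderiv_of_isOpen Metric.isOpen_ball le_rfl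
  have hp : Continuous fun t : ℝ => (t : 𝕜) ^ k := by
    have := RCLike.continuous_ofReal (K := 𝕜)
    fun_prop
  exact hp.continuousOn.smul
    ((continuousOn_comp_dilation h1 v hx).clm_comp (continuous_dilation v).continuousOn)

theorem continuousOn_pow_mul_comp_dilation (hg : ContinuousOn g (Metric.ball 0 ρ))
    (v : Fin n → ℕ) (k : ℕ) (hx : x ∈ Metric.ball 0 ρ) :
    ContinuousOn (fun t : ℝ => (t : 𝕜) ^ k * g (dilation 𝕜 v t x)) (Set.Icc 0 1) := by
  have hp : Continuous fun t : ℝ => (t : 𝕜) ^ k := by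
    have := RCLike.continuous_ofReal (K := 𝕜)
    fun_prop
  exact hp.continuousOn.mul (continuousOn_comp_dilation hg v hx)

theorem hasFDerivAt_dilationMean (hg : ContDiffOn 𝕜 1 g (Metric.ball 0 ρ))
    (v : Fin n → ℕ) (k : ℕ) (hx : x ∈ Metric.ball 0 ρ) :
    HasFDerivAt (dilationMean v k g)
      (∫ t in (0 : ℝ)..1, (t : 𝕜) ^ k • (fderiv 𝕜 g (dilation 𝕜 v t x)).comp
        (dilation 𝕜 v t)) x := by
  obtain ⟨ρ', hxρ', hρ'⟩ : ∃ ρ', ‖x‖ < ρ' ∧ ρ' < ρ := exists_between (mem_ball_zero_iff.1 hx)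
  have hsub : Metric.closedBall (0 : Fin n → 𝕜) ρ' ⊆ Metric.ball 0 ρ :=
    Metric.closedBall_subset_ball hρ'
  have h1 := hg.continuousOn_fderiv_of_isOpen Metric.isOpen_ball le_rfl
  obtain ⟨C, hC⟩ := (isCompact_closedBall (0 : Fin n → 𝕜) ρ').exists_bound_of_continuousOn
    (h1.mono hsub)
  have hI : Set.uIoc (0 : ℝ) 1 ⊆ Set.Icc 0 1 := by
    rw [Set.uIoc_of_le zero_le_one]; exact Set.Ioc_subset_Icc_self
  have hs : Metric.ball (0 : Fin n → 𝕜) ρ' ∈ 𝓝 x :=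
    Metric.isOpen_ball.mem_nhds (mem_ball_zero_iff.2 hxρ')
  refine intervalIntegral.hasFDerivAt_integral_of_dominated_of_fderiv_le (𝕜 := 𝕜)
    (F := fun x t => (t : 𝕜) ^ k * g (dilation 𝕜 v t x))
    (F' := fun x t => (t : 𝕜) ^ k • (fderiv 𝕜 g (dilation 𝕜 v t x)).comp (dilation 𝕜 v t))
    (bound := fun _ => C) hs ?_ ?_ ?_ ?_ ?_ ?_
  · filter_upwards [hs] with y hy
    exact ((continuousOn_pow_mul_comp_dilation hg.continuousOn v k
      (hsub (Metric.ball_subset_closedBall hy))).mono hI).aestronglyMeasurable measurableSet_uIoc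
  · refine ContinuousOn.intervalIntegrable ?_
    rw [Set.uIcc_of_le zero_le_one]
    exact continuousOn_pow_mul_comp_dilation hg.continuousOn v k hx
  · exact ((continuousOn_fderiv_comp_dilation hg v k hx).mono hI).aestronglyMeasurable
      measurableSet_uIoc
  · refine Eventually.of_forall fun t ht y hy => ?_
    obtain ⟨h0, h1⟩ := hI ht
    have hb := hC _ (Metric.ball_subset_closedBall (dilation_mem_ball v h0 h1 hy))
    rw [norm_smul, norm_pow, RCLike.norm_ofReal, abs_of_nonneg h0]
    calc t ^ k * ‖(fderiv 𝕜 g (dilation 𝕜 v t y)).comp (dilation 𝕜 v t)‖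
        ≤ 1 * (‖fderiv 𝕜 g (dilation 𝕜 v t y)‖ * ‖dilation 𝕜 v t‖) := by
          gcongr
          · exact pow_le_one₀ h0 h1
          · exact ContinuousLinearMap.opNorm_comp_le _ _
      _ ≤ 1 * (C * 1) := by
          have := (norm_nonneg _).trans hb
          gcongr
          exact norm_dilation_le v h0 h1
      _ = C := by ring
  · exact intervalIntegrable_const
  · refine Eventually.of_forall fun t ht y hy => ?_
    obtain ⟨h0, h1⟩ := hI ht
    have hy' := dilation_mem_ball v h0 h1 (hsub (Metric.ball_subset_closedBall hy))
    have hd := ((hg.differentiableOn one_ne_zero).differentiableAt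
      (Metric.isOpen_ball.mem_nhds hy')).hasFDerivAt
    exact (hd.comp y (dilation 𝕜 v t).hasFDerivAt).const_mul ((t : 𝕜) ^ k)

theorem fderiv_dilationMean_apply (hg : ContDiffOn 𝕜 1 g (Metric.ball 0 ρ))
    (v : Fin n → ℕ) (k : ℕ) (hx : x ∈ Metric.ball 0 ρ) (y : Fin n → 𝕜) :
    fderiv 𝕜 (dilationMean v k g) x y =
      ∫ t in (0 : ℝ)..1, (t : 𝕜) ^ k * fderiv 𝕜 g (dilation 𝕜 v t x) (dilation 𝕜 v t y) := by
  rw [(hasFDerivAt_dilationMean hg v k hx).fderiv, ContinuousLinearMap.intervalIntegral_apply]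
  · rfl
  · refine ContinuousOn.intervalIntegrable ?_
    rw [Set.uIcc_of_le zero_le_one]
    exact continuousOn_fderiv_comp_dilation hg v k hx

theorem fderiv_dilationMean_single (hg : ContDiffOn 𝕜 1 g (Metric.ball 0 ρ))
    (v : Fin n → ℕ) (k : ℕ) (hx : x ∈ Metric.ball 0 ρ) (i : Fin n) :
    fderiv 𝕜 (dilationMean v k g) x (Pi.single i 1) =
      dilationMean v (k + v i) (fun z => fderiv 𝕜 g z (Pi.single i 1)) x := by
  rw [fderiv_dilationMean_apply hg v k hx, dilationMean]
  refine intervalIntegral.integral_congr fun t _ => ?_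
  simp only [dilation_single, map_smul, smul_eq_mul]
  ring

/-- Each derivative of the mean is a mean of a derivative, so that the mean inherits smoothness. -/
theorem contDiffOn_dilationMean (v : Fin n → ℕ) (N : ℕ) : ∀ (k : ℕ) (g : (Fin n → 𝕜) → 𝕜),
    ContDiffOn 𝕜 (N + 1 : ℕ) g (Metric.ball 0 ρ) →
      ContDiffOn 𝕜 N (dilationMean v k g) (Metric.ball 0 ρ) := by
  induction N with
  | zero =>
    intro k g hg
    simp only [Nat.cast_zero, contDiffOn_zero]
    intro x hx
    exact (hasFDerivAt_dilationMean (by simpa using hg) v k hx).continuousAt.continuousWithinAt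
  | succ N ih =>
    intro k g hg
    have hg1 : ContDiffOn 𝕜 1 g (Metric.ball 0 ρ) := hg.of_le (by
      have : (1 : ℕ) ≤ N + 1 + 1 := by omega
      exact_mod_cast this)
    rw [Nat.cast_add_one, contDiffOn_succ_iff_fderiv_of_isOpen Metric.isOpen_ball]
    refine ⟨fun x hx =>
      (hasFDerivAt_dilationMean hg1 v k hx).differentiableAt.differentiableWithinAt,
      fun h => absurd h (by simp), ?_⟩
    rw [contDiffOn_clm_apply]
    intro y
    have hgi : ∀ i, ContDiffOn 𝕜 (N + 1 : ℕ) (fun z => fderiv 𝕜 g z (Pi.single i 1))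
        (Metric.ball 0 ρ) := fun i => by
      rw [Nat.cast_add_one, contDiffOn_succ_iff_fderiv_of_isOpen Metric.isOpen_ball] at hg
      exact hg.2.2.clm_apply contDiffOn_const
    have hsum : ContDiffOn 𝕜 N (fun x => ∑ i, y i *
        dilationMean v (k + v i) (fun z => fderiv 𝕜 g z (Pi.single i 1)) x) (Metric.ball 0 ρ) :=
      ContDiffOn.sum fun i _ => contDiffOn_const.mul (ih _ _ (hgi i))
    refine hsum.congr fun x hx => ?_
    conv_lhs => rw [pi_eq_sum_univ' y]
    rw [map_sum]
    refine Finset.sum_congr rfl fun i _ => ?_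
    rw [map_smul, fderiv_dilationMean_single hg1 v k hx, smul_eq_mul]

theorem hasDerivAt_comp_dilation (hg : ContDiffOn 𝕜 1 g (Metric.ball 0 ρ))
    (v : Fin n → ℕ) (hx : x ∈ Metric.ball 0 ρ) {t : ℝ} (ht : t ∈ Set.Icc (0 : ℝ) 1) :
    HasDerivAt (fun t => g (dilation 𝕜 v t x))
      (fderiv 𝕜 g (dilation 𝕜 v t x) fun i => (v i * (t : 𝕜) ^ (v i - 1)) * x i) t := by
  have hd := ((hg.differentiableOn one_ne_zero).differentiableAt
    (Metric.isOpen_ball.mem_nhds (dilation_mem_ball v ht.1 ht.2 hx))).hasFDerivAt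
  have hc : HasDerivAt (fun t => dilation 𝕜 v t x)
      (fun i => (v i * (t : 𝕜) ^ (v i - 1)) * x i) t := by
    rw [hasDerivAt_pi]
    intro i
    simp only [dilation_apply]
    have h1 : HasDerivAt (fun t : ℝ => (t : 𝕜)) 1 t := by
      simpa using (RCLike.ofRealCLM (K := 𝕜)).hasDerivAt (x := t)
    simpa using (h1.fun_pow (v i)).mul_const (x i)
  exact (hd.restrictScalars ℝ).comp_hasDerivAt t hc

/-- The mean solves the Euler equation, by the fundamental theorem of calculus for
`t ↦ t^{k+1} g(t^{v₁} x₁, …, t^{vₙ} xₙ)`. -/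
theorem euler_dilationMean (hg : ContDiffOn 𝕜 1 g (Metric.ball 0 ρ))
    (v : Fin n → ℕ) (k : ℕ) (hx : x ∈ Metric.ball 0 ρ) :
    ∑ i, v i * x i * fderiv 𝕜 (dilationMean v k g) x (Pi.single i 1) +
      ((k + 1 : ℕ) : 𝕜) * dilationMean v k g x = g x := by
  have hsum : ∑ i, v i * x i * fderiv 𝕜 (dilationMean v k g) x (Pi.single i 1) =
      fderiv 𝕜 (dilationMean v k g) x fun i => v i * x i := by
    conv_rhs => rw [pi_eq_sum_univ' fun i => (v i : 𝕜) * x i]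
    rw [map_sum]
    exact Finset.sum_congr rfl fun i _ => by rw [map_smul, smul_eq_mul]
  have hderiv : ∀ t ∈ Set.uIcc (0 : ℝ) 1,
      HasDerivAt (fun t : ℝ => (t : 𝕜) ^ (k + 1) * g (dilation 𝕜 v t x))
        ((t : 𝕜) ^ k * fderiv 𝕜 g (dilation 𝕜 v t x) (dilation 𝕜 v t fun i => v i * x i) +
          ((k + 1 : ℕ) : 𝕜) * ((t : 𝕜) ^ k * g (dilation 𝕜 v t x))) t := by
    intro t ht
    rw [Set.uIcc_of_le zero_le_one] at ht
    have h1 : HasDerivAt (fun t : ℝ => (t : 𝕜)) 1 t := by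
      simpa using (RCLike.ofRealCLM (K := 𝕜)).hasDerivAt (x := t)
    have h2 := (h1.fun_pow (k + 1)).mul (hasDerivAt_comp_dilation hg v hx ht)
    have h3 : (dilation 𝕜 v t fun i => v i * x i) =
        (t : 𝕜) • fun i => (v i * (t : 𝕜) ^ (v i - 1)) * x i := by
      funext i
      rw [dilation_apply, Pi.smul_apply, smul_eq_mul]
      rcases Nat.eq_zero_or_pos (v i) with h | h
      · simp [h]
      · obtain ⟨l, hl⟩ := Nat.exists_eq_add_of_le' h
        rw [hl, Nat.add_sub_cancel, pow_succ]
        ring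
    rw [h3, map_smul, smul_eq_mul]
    refine h2.congr_deriv ?_
    rw [Nat.add_sub_cancel]
    ring
  have hint1 : IntervalIntegrable (fun t : ℝ => (t : 𝕜) ^ k *
      fderiv 𝕜 g (dilation 𝕜 v t x) (dilation 𝕜 v t fun i => v i * x i))
      MeasureTheory.volume 0 1 := by
    refine ContinuousOn.intervalIntegrable ?_
    rw [Set.uIcc_of_le zero_le_one]
    exact (continuousOn_fderiv_comp_dilation hg v k hx).clm_apply continuousOn_const
  have hint2 : IntervalIntegrable (fun t : ℝ => (t : 𝕜) ^ k * g (dilation 𝕜 v t x))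
      MeasureTheory.volume 0 1 := by
    refine ContinuousOn.intervalIntegrable ?_
    rw [Set.uIcc_of_le zero_le_one]
    exact continuousOn_pow_mul_comp_dilation hg.continuousOn v k hx
  have h1 : dilation 𝕜 v 1 x = x := by
    funext i
    simp [dilation_apply]
  rw [hsum, fderiv_dilationMean_apply hg v k hx, dilationMean,
    ← intervalIntegral.integral_const_mul, ← intervalIntegral.integral_add hint1
      (hint2.const_mul _), intervalIntegral.integral_eq_sub_of_hasDerivAt hderiv
      (hint1.add (hint2.const_mul _))]
  simp [h1]

/-- Hadamard's lemma. -/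
theorem sub_eq_sum_mul_dilationMean (hg : ContDiffOn 𝕜 1 g (Metric.ball 0 ρ))
    (hx : x ∈ Metric.ball 0 ρ) :
    g x - g 0 = ∑ i, dilationMean (fun _ => 1) 0 (fun z => fderiv 𝕜 g z (Pi.single i 1)) x *
      x i := by
  have hcont : ∀ y, ContinuousOn
      (fun t : ℝ => fderiv 𝕜 g (dilation 𝕜 (fun _ => 1) t x) y) (Set.Icc 0 1) := fun y =>
    (continuousOn_comp_dilation (hg.continuousOn_fderiv_of_isOpen Metric.isOpen_ball le_rfl)
      (fun _ => 1) hx).clm_apply continuousOn_const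
  have hint : ∀ y, IntervalIntegrable
      (fun t : ℝ => fderiv 𝕜 g (dilation 𝕜 (fun _ => 1) t x) y) MeasureTheory.volume 0 1 := by
    intro y
    refine ContinuousOn.intervalIntegrable ?_
    rw [Set.uIcc_of_le zero_le_one]
    exact hcont y
  have hderiv : ∀ t ∈ Set.uIcc (0 : ℝ) 1,
      HasDerivAt (fun t : ℝ => g (dilation 𝕜 (fun _ => 1) t x))
        (fderiv 𝕜 g (dilation 𝕜 (fun _ => 1) t x) x) t := by
    intro t ht
    rw [Set.uIcc_of_le zero_le_one] at ht
    simpa using hasDerivAt_comp_dilation hg (fun _ => 1) hx ht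
  have h1 : dilation 𝕜 (fun _ => 1) 1 x = x := by
    funext i
    simp [dilation_apply]
  have h0 : dilation 𝕜 (fun _ => 1) 0 x = 0 := by
    funext i
    simp [dilation_apply]
  have h := intervalIntegral.integral_eq_sub_of_hasDerivAt hderiv (hint x)
  rw [h1, h0] at h
  rw [← h]
  have hexp : ∀ t : ℝ, fderiv 𝕜 g (dilation 𝕜 (fun _ => 1) t x) x =
      ∑ i, fderiv 𝕜 g (dilation 𝕜 (fun _ => 1) t x) (Pi.single i 1) * x i := by
    intro t
    conv_lhs => rw [pi_eq_sum_univ' x]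
    rw [map_sum]
    refine Finset.sum_congr rfl fun i _ => ?_
    rw [map_smul, smul_eq_mul]
    conv_lhs => rw [← pi_eq_sum_univ' x]
    rw [mul_comm]
  simp only [hexp]
  rw [intervalIntegral.integral_finsetSum fun i _ => (hint _).mul_const _]
  refine Finset.sum_congr rfl fun i _ => ?_
  rw [intervalIntegral.integral_mul_const, dilationMean]
  simp

open ContinuousMultilinearMap in
/-- The mean of an analytic function is analytic: the mean can be taken termwise in the power
series. -/
theorem analyticAt_dilationMean (hg : AnalyticAt 𝕜 g 0) (v : Fin n → ℕ) (k : ℕ) :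
    AnalyticAt 𝕜 (dilationMean v k g) 0 := by
  obtain ⟨p, r, hp⟩ := hg
  obtain ⟨R, hR0, hR⟩ := ENNReal.lt_iff_exists_nnreal_btwn.1 hp.r_pos
  have hI : Set.uIoc (0 : ℝ) 1 ⊆ Set.Icc 0 1 := by
    rw [Set.uIoc_of_le zero_le_one]; exact Set.Ioc_subset_Icc_self
  have hpc : Continuous fun t : ℝ => (t : 𝕜) ^ k := by
    have := RCLike.continuous_ofReal (K := 𝕜)
    fun_prop
  let c : (j : ℕ) → ℝ → (Fin n → 𝕜) [×j]→L[𝕜] 𝕜 := fun j t =>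
    (t : 𝕜) ^ k • (p j).compContinuousLinearMap fun _ => dilation 𝕜 v t
  have hcc : ∀ j, Continuous (c j) := by
    intro j
    have h1 : Continuous fun t : ℝ => compContinuousLinearMapContinuousMultilinear 𝕜
        (fun _ : Fin j => Fin n → 𝕜) (fun _ => Fin n → 𝕜) 𝕜 (fun _ => dilation 𝕜 v t) :=
      (compContinuousLinearMapContinuousMultilinear 𝕜 (fun _ : Fin j => Fin n → 𝕜)
        (fun _ => Fin n → 𝕜) 𝕜).cont.comp (continuous_pi fun _ => continuous_dilation v)
    exact hpc.smul (h1.clm_apply continuous_const)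
  have hc : ∀ j, ∀ t ∈ Set.uIoc (0 : ℝ) 1, ‖c j t‖ ≤ ‖p j‖ := by
    intro j t ht
    obtain ⟨h0, h1⟩ := hI ht
    rw [norm_smul, norm_pow, RCLike.norm_ofReal, abs_of_nonneg h0]
    refine (mul_le_of_le_one_left (norm_nonneg _) (pow_le_one₀ h0 h1)).trans
      ((norm_compContinuousLinearMap_le _ _).trans (mul_le_of_le_one_right (norm_nonneg _) ?_))
    exact Finset.prod_le_one (fun _ _ => norm_nonneg _) fun _ _ => norm_dilation_le v h0 h1
  let q : FormalMultilinearSeries 𝕜 (Fin n → 𝕜) 𝕜 := fun j => ∫ t in (0 : ℝ)..1, c j t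
  have hq : ∀ j, ‖q j‖ ≤ ‖p j‖ := fun j => by
    simpa using intervalIntegral.norm_integral_le_of_norm_le_const (hc j)
  have hsum : Summable fun j => ‖p j‖ * (R : ℝ) ^ j :=
    p.summable_norm_mul_pow (hR.trans_le hp.r_le)
  refine ⟨q, R, ?_, by exact_mod_cast hR0, ?_⟩
  · refine q.le_radius_of_summable_norm (Summable.of_nonneg_of_le (fun j => by positivity)
      (fun j => ?_) hsum)
    have := hq j
    gcongr
  · intro y hy
    rw [zero_add]
    have hyR : ‖y‖ ≤ R := by
      rw [Metric.mem_eball, edist_zero_right, enorm_eq_nnnorm] at hy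
      exact_mod_cast hy.le
    have hqy : ∀ j, (q j fun _ => y) = ∫ t in (0 : ℝ)..1, c j t fun _ => y := by
      intro j
      exact ((ContinuousMultilinearMap.apply 𝕜 (fun _ : Fin j => Fin n → 𝕜) 𝕜
        (fun _ => y)).intervalIntegral_comp_comm ((hcc j).intervalIntegrable 0 1)).symm
    simp only [hqy]
    refine intervalIntegral.hasSum_integral_of_dominated_convergence
      (fun j _ => ‖p j‖ * (R : ℝ) ^ j) (fun j => ?_) (fun j => ?_) ?_ intervalIntegrable_const ?_
    · exact Continuous.aestronglyMeasurable
        ((ContinuousMultilinearMap.apply 𝕜 (fun _ : Fin j => Fin n → 𝕜) 𝕜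
          (fun _ => y)).continuous.comp (hcc j))
    · refine Eventually.of_forall fun t ht => ?_
      refine ((c j t).le_opNorm _).trans ?_
      rw [Finset.prod_const, Finset.card_univ, Fintype.card_fin]
      have := hc j t ht
      gcongr
    · exact Eventually.of_forall fun _ _ => hsum
    · refine Eventually.of_forall fun t ht => ?_
      obtain ⟨h0, h1⟩ := hI ht
      have hmem : dilation 𝕜 v t y ∈ Metric.eball (0 : Fin n → 𝕜) r := by
        rw [Metric.mem_eball, edist_zero_right] at hy ⊢
        refine lt_of_le_of_lt ?_ (hy.trans hR)
        rw [enorm_le_iff_norm_le]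
        exact norm_dilation_apply_le v h0 h1 y
      have := (hp.hasSum hmem).mul_left ((t : 𝕜) ^ k)
      rwa [zero_add] at this

end Dilations

/-! ### Germs of smooth and analytic functions -/

section Germs

variable {𝕜 : Type} [RCLike 𝕜] {n : ℕ} {r : WithTop ℕ∞}

theorem exists_ball_contDiffOn {g : (Fin n → 𝕜) → 𝕜} (hg : ∀ᶠ x in 𝓝 0, ContDiffAt 𝕜 r g x) :
    ∃ ρ > 0, ContDiffOn 𝕜 r g (Metric.ball 0 ρ) := by
  obtain ⟨ρ, hρ, h⟩ := Metric.eventually_nhds_iff_ball.1 hg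
  exact ⟨ρ, hρ, fun x hx => (h x hx).contDiffWithinAt⟩

theorem eventually_contDiffAt_dilationMean_infty {g : (Fin n → 𝕜) → 𝕜}
    (hg : ∀ᶠ x in 𝓝 0, ContDiffAt 𝕜 ∞ g x) (v : Fin n → ℕ) (k : ℕ) :
    ∀ᶠ x in 𝓝 0, ContDiffAt 𝕜 ∞ (dilationMean v k g) x := by
  obtain ⟨ρ, hρ, h⟩ := exists_ball_contDiffOn hg
  have hm : ContDiffOn 𝕜 ∞ (dilationMean v k g) (Metric.ball 0 ρ) :=
    contDiffOn_infty.2 fun N => contDiffOn_dilationMean v N k g (contDiffOn_infty.1 h _)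
  filter_upwards [Metric.ball_mem_nhds 0 hρ] with x hx
  exact hm.contDiffAt (Metric.isOpen_ball.mem_nhds hx)

theorem eventually_contDiffAt_dilationMean_omega {g : (Fin n → 𝕜) → 𝕜}
    (hg : ∀ᶠ x in 𝓝 0, ContDiffAt 𝕜 ω g x) (v : Fin n → ℕ) (k : ℕ) :
    ∀ᶠ x in 𝓝 0, ContDiffAt 𝕜 ω (dilationMean v k g) x := by
  filter_upwards [(analyticAt_dilationMean hg.self_of_nhds.analyticAt v k).eventually_analyticAt]
    with x hx
  exact hx.contDiffAt

/-- The class of a function in the algebra of germs. -/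
def germOf (g : (Fin n → 𝕜) → 𝕜) (hg : ∀ᶠ x in 𝓝 0, ContDiffAt 𝕜 r g x) : germAlg 𝕜 n r :=
  ⟨(g : Germ (𝓝 (0 : Fin n → 𝕜)) 𝕜), g, hg, rfl⟩

theorem coe_algebraMap_germAlg (c : 𝕜) :
    ((algebraMap 𝕜 (germAlg 𝕜 n r) c : germAlg 𝕜 n r) : Germ (𝓝 (0 : Fin n → 𝕜)) 𝕜) =
      ((fun _ => c : (Fin n → 𝕜) → 𝕜) : Germ (𝓝 (0 : Fin n → 𝕜)) 𝕜) := by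
  change algebraMap 𝕜 (Germ (𝓝 (0 : Fin n → 𝕜)) 𝕜) c = _
  rw [Algebra.algebraMap_eq_smul_one]
  refine congrArg Germ.ofFun (?_ : c • (1 : (Fin n → 𝕜) → 𝕜) = fun _ => c)
  funext x
  simp

/-- The coordinate functions as germs. -/
def germCoord (𝕜 : Type) [RCLike 𝕜] (n : ℕ) (r : WithTop ℕ∞) (i : Fin n) : germAlg 𝕜 n r :=
  germOf (fun x => x i) (Eventually.of_forall fun _ => contDiffAt_apply 𝕜 𝕜 i _)

theorem span_germCoord_ne_top : Ideal.span (Set.range (germCoord 𝕜 n r)) ≠ ⊤ := by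
  intro h
  let ev : germAlg 𝕜 n r →+* 𝕜 :=
    (Germ.valueRingHom (x := (0 : Fin n → 𝕜)) (E := 𝕜)).comp (germAlg 𝕜 n r).val.toRingHom
  have h1 : Ideal.span (Set.range (germCoord 𝕜 n r)) ≤ RingHom.ker ev := by
    refine Ideal.span_le.2 ?_
    rintro _ ⟨i, rfl⟩
    rfl
  rw [h, top_le_iff] at h1
  have h2 : (1 : germAlg 𝕜 n r) ∈ RingHom.ker ev := h1 ▸ trivial
  rw [RingHom.mem_ker, map_one] at h2
  exact one_ne_zero h2

theorem germPDeriv_germCoord (hr : r + 1 ≤ r) (i j : Fin n) :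
    germPDeriv 𝕜 n r hr i (germCoord 𝕜 n r j) = if i = j then 1 else 0 := by
  have h : ∀ x : Fin n → 𝕜, fderiv 𝕜 (fun x : Fin n → 𝕜 => x j) x (Pi.single i 1) =
      if i = j then 1 else 0 := by
    intro x
    rw [show fderiv 𝕜 (fun x : Fin n → 𝕜 => x j) x = ContinuousLinearMap.proj j from
      (ContinuousLinearMap.proj j : (Fin n → 𝕜) →L[𝕜] 𝕜).fderiv, ContinuousLinearMap.proj_apply,
      Pi.single_apply]
    simp only [eq_comm]
  refine Subtype.ext ?_
  change (((fun x => fderiv 𝕜 (fun x : Fin n → 𝕜 => x j) x (Pi.single i 1)) :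
    (Fin n → 𝕜) → 𝕜) : Germ (𝓝 (0 : Fin n → 𝕜)) 𝕜) = _
  rw [funext h]
  split_ifs <;> rfl

theorem eventually_contDiffAt_fderiv (hr : r + 1 ≤ r) {g : (Fin n → 𝕜) → 𝕜}
    (hg : ∀ᶠ x in 𝓝 0, ContDiffAt 𝕜 r g x) (i : Fin n) :
    ∀ᶠ x in 𝓝 0, ContDiffAt 𝕜 r (fun x => fderiv 𝕜 g x (Pi.single i 1)) x := by
  filter_upwards [hg] with x hx
  exact (hx.fderiv_right hr).clm_apply contDiffAt_const

theorem coe_sum_germ (u : Fin n → (Fin n → 𝕜) → 𝕜) :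
    ∑ i, (u i : Germ (𝓝 (0 : Fin n → 𝕜)) 𝕜) = ((fun x => ∑ i, u i x : (Fin n → 𝕜) → 𝕜) :
      Germ (𝓝 (0 : Fin n → 𝕜)) 𝕜) := by
  have h := map_sum (Germ.coeRingHom (R := 𝕜) (𝓝 (0 : Fin n → 𝕜))) u Finset.univ
  refine h.symm.trans (congrArg Germ.ofFun ?_)
  funext x
  exact Finset.sum_apply _ _ _

theorem coe_natCast_germAlg (k : ℕ) :
    ((k : germAlg 𝕜 n r) : Germ (𝓝 (0 : Fin n → 𝕜)) 𝕜) =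
      ((fun _ => (k : 𝕜) : (Fin n → 𝕜) → 𝕜) : Germ (𝓝 (0 : Fin n → 𝕜)) 𝕜) := by
  rw [← map_natCast (algebraMap 𝕜 (germAlg 𝕜 n r)) k, coe_algebraMap_germAlg]

theorem germOf_sub_mem_span (hr : r + 1 ≤ r) (h1r : 1 ≤ r)
    (hmean : ∀ (g : (Fin n → 𝕜) → 𝕜), (∀ᶠ x in 𝓝 0, ContDiffAt 𝕜 r g x) → ∀ v k,
      ∀ᶠ x in 𝓝 0, ContDiffAt 𝕜 r (dilationMean v k g) x)
    (g : (Fin n → 𝕜) → 𝕜) (hg : ∀ᶠ x in 𝓝 0, ContDiffAt 𝕜 r g x) :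
    germOf g hg - algebraMap 𝕜 (germAlg 𝕜 n r) (g 0) ∈
      Ideal.span (Set.range (germCoord 𝕜 n r)) := by
  refine Ideal.mem_span_range_iff_exists_fun.2 ⟨fun i => germOf _
    (hmean _ (eventually_contDiffAt_fderiv hr hg i) (fun _ => 1) 0), ?_⟩
  obtain ⟨ρ, hρ, h⟩ := exists_ball_contDiffOn hg
  refine Subtype.ext ?_
  change (germAlg 𝕜 n r).val (∑ i, germOf _ _ * germCoord 𝕜 n r i) =
    (g : Germ (𝓝 (0 : Fin n → 𝕜)) 𝕜) - ((algebraMap 𝕜 (germAlg 𝕜 n r) (g 0) :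
      germAlg 𝕜 n r) : Germ (𝓝 (0 : Fin n → 𝕜)) 𝕜)
  rw [map_sum, coe_algebraMap_germAlg]
  refine (coe_sum_germ fun i x => dilationMean (fun _ => 1) 0
    (fun z => fderiv 𝕜 g z (Pi.single i 1)) x * x i).trans (Germ.coe_eq.2 ?_)
  filter_upwards [Metric.ball_mem_nhds 0 hρ] with x hx
  exact (sub_eq_sum_mul_dilationMean (h.of_le h1r) hx).symm

theorem euler_germOf_dilationMean (hr : r + 1 ≤ r) (h1r : 1 ≤ r) {g : (Fin n → 𝕜) → 𝕜}
    (hg : ∀ᶠ x in 𝓝 0, ContDiffAt 𝕜 r g x) (w : Fin n → ℕ) (k : ℕ)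
    (hm : ∀ᶠ x in 𝓝 0, ContDiffAt 𝕜 r (dilationMean w k g) x) :
    ∑ i, (w i : germAlg 𝕜 n r) * germCoord 𝕜 n r i * germPDeriv 𝕜 n r hr i (germOf _ hm) +
      ((k + 1 : ℕ) : germAlg 𝕜 n r) * germOf _ hm = germOf g hg := by
  obtain ⟨ρ, hρ, h⟩ := exists_ball_contDiffOn hg
  refine Subtype.ext ?_
  have hw : ∀ i, (germAlg 𝕜 n r).val ((w i : germAlg 𝕜 n r) * germCoord 𝕜 n r i *
      germPDeriv 𝕜 n r hr i (germOf _ hm)) =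
      ((fun x => w i * x i * fderiv 𝕜 (dilationMean w k g) x (Pi.single i 1) :
        (Fin n → 𝕜) → 𝕜) : Germ (𝓝 (0 : Fin n → 𝕜)) 𝕜) := by
    intro i
    rw [map_mul, map_mul, Subalgebra.coe_val, coe_natCast_germAlg]
    rfl
  have hk : (germAlg 𝕜 n r).val (((k + 1 : ℕ) : germAlg 𝕜 n r) * germOf _ hm) =
      ((fun x => ((k + 1 : ℕ) : 𝕜) * dilationMean w k g x :
        (Fin n → 𝕜) → 𝕜) : Germ (𝓝 (0 : Fin n → 𝕜)) 𝕜) := by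
    rw [map_mul, Subalgebra.coe_val, coe_natCast_germAlg]
    rfl
  rw [← Subalgebra.coe_val, map_add, map_sum, hk]
  simp only [hw]
  rw [coe_sum_germ]
  refine Germ.coe_eq.2 ?_
  filter_upwards [Metric.ball_mem_nhds 0 hρ] with x hx
  exact euler_dilationMean (h.of_le h1r) w k hx

/-- An algebra of germs that is stable under the means over dilations has the required
properties. -/
theorem eulerSolvable_germFunctions (hr : r + 1 ≤ r) (h1r : 1 ≤ r)
    (hmean : ∀ (g : (Fin n → 𝕜) → 𝕜), (∀ᶠ x in 𝓝 0, ContDiffAt 𝕜 r g x) → ∀ v k,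
      ∀ᶠ x in 𝓝 0, ContDiffAt 𝕜 r (dilationMean v k g) x) (w : Fin n → ℕ) :
    (germFunctions 𝕜 n r hr).EulerSolvable w where
  span_coord_ne_top := span_germCoord_ne_top (r := r)
  D_coord := germPDeriv_germCoord hr
  exists_sub_mem_span := by
    rintro ⟨_, g, hg, rfl⟩
    exact ⟨g 0, germOf_sub_mem_span hr h1r hmean g hg⟩
  exists_euler_add := by
    rintro μ hμ ⟨_, g, hg, rfl⟩
    obtain ⟨k, rfl⟩ := Nat.exists_eq_add_of_le' hμ
    exact ⟨germOf _ (hmean g hg w k), (congrArg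
      (· + ((k + 1 : ℕ) : germAlg 𝕜 n r) * germOf _ (hmean g hg w k))
      (vact_apply (germPDeriv 𝕜 n r hr) (eulerField w (germCoord 𝕜 n r))
        (germOf _ (hmean g hg w k)))).trans
      (euler_germOf_dilationMean hr h1r hg w k _)⟩

end Germs

/-! ### The normal form of a class and the dimension of the cohomology -/

section Cohomology

variable {𝕜 : Type} [Field 𝕜] {m : ℕ}

theorem fieldOp_sub {n : ℕ} {F : Type} [CommRing F] [Algebra 𝕜 F] (D : Fin n → Derivation 𝕜 F F)
    (f : F) (c : 𝕜) (X Y : VField F n) :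
    fieldOp D f c (X - Y) = fieldOp D f c X - fieldOp D f c Y := by
  rw [eq_sub_iff_add_eq, ← fieldOp_add, sub_add_cancel]

theorem smul_vol_mem_dOpCoboundaries_iff {F : Type} [CommRing F] [Algebra 𝕜 F]
    (D : Fin (m + 1) → Derivation 𝕜 F F) (f g : F) :
    g • vol F (m + 1) ∈ dOpCoboundaries D f m ↔ ∃ X, g = fieldOp D f (m : 𝕜) X := by
  have h : ∀ X, dOp D f m (interiorVol F m X) = fieldOp D f (m : 𝕜) X • vol F (m + 1) := by
    intro X
    rw [dOp_interiorVol, fieldOp, Algebra.smul_def, map_natCast]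
  constructor
  · rintro ⟨β, hβ⟩
    obtain ⟨X, rfl⟩ := (interiorVol F m).surjective β
    refine ⟨X, ?_⟩
    have := congrArg (fun α => α (frame F (m + 1))) (hβ.symm.trans (h X))
    simpa [vol_frame] using this
  · rintro ⟨X, rfl⟩
    exact ⟨interiorVol F m X, h X⟩

theorem sub_smul_vol_mem_iff {F : Type} [CommRing F] [Algebra 𝕜 F]
    (D : Fin (m + 1) → Derivation 𝕜 F F) (f p : F) (α : DForm F (m + 1) (m + 1)) :
    α - p • vol F (m + 1) ∈ dOpCoboundaries D f m ↔
      ∃ X, α (frame F (m + 1)) - p = fieldOp D f (m : 𝕜) X := by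
  have h : α - p • vol F (m + 1) = (α (frame F (m + 1)) - p) • vol F (m + 1) :=
    dform_top_ext (by simp [vol_frame])
  rw [← smul_vol_mem_dOpCoboundaries_iff, h]

/-- The `𝕜`-linear map `g ↦ g ω`. -/
def smulVol (𝕜 F : Type) [Field 𝕜] [CommRing F] [Algebra 𝕜 F] (n : ℕ) : F →ₗ[𝕜] DForm F n n where
  toFun g := g • vol F n
  map_add' g h := add_smul g h _
  map_smul' c g := AlternatingMap.ext fun Y => smul_assoc c g (vol F n Y)

theorem mem_normalFormSpace_iff (hm : 1 ≤ m) (w : Fin (m + 1) → ℕ) (N : ℤ)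
    (B : Finset (Fin (m + 1) →₀ ℕ)) (h : Fin (m + 1) → MvPolynomial (Fin (m + 1)) 𝕜) :
    (∀ j, h j ∈ normalFormSpace w N B j) ↔
      IsQuasihomogeneous w (h 0) (N - ∑ i, (w i : ℤ)) ∧
        (∀ j : Fin (m + 1), 1 ≤ (j : ℕ) → (j : ℕ) < m →
          h j ∈ monomialSpan 𝕜
            {a | a ∈ B ∧ monomialDegree w a = ((j : ℤ) + 1) * N - ∑ i, (w i : ℤ)}) ∧
        h (Fin.last m) ∈ monomialSpan 𝕜 {a | a ∈ B} := by
  have h0 : (0 : Fin (m + 1)) ≠ Fin.last m := fun h => by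
    have := congrArg Fin.val h
    simp at this
    omega
  constructor
  · intro hh
    refine ⟨?_, fun j h1 h2 => ?_, ?_⟩
    · have := hh 0
      rwa [normalFormSpace, if_neg h0, if_pos rfl] at this
    · have := hh j
      rwa [normalFormSpace, if_neg (by rintro rfl; simp at h2), if_neg (by rintro rfl; simp at h1)]
        at this
    · have := hh (Fin.last m)
      rwa [normalFormSpace, if_pos rfl] at this
  · rintro ⟨hq, hj, hl⟩ j
    rw [normalFormSpace]
    split_ifs with h1 h2
    · exact h1 ▸ hl
    · exact h2 ▸ hq
    · exact hj j (Nat.one_le_iff_ne_zero.2 fun h => h2 (Fin.ext h)) (Fin.val_lt_last h1)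

theorem finite_normalFormSpace {w : Fin (m + 1) → ℕ} (hw : ∀ i, 0 < w i) (N : ℤ)
    (B : Finset (Fin (m + 1) →₀ ℕ)) (j : Fin (m + 1)) :
    Module.Finite 𝕜 (normalFormSpace (𝕜 := 𝕜) w N B j) := by
  by_cases h1 : j = Fin.last m
  · rw [normalFormSpace, if_pos h1]
    exact finite_monomialSpan B
  by_cases h2 : j = 0
  · rw [normalFormSpace, if_neg h1, if_pos h2]
    exact finite_quasihomogeneousPolys hw _
  · rw [normalFormSpace, if_neg h1, if_neg h2]
    have := finite_monomialSpan (𝕜 := 𝕜) (B.filter fun a =>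
      monomialDegree w a = ((j : ℤ) + 1) * N - ∑ i, (w i : ℤ))
    rwa [Finset.coe_filter] at this

/-- The index `j` of a middle space, `1 ≤ j < m`, corresponds to the summand `j + 1`. -/
theorem sum_finrank_normalFormSpace (hm : 1 ≤ m) (w : Fin (m + 1) → ℕ) (N : ℤ)
    (B : Finset (Fin (m + 1) →₀ ℕ)) :
    ∑ j, Module.finrank 𝕜 (normalFormSpace (𝕜 := 𝕜) w N B j) =
      B.card + ∑ j ∈ Finset.Icc 2 m,
        (B.filter fun a => monomialDegree w a = (j : ℤ) * N - ∑ i, (w i : ℤ)).card +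
      Module.finrank 𝕜 (quasihomogeneousPolys 𝕜 w (N - ∑ i, (w i : ℤ))) := by
  obtain ⟨m, rfl⟩ : ∃ k, m = k + 1 := ⟨m - 1, by omega⟩
  have hlast : Module.finrank 𝕜 (normalFormSpace (𝕜 := 𝕜) w N B (Fin.last (m + 1))) = B.card := by
    rw [normalFormSpace, if_pos rfl]
    exact finrank_monomialSpan B
  have h0 : normalFormSpace (𝕜 := 𝕜) w N B 0 =
      quasihomogeneousPolys 𝕜 w (N - ∑ i, (w i : ℤ)) := by
    rw [normalFormSpace, if_neg (by simp [Fin.ext_iff]), if_pos rfl]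
  have hmid : ∀ j : Fin m, Module.finrank 𝕜
      (normalFormSpace (𝕜 := 𝕜) w N B (Fin.succ j).castSucc) =
      (B.filter fun a => monomialDegree w a =
        ((j + 2 : ℕ) : ℤ) * N - ∑ i, (w i : ℤ)).card := by
    intro j
    rw [normalFormSpace, if_neg (Fin.castSucc_ne_last _), if_neg (by simp [Fin.ext_iff]),
      ← finrank_monomialSpan (𝕜 := 𝕜), Finset.coe_filter]
    have : ((((Fin.succ j).castSucc : Fin (m + 1 + 1)) : ℕ) : ℤ) + 1 = ((j + 2 : ℕ) : ℤ) := by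
      simp
      ring
    rw [this]
  have hIcc : Finset.Icc 2 (m + 1) = Finset.Ico 2 (m + 2) := rfl
  rw [Fin.sum_univ_castSucc, Fin.sum_univ_succ, hlast, Fin.castSucc_zero, h0, hIcc,
    Finset.sum_Ico_eq_sum_range, ← Fin.sum_univ_eq_sum_range (fun k => (B.filter fun a =>
      monomialDegree w a = ((2 + k : ℕ) : ℤ) * N - ∑ i, (w i : ℤ)).card) (m + 2 - 2)]
  simp only [hmid]
  change _ + ∑ _ : Fin m, _ + _ = _ + ∑ _ : Fin m, _ + _
  simp only [add_comm 2]
  ring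

variable {A : FunctionAlgebra 𝕜 (m + 1)} {w : Fin (m + 1) → ℕ}
  {f : MvPolynomial (Fin (m + 1)) 𝕜} {B : Finset (Fin (m + 1) →₀ ℕ)}

/-- The class modulo the coboundaries of the form `(∑ f^{m-j} h_j) ω` assembled from the
coefficients `h_j` of a normal form. -/
def normalFormClass (A : FunctionAlgebra 𝕜 (m + 1)) (w : Fin (m + 1) → ℕ) (N : ℤ)
    (f : MvPolynomial (Fin (m + 1)) 𝕜) (B : Finset (Fin (m + 1) →₀ ℕ)) :
    ((j : Fin (m + 1)) → normalFormSpace (𝕜 := 𝕜) w N B j) →ₗ[𝕜]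
      (DForm A.carrier (m + 1) (m + 1) ⧸ dOpCoboundaries A.D (A.ofPoly f) m) :=
  (dOpCoboundaries A.D (A.ofPoly f) m).mkQ ∘ₗ
    smulVol 𝕜 A.carrier (m + 1) ∘ₗ A.ofPoly.toLinearMap ∘ₗ
    ∑ j : Fin (m + 1), LinearMap.mulLeft 𝕜 (f ^ (m - (j : ℕ))) ∘ₗ
      (normalFormSpace w N B j).subtype ∘ₗ LinearMap.proj j

theorem normalFormClass_apply (N : ℤ) (h : (j : Fin (m + 1)) → normalFormSpace (𝕜 := 𝕜) w N B j) :
    normalFormClass A w N f B h = Submodule.Quotient.mk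
      (A.ofPoly (∑ j : Fin (m + 1), f ^ (m - (j : ℕ)) * (h j).1) • vol A.carrier (m + 1)) := by
  change Submodule.Quotient.mk (smulVol 𝕜 A.carrier (m + 1) (A.ofPoly (_))) = _
  simp only [LinearMap.sum_apply]
  rfl

namespace FunctionAlgebra.EulerSolvable

variable [CharZero 𝕜]

theorem existsUnique_normalForm (hm : 1 ≤ m) (hA : A.EulerSolvable w) (hw : ∀ i, 0 < w i) {N : ℤ}
    (hf : IsQuasihomogeneous w f N) [Module.Finite 𝕜 (A.Q (A.ofPoly f))]
    (hB : A.IsMonomialBasis (A.ofPoly f) B) (α : DForm A.carrier (m + 1) (m + 1)) :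
    ∃! h : Fin (m + 1) → MvPolynomial (Fin (m + 1)) 𝕜, (∀ j, h j ∈ normalFormSpace w N B j) ∧
      α - A.ofPoly (∑ j : Fin (m + 1), f ^ (m - (j : ℕ)) * h j) • vol A.carrier (m + 1) ∈
        dOpCoboundaries A.D (A.ofPoly f) m := by
  obtain ⟨h, hh, hX⟩ := hA.exists_normalForm hm hw hf hB (α (frame A.carrier (m + 1)))
  refine ⟨h, ⟨hh, (sub_smul_vol_mem_iff _ _ _ _).2 hX⟩, ?_⟩
  rintro h' ⟨hh', hX'⟩
  obtain ⟨X, hX⟩ := hX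
  obtain ⟨X', hX'⟩ := (sub_smul_vol_mem_iff _ _ _ _).1 hX'
  refine sub_eq_zero.1 (hA.normalForm_eq_zero hm hw hf hB (h := h' - h) (X := X - X')
    (fun j => sub_mem (hh' j) (hh j)) ?_)
  rw [fieldOp_sub, ← hX, ← hX', sub_sub_sub_cancel_left, ← map_sub, ← Finset.sum_sub_distrib]
  simp only [← mul_sub, Pi.sub_apply]

theorem bijective_normalFormClass (hm : 1 ≤ m) (hA : A.EulerSolvable w) (hw : ∀ i, 0 < w i) {N : ℤ}
    (hf : IsQuasihomogeneous w f N) [Module.Finite 𝕜 (A.Q (A.ofPoly f))]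
    (hB : A.IsMonomialBasis (A.ofPoly f) B) :
    Function.Bijective (normalFormClass A w N f B) := by
  constructor
  · intro h h' hhh
    rw [normalFormClass_apply, normalFormClass_apply, Submodule.Quotient.eq] at hhh
    have := (hA.existsUnique_normalForm hm hw hf hB
      (A.ofPoly (∑ j : Fin (m + 1), f ^ (m - (j : ℕ)) * (h j).1) • vol A.carrier (m + 1))).unique
      ⟨fun j => (h j).2, by rw [sub_self]; exact zero_mem _⟩ ⟨fun j => (h' j).2, hhh⟩
    funext j
    exact Subtype.ext (congrFun this j)
  · intro q
    obtain ⟨α, rfl⟩ := Submodule.Quotient.mk_surjective _ q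
    obtain ⟨h, ⟨hh, hα⟩, -⟩ := hA.existsUnique_normalForm hm hw hf hB α
    refine ⟨fun j => ⟨h j, hh j⟩, ?_⟩
    rw [normalFormClass_apply]
    exact ((Submodule.Quotient.eq _).2 hα).symm

theorem finite_finrank_npCohomology (hm : 1 ≤ m) (hA : A.EulerSolvable w) (hw : ∀ i, 0 < w i)
    {N : ℤ} (hf : IsQuasihomogeneous w f N) [Module.Finite 𝕜 (A.Q (A.ofPoly f))]
    (hB : A.IsMonomialBasis (A.ofPoly f) B) :
    Module.Finite 𝕜 (NPCohomology A.D (topVector (A.ofPoly f)) (m + 1)) ∧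
    Module.finrank 𝕜 (NPCohomology A.D (topVector (A.ofPoly f)) (m + 1)) =
      ∑ j, Module.finrank 𝕜 (normalFormSpace (𝕜 := 𝕜) w N B j) := by
  have hfin := finite_normalFormSpace (𝕜 := 𝕜) hw N B
  let e := (LinearEquiv.ofBijective _ (hA.bijective_normalFormClass hm hw hf hB)).trans
    (npCohomologyEquiv hm A.D (A.ofPoly f)).symm
  exact ⟨Module.Finite.equiv e, by rw [← e.finrank_eq, Module.finrank_pi_fintype]⟩

end FunctionAlgebra.EulerSolvable

theorem FunctionAlgebra.IsLocal.eulerSolvable {n : ℕ} {𝕜 : Type} [RCLike 𝕜]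
    {A : FunctionAlgebra 𝕜 n} (hA : A.IsLocal) (w : Fin n → ℕ) :
    A.EulerSolvable w := by
  cases hA with
  | formal => exact eulerSolvable_formalFunctions w
  | analytic =>
    exact eulerSolvable_germFunctions le_rfl le_top
      (fun _ hg v k => eventually_contDiffAt_dilationMean_omega hg v k) w
  | smooth =>
    exact eulerSolvable_germFunctions le_rfl (by exact_mod_cast le_top)
      (fun _ hg v k => eventually_contDiffAt_dilationMean_infty hg v k) w

end Cohomology

end NambuPoisson

end

open NambuPoisson in
theorem mainTheorem2 {𝕜 : Type} [RCLike 𝕜] {m : ℕ} (hm : 3 ≤ m + 1)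
    (A : FunctionAlgebra 𝕜 (m + 1)) (hA : A.IsLocal)
    (w : Fin (m + 1) → ℕ) (hw : ∀ i, 0 < w i) (N : ℤ)
    (f : MvPolynomial (Fin (m + 1)) 𝕜) (hf : IsQuasihomogeneous w f N)
    (hfin : Module.Finite 𝕜 (A.Q (A.ofPoly f)))
    (B : Finset (Fin (m + 1) →₀ ℕ)) (hB : A.IsMonomialBasis (A.ofPoly f) B) :
    (∀ α : DForm A.carrier (m + 1) (m + 1),
      ∃! h : Fin (m + 1) → MvPolynomial (Fin (m + 1)) 𝕜,
        IsQuasihomogeneous w (h 0) (N - ∑ i, (w i : ℤ)) ∧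
        (∀ j : Fin (m + 1), 1 ≤ (j : ℕ) → (j : ℕ) < m →
          h j ∈ monomialSpan 𝕜
            {a | a ∈ B ∧ monomialDegree w a = ((j : ℤ) + 1) * N - ∑ i, (w i : ℤ)}) ∧
        h (Fin.last m) ∈ monomialSpan 𝕜 {a | a ∈ B} ∧
        α - A.ofPoly (∑ j : Fin (m + 1), f ^ (m - (j : ℕ)) * h j) • vol A.carrier (m + 1) ∈
          dOpCoboundaries A.D (A.ofPoly f) m) ∧
    Module.Finite 𝕜 (NPCohomology A.D (topVector (A.ofPoly f)) (m + 1)) ∧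
    Module.finrank 𝕜 (NPCohomology A.D (topVector (A.ofPoly f)) (m + 1)) =
      Module.finrank 𝕜 (A.Q (A.ofPoly f)) +
      ∑ j ∈ Finset.Icc 2 m,
        (B.filter fun a => monomialDegree w a = (j : ℤ) * N - ∑ i, (w i : ℤ)).card +
      Module.finrank 𝕜 (quasihomogeneousPolys 𝕜 w (N - ∑ i, (w i : ℤ))) := by
  have hm1 : 1 ≤ m := by omega
  have hE := hA.eulerSolvable w
  refine ⟨fun α => ?_, ?_⟩
  · have h := hE.existsUnique_normalForm hm1 hw hf hB α
    simpa only [mem_normalFormSpace_iff hm1, and_assoc] using h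
  · rw [finrank_Q_eq_card hB, ← sum_finrank_normalFormSpace hm1]
    exact hE.finite_finrank_npCohomology hm1 hw hf hB
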